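/- All homology and cohomology is singular with rational coefficients. Let $G$ be a topological group, let $B$ and $L$ be closed topological manifolds of dimensions $b$ and $c$, and let $G$ act continuously on $L$. Let $\pi\colon E\to B$ be a fiber bundle with fiber $L$ and structure group $G$, that is, $E=P\times_G L$ for an underlying principal $G$-bundle $P\to B$. Assume that $\pi$ is a global product as a bundle with structure group $G$, i.e. $P\cong B\times G$ as principal $G$-bundles over $B$; thus $E= B\times L$ over $B$, and $\dim E=b+c$. A *$G$-equivariant Moore approximation* of $L$ of degree $m\in\mathbb Z$ is a $G$-space $L_{<m}$ with a continuous $G$-equivariant map $f_{<m}\colon L_{<m}\to L$ such that $H_r(f_{<m})$ is an isomorphism for $r<m$ and $H_r(L_{<m})=0$ for $r\ge m$. Given one, let $\mathrm{ft}_{<m}E=P\times_G L_{<m}$, with its projection to $B$ and with the map $F_{<m}\colon \mathrm{ft}_{<m}E\to E$ induced by $f_{<m}$; let $\mathrm{ft}_{\ge m}E$ be the homotopy pushout of $B\leftarrow \mathrm{ft}_{<m}E\xrightarrow{F_{<m}}E$, with canonical maps $\sigma\colon B\to \mathrm{ft}_{\ge m}E$ and $c_{\ge m}\colon E\to \mathrm{ft}_{\ge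 m}E$; let $Q_{\ge m}E$ be the mapping cone of $\sigma$, pointed by its cone point; and let $C_{\ge m}\colon E\to Q_{\ge m}E$ be the composition of $c_{\ge m}$ with the inclusion $\mathrm{ft}_{\ge m}E\to Q_{\ge m}E$. Reduced cohomology $\widetilde H^*(Q_{\ge m}E)$ is cohomology relative to the cone point, i.e. the kernel of the restriction $H^*(Q_{\ge m}E)\to H^*(\mathrm{pt})$. Let $\bar p,\bar q$ be complementary perversities, i.e. integer-valued functions of the codimension $j\geq 1$ with $\bar p(j)+\bar q(j)=j-2$ for all $j$, and put $$k=c-\bar p(c+1),\qquad l=c-\bar q(c+1).$$ Suppose given $G$-equivariant Moore approximations of $L$ of degree $k$ and of degree $l$. Then for every $i\ge 0$ the local duality obstruction $$\mathrm{ob}_i(\pi,k,l)=\{\,C_{\ge k}^*(x)\cup C_{\ge l}^*(y)\;:\;x\in\widetilde H^i(Q_{\ge k}E),\ y\in\widetilde H^{b+c-i}(Q_{\ge l}E)\,\}\subset H^{b+c}(E)$$ vanishes, i.e. $\mathrm{ob}_i(\pi,k,l)=\{0\}$. -/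

import Mathlib

universe u

noncomputable section

namespace LocalDuality

open CategoryTheory

/-! ## Rational singular homology and cohomology, cup product -/

/-- Singular homology `H_r(-; ℚ)`. -/
def ratHomology (r : ℕ) : TopCat.{u} ⥤ ModuleCat.{u} ℚ :=
  (AlgebraicTopology.singularHomologyFunctor.{u} (ModuleCat.{u} ℚ) r).obj
    (ModuleCat.of ℚ (ULift.{u} ℚ))

section Simplicial

open Simplicial

/-- Rational `n`-cochains of a simplicial set. -/
abbrev Cochain (S : SSet.{u}) (n : ℕ) : Type u := S _⦋n⦌ → ℚ

/-- The coboundary `(d φ)(σ) = ∑ i, (-1)^i φ(∂_i σ)`. -/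
def coboundary (S : SSet.{u}) (n : ℕ) : Cochain S n →ₗ[ℚ] Cochain S (n + 1) where
  toFun φ := fun σ => ∑ i : Fin (n + 2), (-1 : ℚ) ^ (i : ℕ) * φ (S.δ i σ)
  map_add' φ ψ := by
    funext σ
    simp [mul_add, Finset.sum_add_distrib]
  map_smul' a φ := by
    funext σ
    simp only [Pi.smul_apply, smul_eq_mul, RingHom.id_apply, Finset.mul_sum]
    exact Finset.sum_congr rfl fun i _ => by ring

/-- The cocycles of degree `n`. -/
abbrev cocycles (S : SSet.{u}) (n : ℕ) : Submodule ℚ (Cochain S n) :=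
  LinearMap.ker (coboundary S n)

/-- The coboundaries of degree `n`. -/
def coboundaries (S : SSet.{u}) (n : ℕ) : Submodule ℚ (Cochain S n) :=
  match n with
  | 0 => ⊥
  | m + 1 => LinearMap.range (coboundary S m)

/-- Cocycles modulo coboundaries. -/
abbrev SCohomology (S : SSet.{u}) (n : ℕ) : Type u :=
  cocycles S n ⧸ (coboundaries S n).submoduleOf (cocycles S n)

/-- The class of a cocycle. -/
def classOf (S : SSet.{u}) (n : ℕ) : cocycles S n →ₗ[ℚ] SCohomology S n :=
  Submodule.mkQ _

/-- Pullback of cochains along a simplicial map. -/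
def cochainMap {S T : SSet.{u}} (f : S ⟶ T) (n : ℕ) : Cochain T n →ₗ[ℚ] Cochain S n where
  toFun φ := fun σ => φ (f.app (Opposite.op ⦋n⦌) σ)
  map_add' _ _ := rfl
  map_smul' _ _ := rfl

theorem coboundary_cochainMap {S T : SSet.{u}} (f : S ⟶ T) (n : ℕ) (φ : Cochain T n) :
    coboundary S n (cochainMap f n φ) = cochainMap f (n + 1) (coboundary T n φ) := by
  funext σ
  change (∑ i : Fin (n + 2), (-1 : ℚ) ^ (i : ℕ) * φ (f.app (Opposite.op ⦋n⦌) (S.δ i σ))) =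
    ∑ i : Fin (n + 2), (-1 : ℚ) ^ (i : ℕ) * φ (T.δ i (f.app (Opposite.op ⦋n + 1⦌) σ))
  refine Finset.sum_congr rfl fun i _ => ?_
  exact congr_arg (fun z => (-1 : ℚ) ^ (i : ℕ) * φ z)
    (ConcreteCategory.congr_hom (SimplicialObject.δ_naturality f i) σ)

theorem cochainMap_mem_cocycles {S T : SSet.{u}} (f : S ⟶ T) (n : ℕ) (φ : Cochain T n)
    (h : φ ∈ cocycles T n) : cochainMap f n φ ∈ cocycles S n := by
  rw [LinearMap.mem_ker] at h ⊢
  rw [coboundary_cochainMap, h, map_zero]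

theorem cochainMap_mem_coboundaries {S T : SSet.{u}} (f : S ⟶ T) (n : ℕ) (φ : Cochain T n)
    (h : φ ∈ coboundaries T n) : cochainMap f n φ ∈ coboundaries S n := by
  cases n with
  | zero =>
    rw [show φ = 0 from h, map_zero]
    exact Submodule.zero_mem _
  | succ n =>
    obtain ⟨ψ, rfl⟩ := h
    exact ⟨cochainMap f n ψ, coboundary_cochainMap f n ψ⟩

/-- The map induced on cohomology by a simplicial map. -/
def sCohomologyMap {S T : SSet.{u}} (f : S ⟶ T) (n : ℕ) :
    SCohomology T n →ₗ[ℚ] SCohomology S n :=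
  Submodule.mapQ _ _
    ((cochainMap f n).restrict fun φ h => cochainMap_mem_cocycles f n φ h)
    (fun φ h => cochainMap_mem_coboundaries f n φ.1 h)

/-- The front `p`-face `[0, …, p] → [0, …, n]`. -/
def front {p q n : ℕ} (h : p + q = n) : ⦋p⦌ ⟶ ⦋n⦌ :=
  SimplexCategory.Hom.mk
    { toFun := fun i => ⟨i.1, by have := i.2; simp only [SimplexCategory.len_mk] at *; omega⟩
      monotone' := fun _ _ hij => hij }

/-- The back `q`-face `[0, …, q] → [0, …, n]`, `i ↦ p + i`. -/
def back {p q n : ℕ} (h : p + q = n) : ⦋q⦌ ⟶ ⦋n⦌ :=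
  SimplexCategory.Hom.mk
    { toFun := fun i => ⟨p + i.1, by have := i.2; simp only [SimplexCategory.len_mk] at *; omega⟩
      monotone' := fun _ _ hij => Nat.add_le_add_left hij p }

/-- The cup product of cochains: `(φ ∪ ψ)(σ) = φ(front face of σ) ψ(back face of σ)`. -/
def cochainCup (S : SSet.{u}) {p q n : ℕ} (h : p + q = n) (φ : Cochain S p) (ψ : Cochain S q) :
    Cochain S n :=
  fun σ => φ (S.map (front h).op σ) * ψ (S.map (back h).op σ)

theorem δ_val {n : ℕ} (j : Fin (n + 2)) (k : Fin (n + 1)) :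
    ((SimplexCategory.δ j).toOrderHom k : ℕ) = if k.1 < j.1 then k.1 else k.1 + 1 := by
  change ((j.succAbove k : Fin (n + 2)) : ℕ) = _
  simp only [Fin.succAbove, Fin.lt_def, Fin.val_castSucc]
  split_ifs <;> rfl

theorem δ_comp_front_low {p q n : ℕ} (h : p + q = n) (h' : p + 1 + q = n + 1) (i : Fin (p + 2))
    (j : Fin (n + 2)) (hj : j.1 = i.1) :
    front h ≫ SimplexCategory.δ j = SimplexCategory.δ i ≫ front h' := by
  ext k : 3
  apply Fin.ext
  change ((SimplexCategory.δ j).toOrderHom ((front h).toOrderHom k) : ℕ)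
    = ((SimplexCategory.δ i).toOrderHom k : ℕ)
  rw [δ_val, δ_val, hj]
  rfl

theorem δ_comp_back_low {p q n : ℕ} (h : p + q = n) (h' : p + 1 + q = n + 1)
    (j : Fin (n + 2)) (hj : j.1 ≤ p) :
    back h ≫ SimplexCategory.δ j = back h' := by
  ext k : 3
  apply Fin.ext
  change ((SimplexCategory.δ j).toOrderHom ((back h).toOrderHom k) : ℕ) = p + 1 + k.1
  rw [δ_val]
  change (if p + k.1 < j.1 then p + k.1 else p + k.1 + 1) = p + 1 + k.1
  split_ifs <;> omega

theorem δ_comp_front_high {p q n : ℕ} (h : p + q = n) (h' : p + (q + 1) = n + 1)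
    (j : Fin (n + 2)) (hj : p < j.1) :
    front h ≫ SimplexCategory.δ j = front h' := by
  ext k : 3
  apply Fin.ext
  change ((SimplexCategory.δ j).toOrderHom ((front h).toOrderHom k) : ℕ) = k.1
  rw [δ_val]
  change (if k.1 < j.1 then k.1 else k.1 + 1) = k.1
  have := k.2
  simp only [SimplexCategory.len_mk] at this
  split_ifs <;> omega

theorem δ_comp_back_high {p q n : ℕ} (h : p + q = n) (h' : p + (q + 1) = n + 1) (i : Fin (q + 2))
    (j : Fin (n + 2)) (hj : j.1 = p + i.1) :
    back h ≫ SimplexCategory.δ j = SimplexCategory.δ i ≫ back h' := by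
  ext k : 3
  apply Fin.ext
  change ((SimplexCategory.δ j).toOrderHom ((back h).toOrderHom k) : ℕ)
    = p + ((SimplexCategory.δ i).toOrderHom k : ℕ)
  rw [δ_val, δ_val]
  change (if p + k.1 < j.1 then p + k.1 else p + k.1 + 1) = _
  split_ifs <;> omega

theorem δ_front_last {p q n : ℕ} (h : p + (q + 1) = n + 1) (h' : p + 1 + q = n + 1) :
    SimplexCategory.δ (Fin.last (p + 1)) ≫ front h' = front h := by
  ext k : 3
  apply Fin.ext
  change ((SimplexCategory.δ (Fin.last (p + 1))).toOrderHom k : ℕ) = k.1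
  have := k.2
  simp only [SimplexCategory.len_mk] at this
  rw [δ_val, Fin.val_last, if_pos (by omega)]

theorem δ_back_zero {p q n : ℕ} (h : p + (q + 1) = n + 1) (h' : p + 1 + q = n + 1) :
    SimplexCategory.δ (0 : Fin (q + 2)) ≫ back h = back h' := by
  ext k : 3
  apply Fin.ext
  change p + ((SimplexCategory.δ (0 : Fin (q + 2))).toOrderHom k : ℕ) = p + 1 + k.1
  rw [δ_val, Fin.val_zero, if_neg (by omega)]
  omega

theorem map_comp_apply (S : SSet.{u}) {a b c : ℕ} (f : ⦋a⦌ ⟶ ⦋b⦌) (g : ⦋b⦌ ⟶ ⦋c⦌)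
    (σ : S _⦋c⦌) : (S.map f.op (S.map g.op σ) : S _⦋a⦌) = S.map (f ≫ g).op σ := by
  rw [op_comp, Functor.map_comp]
  rfl

theorem fin_sum_split {p q n : ℕ} (h : p + q = n) (f : ℕ → ℚ) :
    ∑ i : Fin (n + 2), f i = (∑ i : Fin (p + 1), f i) + ∑ i : Fin (q + 1), f (p + 1 + i) := by
  subst h
  rw [Fin.sum_univ_eq_sum_range, Fin.sum_univ_eq_sum_range,
    Fin.sum_univ_eq_sum_range (fun i => f (p + 1 + i)),
    show p + q + 2 = (p + 1) + (q + 1) by omega, Finset.sum_range_add]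

/-- The Leibniz rule `d(φ ∪ ψ) = dφ ∪ ψ + (-1)^p φ ∪ dψ`. -/
theorem coboundary_cochainCup (S : SSet.{u}) {p q n : ℕ} (h : p + q = n)
    (h₁ : p + 1 + q = n + 1) (h₂ : p + (q + 1) = n + 1) (φ : Cochain S p) (ψ : Cochain S q) :
    coboundary S n (cochainCup S h φ ψ) =
      cochainCup S h₁ (coboundary S p φ) ψ +
        (-1 : ℚ) ^ p • cochainCup S h₂ φ (coboundary S q ψ) := by
  funext σ
  let F : ℕ → ℚ := fun i => if hi : i < n + 2 then
    (-1 : ℚ) ^ i * cochainCup S h φ ψ (S.δ ⟨i, hi⟩ σ) else 0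
  have hL : coboundary S n (cochainCup S h φ ψ) σ = ∑ i : Fin (n + 2), F i := by
    change (∑ i : Fin (n + 2), (-1 : ℚ) ^ (i : ℕ) * cochainCup S h φ ψ (S.δ i σ)) = _
    refine Finset.sum_congr rfl fun i _ => ?_
    simp only [F, i.2, dif_pos]
  have e₁ : cochainCup S h₁ (coboundary S p φ) ψ σ =
      (∑ i : Fin (p + 1), F i) +
        (-1 : ℚ) ^ (p + 1) * (φ (S.map (front h₂).op σ) * ψ (S.map (back h₁).op σ)) := by
    change (∑ i : Fin (p + 2), (-1 : ℚ) ^ (i : ℕ) * φ (S.map (SimplexCategory.δ i).op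
      (S.map (front h₁).op σ))) * ψ (S.map (back h₁).op σ) = _
    rw [Fin.sum_univ_castSucc, add_mul, Finset.sum_mul]
    congr 1
    · refine Finset.sum_congr rfl fun i _ => ?_
      have hi : i.1 < n + 2 := by have := i.2; omega
      simp only [F, hi, dif_pos]
      change _ = (-1 : ℚ) ^ i.1 * (φ (S.map (front h).op (S.map (SimplexCategory.δ ⟨i.1, hi⟩).op σ))
        * ψ (S.map (back h).op (S.map (SimplexCategory.δ ⟨i.1, hi⟩).op σ)))
      rw [map_comp_apply, map_comp_apply, map_comp_apply,
        δ_comp_front_low h h₁ i.castSucc ⟨i.1, hi⟩ rfl,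
        δ_comp_back_low h h₁ ⟨i.1, hi⟩ (by have := i.2; simp only; omega), Fin.val_castSucc]
      ring
    · rw [map_comp_apply, δ_front_last h₂ h₁, Fin.val_last]
      ring
  have e₂ : cochainCup S h₂ φ (coboundary S q ψ) σ =
      φ (S.map (front h₂).op σ) * ψ (S.map (back h₁).op σ) +
        (-1 : ℚ) ^ p * ∑ i : Fin (q + 1), F (p + 1 + i) := by
    change φ (S.map (front h₂).op σ) * (∑ i : Fin (q + 2), (-1 : ℚ) ^ (i : ℕ) *
      ψ (S.map (SimplexCategory.δ i).op (S.map (back h₂).op σ))) = _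
    rw [Fin.sum_univ_succ, mul_add, Finset.mul_sum, Finset.mul_sum]
    congr 1
    · rw [map_comp_apply, δ_back_zero h₂ h₁, Fin.val_zero]
      ring
    · refine Finset.sum_congr rfl fun i _ => ?_
      have hi : p + 1 + i.1 < n + 2 := by have := i.2; omega
      simp only [F, hi, dif_pos]
      change _ = (-1 : ℚ) ^ p * ((-1 : ℚ) ^ (p + 1 + i.1) *
        (φ (S.map (front h).op (S.map (SimplexCategory.δ ⟨p + 1 + i.1, hi⟩).op σ))
        * ψ (S.map (back h).op (S.map (SimplexCategory.δ ⟨p + 1 + i.1, hi⟩).op σ))))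
      rw [map_comp_apply, map_comp_apply, map_comp_apply,
        δ_comp_front_high h h₂ ⟨p + 1 + i.1, hi⟩ (by simp only; omega),
        δ_comp_back_high h h₂ i.succ ⟨p + 1 + i.1, hi⟩ (by simp only [Fin.val_succ]; omega),
        Fin.val_succ]
      have hs : (-1 : ℚ) ^ p * (-1 : ℚ) ^ p = 1 := by rw [← mul_pow]; norm_num
      rw [show p + 1 + i.1 = p + (i.1 + 1) by omega, pow_add (-1 : ℚ) p (i.1 + 1)]
      linear_combination (-(-1 : ℚ) ^ (i.1 + 1) * φ (S.map (front h₂).op σ) *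
        ψ (S.map (SimplexCategory.δ i.succ ≫ back h₂).op σ)) * hs
  have hs : (-1 : ℚ) ^ p * (-1 : ℚ) ^ p = 1 := by rw [← mul_pow]; norm_num
  rw [hL, fin_sum_split h F, Pi.add_apply, Pi.smul_apply, smul_eq_mul, e₁, e₂]
  linear_combination (-∑ i : Fin (q + 1), F (p + 1 + i)) * hs

theorem cochainCup_mem_cocycles (S : SSet.{u}) {p q n : ℕ} (h : p + q = n) (φ : Cochain S p)
    (ψ : Cochain S q) (hφ : φ ∈ cocycles S p) (hψ : ψ ∈ cocycles S q) :
    cochainCup S h φ ψ ∈ cocycles S n := by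
  rw [LinearMap.mem_ker] at *
  rw [coboundary_cochainCup S h (by omega) (by omega), hφ, hψ]
  funext σ
  simp [cochainCup]

theorem cochainCup_mem_coboundaries_left (S : SSet.{u}) {p q n : ℕ} (h : p + q = n)
    (φ : Cochain S p) (ψ : Cochain S q) (hφ : φ ∈ coboundaries S p) (hψ : ψ ∈ cocycles S q) :
    cochainCup S h φ ψ ∈ coboundaries S n := by
  cases p with
  | zero =>
    rw [show φ = 0 from hφ, show cochainCup S h 0 ψ = 0 by funext σ; simp [cochainCup]]
    exact Submodule.zero_mem _
  | succ p =>
    obtain ⟨χ, rfl⟩ := hφ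
    obtain ⟨m, rfl⟩ : ∃ m, n = m + 1 := ⟨p + q, by omega⟩
    refine ⟨cochainCup S (show p + q = m by omega) χ ψ, ?_⟩
    rw [LinearMap.mem_ker] at hψ
    rw [coboundary_cochainCup S _ h (by omega), hψ]
    funext σ
    simp [cochainCup]

theorem cochainCup_mem_coboundaries_right (S : SSet.{u}) {p q n : ℕ} (h : p + q = n)
    (φ : Cochain S p) (ψ : Cochain S q) (hφ : φ ∈ cocycles S p) (hψ : ψ ∈ coboundaries S q) :
    cochainCup S h φ ψ ∈ coboundaries S n := by
  cases q with
  | zero =>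
    rw [show ψ = 0 from hψ, show cochainCup S h φ 0 = 0 by funext σ; simp [cochainCup]]
    exact Submodule.zero_mem _
  | succ q =>
    obtain ⟨χ, rfl⟩ := hψ
    obtain ⟨m, rfl⟩ : ∃ m, n = m + 1 := ⟨p + q, by omega⟩
    refine ⟨(-1 : ℚ) ^ p • cochainCup S (show p + q = m by omega) φ χ, ?_⟩
    rw [LinearMap.mem_ker] at hφ
    rw [map_smul, coboundary_cochainCup S _ (by omega) h, hφ, smul_add, smul_smul, ← mul_pow]
    funext σ
    simp [cochainCup]

/-- The cup product of cocycles, with values in cohomology. -/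
def cocycleCup (S : SSet.{u}) {p q n : ℕ} (h : p + q = n) :
    cocycles S p →ₗ[ℚ] cocycles S q →ₗ[ℚ] SCohomology S n :=
  LinearMap.mk₂ ℚ
    (fun φ ψ => classOf S n ⟨cochainCup S h φ.1 ψ.1,
      cochainCup_mem_cocycles S h φ.1 ψ.1 φ.2 ψ.2⟩)
    (fun φ φ' ψ => by
      rw [← map_add]
      exact congr_arg _ (Subtype.ext (by funext σ; simp [cochainCup, add_mul])))
    (fun a φ ψ => by
      rw [← map_smul]
      exact congr_arg _ (Subtype.ext (by funext σ; simp [cochainCup, mul_assoc])))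
    (fun φ ψ ψ' => by
      rw [← map_add]
      exact congr_arg _ (Subtype.ext (by funext σ; simp [cochainCup, mul_add])))
    (fun a φ ψ => by
      rw [← map_smul]
      exact congr_arg _ (Subtype.ext (by funext σ; simp [cochainCup, mul_left_comm])))

theorem classOf_eq_zero (S : SSet.{u}) (n : ℕ) (φ : cocycles S n)
    (h : φ.1 ∈ coboundaries S n) : classOf S n φ = 0 :=
  (Submodule.Quotient.mk_eq_zero _).2 h

/-- The cup product `H^p × H^q → H^{p+q}`. -/
def sCup (S : SSet.{u}) {p q n : ℕ} (h : p + q = n) :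
    SCohomology S p →ₗ[ℚ] SCohomology S q →ₗ[ℚ] SCohomology S n :=
  Submodule.liftQ _
    (LinearMap.flip (Submodule.liftQ _ (cocycleCup S h).flip (fun ψ hψ => by
      refine LinearMap.mem_ker.2 (LinearMap.ext fun φ => ?_)
      exact classOf_eq_zero S n _
        (cochainCup_mem_coboundaries_right S h φ.1 ψ.1 φ.2 hψ))))
    (fun φ hφ => by
      refine LinearMap.mem_ker.2 (LinearMap.ext fun y => ?_)
      obtain ⟨ψ, rfl⟩ := Submodule.mkQ_surjective _ y
      exact classOf_eq_zero S n _
        (cochainCup_mem_coboundaries_left S h φ.1 ψ.1 hφ ψ.2))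

theorem sCup_classOf (S : SSet.{u}) {p q n : ℕ} (h : p + q = n) (φ : cocycles S p)
    (ψ : cocycles S q) :
    sCup S h (classOf S p φ) (classOf S q ψ) = classOf S n ⟨cochainCup S h φ.1 ψ.1,
      cochainCup_mem_cocycles S h φ.1 ψ.1 φ.2 ψ.2⟩ := rfl

end Simplicial

/-- Rational singular cohomology `H^n(X; ℚ)`. -/
abbrev H (X : Type u) [TopologicalSpace X] (n : ℕ) : Type u :=
  SCohomology (TopCat.toSSet.obj (TopCat.of X)) n

/-- The map `f^* : H^n(Y; ℚ) → H^n(X; ℚ)` induced by a continuous map. -/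
def pullback {X Y : Type u} [TopologicalSpace X] [TopologicalSpace Y] (f : C(X, Y)) (n : ℕ) :
    H Y n →ₗ[ℚ] H X n :=
  sCohomologyMap (TopCat.toSSet.map (TopCat.ofHom f)) n

/-- The cup product on rational singular cohomology. -/
def cup (X : Type u) [TopologicalSpace X] {p q n : ℕ} (h : p + q = n) :
    H X p →ₗ[ℚ] H X q →ₗ[ℚ] H X n :=
  sCup (TopCat.toSSet.obj (TopCat.of X)) h

/-- Reduced cohomology of the pointed space `(X, x₀)`: the kernel of restriction to the base
point. The long exact sequence of the pair, split by `X → {x₀}`, identifies it with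
`H^n(X, {x₀})`; it is all of `H^n(X)` for `n > 0`. -/
def reducedH {X : Type u} [TopologicalSpace X] (x₀ : X) (n : ℕ) : Submodule ℚ (H X n) :=
  LinearMap.ker (pullback (ContinuousMap.const PUnit.{u + 1} x₀) n)

/-! ## Homotopy pushouts -/

section HomotopyPushout

variable {X Y₁ Y₂ : Type u} [TopologicalSpace X] [TopologicalSpace Y₁] [TopologicalSpace Y₂]

/-- The gluing relation `(x, 0) ∼ f₁ x`, `(x, 1) ∼ f₂ x`. -/
inductive GlueRel (f₁ : C(X, Y₁)) (f₂ : C(X, Y₂)) :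
    (X × unitInterval) ⊕ (Y₁ ⊕ Y₂) → (X × unitInterval) ⊕ (Y₁ ⊕ Y₂) → Prop
  | left (x : X) : GlueRel f₁ f₂ (Sum.inl (x, 0)) (Sum.inr (Sum.inl (f₁ x)))
  | right (x : X) : GlueRel f₁ f₂ (Sum.inl (x, 1)) (Sum.inr (Sum.inr (f₂ x)))

/-- The homotopy pushout of `Y₁ ← X → Y₂`: the quotient of `X × [0,1] ⊔ Y₁ ⊔ Y₂` by the
equivalence relation generated by the gluing relation, with the quotient topology. -/
def HomotopyPushout (f₁ : C(X, Y₁)) (f₂ : C(X, Y₂)) : Type u :=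
  Quot (GlueRel f₁ f₂)

instance (f₁ : C(X, Y₁)) (f₂ : C(X, Y₂)) : TopologicalSpace (HomotopyPushout f₁ f₂) :=
  inferInstanceAs (TopologicalSpace (Quot _))

/-- The canonical map `Y₁ → Y₁ ∪_X Y₂`. -/
def HomotopyPushout.inl (f₁ : C(X, Y₁)) (f₂ : C(X, Y₂)) : C(Y₁, HomotopyPushout f₁ f₂) where
  toFun y := Quot.mk _ (Sum.inr (Sum.inl y))
  continuous_toFun := continuous_quot_mk.comp (continuous_inr.comp continuous_inl)

/-- The canonical map `Y₂ → Y₁ ∪_X Y₂`. -/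
def HomotopyPushout.inr (f₁ : C(X, Y₁)) (f₂ : C(X, Y₂)) : C(Y₂, HomotopyPushout f₁ f₂) where
  toFun y := Quot.mk _ (Sum.inr (Sum.inr y))
  continuous_toFun := continuous_quot_mk.comp (continuous_inr.comp continuous_inr)

end HomotopyPushout

/-! ## Equivariant Moore approximations -/

/-- A `G`-equivariant rational Moore approximation of degree `k` of the `G`-space `L`. -/
structure MooreApproximation (G L : Type u) [Group G] [TopologicalSpace G] [TopologicalSpace L]
    [MulAction G L] (k : ℤ) where
  /-- The `G`-space `L_{<k}`. -/
  Space : Type u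
  [top : TopologicalSpace Space]
  [act : MulAction G Space]
  [contAct : ContinuousSMul G Space]
  /-- The structure map `f_{<k} : L_{<k} → L`. -/
  map : C(Space, L)
  equivariant : ∀ (g : G) (x : Space), map (g • x) = g • map x
  iso_of_lt : ∀ r : ℕ, (r : ℤ) < k → IsIso ((ratHomology.{u} r).map (TopCat.ofHom map))
  zero_of_ge : ∀ r : ℕ, k ≤ (r : ℤ) →
    Limits.IsZero ((ratHomology.{u} r).obj (TopCat.of Space))

attribute [instance] MooreApproximation.top MooreApproximation.act MooreApproximation.contAct

/-! ## Principal bundles and associated bundles -/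

/-- A trivialization `e` of `proj : P → B` with fiber `G` is a trivialization of principal bundles
if it carries the right action of `G` on `P` to right multiplication. -/
def IsPrincipalTrivialization {G B P : Type u} [Group G] [TopologicalSpace G]
    [TopologicalSpace B] [TopologicalSpace P] [MulAction Gᵐᵒᵖ P] {proj : P → B}
    (e : Bundle.Trivialization G proj) : Prop :=
  ∀ p ∈ e.source, ∀ g : G, (e (MulOpposite.op g • p)).2 = (e p).2 * g

/-- A (locally trivial) principal `G`-bundle `proj : P → B`; the group acts from the right. -/
structure PrincipalBundle (G B : Type u) [Group G] [TopologicalSpace G] [TopologicalSpace B] where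
  /-- The total space. -/
  P : Type u
  [top : TopologicalSpace P]
  [act : MulAction Gᵐᵒᵖ P]
  [contAct : ContinuousSMul Gᵐᵒᵖ P]
  /-- The projection. -/
  proj : C(P, B)
  proj_smul : ∀ (g : G) (p : P), proj (MulOpposite.op g • p) = proj p
  locallyTrivial : ∀ b : B, ∃ e : Bundle.Trivialization G proj,
    b ∈ e.baseSet ∧ IsPrincipalTrivialization e

attribute [instance] PrincipalBundle.top PrincipalBundle.act PrincipalBundle.contAct

namespace PrincipalBundle

variable {G B : Type u} [Group G] [TopologicalSpace G] [TopologicalSpace B]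
  (ξ : PrincipalBundle G B)

/-- The principal bundle is globally trivial: isomorphic over `B` to `B × G`. -/
def IsTrivial : Prop :=
  ∃ e : Bundle.Trivialization G ξ.proj, e.baseSet = Set.univ ∧ IsPrincipalTrivialization e

/-- The relation `(p g, x) ∼ (p, g x)` on `P × X`. -/
def AssocRel (X : Type u) [MulAction G X] (a b : ξ.P × X) : Prop :=
  ∃ g : G, a.1 = MulOpposite.op g • b.1 ∧ b.2 = g • a.2

/-- The total space `P ×_G X` of the associated bundle with fiber the `G`-space `X`. -/
def Assoc (X : Type u) [MulAction G X] : Type u := Quot (ξ.AssocRel X)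

instance (X : Type u) [TopologicalSpace X] [MulAction G X] : TopologicalSpace (ξ.Assoc X) :=
  inferInstanceAs (TopologicalSpace (Quot _))

/-- The projection `P ×_G X → B`. -/
def assocProj (X : Type u) [TopologicalSpace X] [MulAction G X] : C(ξ.Assoc X, B) where
  toFun := Quot.lift (fun a => ξ.proj a.1) (by
    rintro ⟨p, x⟩ ⟨p', x'⟩ ⟨g, h, -⟩
    simp only at h
    simp only [h, ξ.proj_smul])
  continuous_toFun := continuous_quot_lift _ (ξ.proj.continuous.comp continuous_fst)

/-- The map `P ×_G X → P ×_G Y` induced by an equivariant map `f : X → Y`. -/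
def assocMap {X Y : Type u} [TopologicalSpace X] [MulAction G X] [TopologicalSpace Y]
    [MulAction G Y] (f : C(X, Y)) (hf : ∀ (g : G) (x : X), f (g • x) = g • f x) :
    C(ξ.Assoc X, ξ.Assoc Y) where
  toFun := Quot.lift (fun a => Quot.mk _ (a.1, f a.2)) (by
    rintro ⟨p, x⟩ ⟨p', x'⟩ ⟨g, h, h'⟩
    refine Quot.sound ⟨g, h, ?_⟩
    simp only at h' ⊢
    rw [h', hf])
  continuous_toFun := continuous_quot_lift _ (continuous_quot_mk.comp
    (continuous_fst.prodMk (f.continuous.comp continuous_snd)))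

end PrincipalBundle

/-! ## Fiber bundles with structure group, fiberwise truncation and cotruncation -/

/-- The structure, on a map `π : E → B`, of a fiber bundle with fiber the `G`-space `L` and
structure group `G`: an underlying principal `G`-bundle `P → B` and an identification
`P ×_G L ≅ E` over `B`. -/
structure BundleStructure (G L : Type u) [Group G] [TopologicalSpace G] [TopologicalSpace L]
    [MulAction G L] {E B : Type u} [TopologicalSpace E] [TopologicalSpace B] (π : C(E, B)) where
  /-- The underlying principal bundle. -/
  principal : PrincipalBundle G B
  /-- The identification of `E` with the associated bundle. -/
  homeo : principal.Assoc L ≃ₜ E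
  proj_homeo : ∀ z, π (homeo z) = principal.assocProj L z

namespace BundleStructure

variable {G L : Type u} [Group G] [TopologicalSpace G] [TopologicalSpace L]
    [MulAction G L] {E B : Type u} [TopologicalSpace E] [TopologicalSpace B] {π : C(E, B)}
    (β : BundleStructure G L π) {k l : ℤ} (M : MooreApproximation G L k)
    (N : MooreApproximation G L l)

/-- As a bundle with structure group `G`, the bundle is a global product: its underlying principal
bundle is trivial. -/
def IsGlobalProduct : Prop := β.principal.IsTrivial

/-- The fiberwise truncation `ft_{<k} E = P ×_G L_{<k}`. -/
abbrev Trunc : Type u := β.principal.Assoc M.Space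

/-- The projection `π_{<k} : ft_{<k} E → B`. -/
def truncProj : C(β.Trunc M, B) := β.principal.assocProj M.Space

/-- The structure map `F_{<k} : ft_{<k} E → E`. -/
def truncMap : C(β.Trunc M, E) :=
  (ContinuousMap.mk β.homeo β.homeo.continuous).comp
    (β.principal.assocMap M.map M.equivariant)

/-- The fiberwise cotruncation `ft_{≥k} E`: the homotopy pushout of `B ← ft_{<k} E → E`. -/
abbrev Cotrunc : Type u := HomotopyPushout (β.truncProj M) (β.truncMap M)

/-- The canonical section `σ : B → ft_{≥k} E`. -/
def section_ : C(B, β.Cotrunc M) := HomotopyPushout.inl _ _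

/-- The map `c_{≥k} : E → ft_{≥k} E`. -/
def cotruncMap : C(E, β.Cotrunc M) := HomotopyPushout.inr _ _

/-- The space `Q_{≥k} E`: the homotopy pushout of `⋆ ← B → ft_{≥k} E`, that is, the mapping cone
of the section `σ`. -/
abbrev Q : Type u :=
  HomotopyPushout (ContinuousMap.const B (PUnit.unit : PUnit.{u + 1})) (β.section_ M)

/-- The cone point of `Q_{≥k} E`. -/
def conePoint : β.Q M := HomotopyPushout.inl _ _ PUnit.unit

/-- The map `C_{≥k} : E → Q_{≥k} E`. -/
def toQ : C(E, β.Q M) := (HomotopyPushout.inr _ _).comp (β.cotruncMap M)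

/-- The local duality obstruction `ob_i(π, k, l) ⊆ H^d(E)`, where `d = dim E`: the set of products
`C_{≥k}^* x ∪ C_{≥l}^* y` with `x` and `y` in the reduced cohomology of `Q_{≥k} E` and `Q_{≥l} E`,
of degrees `i` and `d - i`. For `i > d` the group in the negative degree `d - i` is zero,
so that the set is `{0}`. -/
def obstruction (d i : ℕ) : Set (H E d) :=
  if h : i ≤ d then
    {z | ∃ x ∈ reducedH (β.conePoint M) i, ∃ y ∈ reducedH (β.conePoint N) (d - i),
      z = cup E (Nat.add_sub_of_le h) (pullback (β.toQ M) i x) (pullback (β.toQ N) (d - i) y)}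
  else {0}

end BundleStructure

/-! ## Perversities -/

/-- A perversity assigns an integer to the codimension of a singular stratum. No growth condition
is imposed. -/
abbrev Perversity : Type := ℕ → ℤ

/-- The top perversity `t(j) = j - 2`. -/
def topPerversity : Perversity := fun j => (j : ℤ) - 2

/-- Complementary perversities: `p + q = t` in all positive codimensions. -/
def Complementary (p q : Perversity) : Prop := ∀ j : ℕ, 1 ≤ j → p j + q j = topPerversity j

/-- The degree `c - p(c + 1)` at which a link of dimension `c` is truncated. -/
def cutoff (p : Perversity) (c : ℕ) : ℤ := (c : ℤ) - p (c + 1)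

end LocalDuality

end

/-!
The bundle is `E = B × L`, so the claim concerns cup products on a product. Put `S = Sing B` and
`T = Sing L`, and let `x`, `y` be reduced classes of `Q_{≥k} E` and `Q_{≥l} E`, where
`k = c - p(c+1)` and `l = c - q(c+1)`. Complementarity of the perversities gives `k + l = c + 1`.

The composition `ft_{<k} E → E → Q_{≥k} E` is homotopic to the constant map at the cone point
(`toQ_comp_truncMap_homotopic`), hence the pullback `u` of `x` to `E` restricts to zero along
`B × L_{<k} → B × L`. Let `skel T k` be the simplicial subset generated by the simplices of
dimension less than `k`. Every cycle of `skel T k` is homologous in `T` to one coming from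
`L_{<k}`: in degrees `< k` since `L_{<k} → L` is surjective on homology, in degrees `≥ k` since
all simplices are degenerate (`exists_cycle_skel`). Over a field this comparison survives taking
the product with `S` (`exists_cycle_prod`). Therefore `u` vanishes on `S ⊗ skel T k` and is
represented by a cocycle that is zero on all simplices of `S ⊗ skel T k`
(`exists_cocycle_vanishing_skel`); likewise the pullback `v` of `y` is represented by a cocycle
that is zero on `S ⊗ skel T l`. The cup product of these two cocycles is zero on
`S ⊗ skel T (k + l) = S ⊗ skel T (c + 1)` (`cochainCup_eq_zero_of_mem_skel`).

A compact `c`-manifold has no homology above degree `c` (`exists_boundary_of_compact_manifold`),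
so by the same comparison every cycle of `S ⊗ T` is homologous to one of `S ⊗ skel T (c + 1)`. The
product cocycle pairs to zero with all cycles, and over a field it is then a coboundary.

The product comparison replaces the Künneth theorem. A chain map `C(T') → C(T'')` realizing the
comparison exists because chains over a field split, and it is spread over the product by acyclic
models in the variable `S`: a natural operator is determined by its values on `Δ[n]`, and
`Δ[n] ⊗ R → R` is a homotopy equivalence (`exists_boundary_lift`). The chain map need not come
from a simplicial map, and only naturality in `S` is used.

The vanishing for manifolds rests on the Mayer–Vietoris argument for two open sets
(`AcyclicAt.union`), which is obtained from barycentric subdivision. For open subsets of `ℝ × Y`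
one covers the compact support of a cycle by boxes `J i ×ˢ V i` over overlapping intervals, whose
even members, odd members and consecutive intersections are disjoint families
(`acyclicAt_real_prod`); the manifold case follows by induction over a finite set of charts.
-/

noncomputable section

namespace LocalDuality

open CategoryTheory Simplicial Opposite

/-! ### Rational chains of simplicial sets -/

/-- Rational `n`-chains of a simplicial set. -/
abbrev Chain (S : SSet.{u}) (n : ℕ) : Type u := S _⦋n⦌ →₀ ℚ

/-- The boundary `C_n → C_{n-1}`; it is zero for `n = 0`, where the truncated `n - 1` is `0`. -/
def boundary (S : SSet.{u}) (n : ℕ) : Chain S n →ₗ[ℚ] Chain S (n - 1) :=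
  match n with
  | 0 => 0
  | n + 1 => ∑ i : Fin (n + 2), (-1 : ℚ) ^ (i : ℕ) • Finsupp.lmapDomain ℚ ℚ (fun σ => S.δ i σ)

/-- The boundary `C_{n+1} → C_n`. -/
abbrev boundarySucc (S : SSet.{u}) (n : ℕ) : Chain S (n + 1) →ₗ[ℚ] Chain S n :=
  boundary S (n + 1)

/-- The map induced on chains by a simplicial map. -/
def chainMap {S T : SSet.{u}} (f : S ⟶ T) (n : ℕ) : Chain S n →ₗ[ℚ] Chain T n :=
  Finsupp.lmapDomain ℚ ℚ (fun σ => f.app (op ⦋n⦌) σ)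

@[simp]
theorem chainMap_single {S T : SSet.{u}} (f : S ⟶ T) (n : ℕ) (σ : S _⦋n⦌) (a : ℚ) :
    chainMap f n (Finsupp.single σ a) = Finsupp.single (f.app (op ⦋n⦌) σ) a := by
  simp [chainMap]

theorem boundary_single {S : SSet.{u}} (n : ℕ) (σ : S _⦋n + 1⦌) (a : ℚ) :
    boundary S (n + 1) (Finsupp.single σ a) =
      ∑ i : Fin (n + 2), (-1 : ℚ) ^ (i : ℕ) • Finsupp.single (S.δ i σ) a := by
  simp [boundary]

@[simp]
theorem chainMap_id (S : SSet.{u}) (n : ℕ) (z : Chain S n) : chainMap (𝟙 S) n z = z := by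
  induction z using Finsupp.induction_linear with
  | zero => simp
  | add x y hx hy => rw [map_add, hx, hy]
  | single σ a => simp

theorem chainMap_comp {S T U : SSet.{u}} (f : S ⟶ T) (g : T ⟶ U) (n : ℕ) (z : Chain S n) :
    chainMap (f ≫ g) n z = chainMap g n (chainMap f n z) := by
  induction z using Finsupp.induction_linear with
  | zero => simp
  | add x y hx hy => simp only [map_add, hx, hy]
  | single σ a => simp

theorem boundary_chainMap {S T : SSet.{u}} (f : S ⟶ T) (n : ℕ) (z : Chain S n) :
    boundary T n (chainMap f n z) = chainMap f (n - 1) (boundary S n z) := by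
  cases n with
  | zero => simp [boundary]
  | succ n =>
    induction z using Finsupp.induction_linear with
    | zero => simp
    | add x y hx hy => simp only [map_add, hx, hy]
    | single σ a =>
      rw [chainMap_single, boundary_single, boundary_single, map_sum]
      refine Finset.sum_congr rfl fun i _ => ?_
      rw [map_smul]
      erw [chainMap_single]
      exact congr_arg (fun x => (-1 : ℚ) ^ (i : ℕ) • Finsupp.single x a)
        (ConcreteCategory.congr_hom (SimplicialObject.δ_naturality f i) σ).symm

/-- The free rational vector space functor. -/
def freeRat : Type u ⥤ ModuleCat.{u} ℚ where
  obj X := ModuleCat.of ℚ (X →₀ ℚ)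
  map f := ModuleCat.ofHom (Finsupp.lmapDomain ℚ ℚ (fun x => f x))
  map_id X := by
    ext x; simp
  map_comp f g := by
    ext x; simp

/-- The simplicial rational vector space spanned by a simplicial set. -/
abbrev freeSimplicial (S : SSet.{u}) : SimplicialObject (ModuleCat.{u} ℚ) :=
  ((SimplicialObject.whiskering _ _).obj freeRat).obj S

theorem alternatingFaceMapComplex_d_hom (S : SSet.{u}) (n : ℕ) :
    (((AlgebraicTopology.alternatingFaceMapComplex _).obj (freeSimplicial S)).d (n + 1) n).hom =
      boundary S (n + 1) := by
  rw [AlgebraicTopology.alternatingFaceMapComplex_obj_d]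
  refine (ModuleCat.hom_sum _ _).trans (Finset.sum_congr rfl fun i _ => ?_)
  rw [ModuleCat.hom_zsmul, ← Int.cast_smul_eq_zsmul ℚ]
  push_cast
  rfl

theorem alternatingFaceMapComplex_d_apply (S : SSet.{u}) (n : ℕ) (z : Chain S (n + 1)) :
    (((AlgebraicTopology.alternatingFaceMapComplex _).obj (freeSimplicial S)).d (n + 1) n).hom z =
      boundary S (n + 1) z :=
  LinearMap.congr_fun (alternatingFaceMapComplex_d_hom S n) z

theorem boundary_boundary (S : SSet.{u}) (n : ℕ) (z : Chain S n) :
    boundary S (n - 1) (boundary S n z) = 0 := by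
  match n with
  | 0 => simp [boundary]
  | 1 => rfl
  | n + 2 =>
    have := congr_arg ModuleCat.Hom.hom
      (((AlgebraicTopology.alternatingFaceMapComplex _).obj (freeSimplicial S)).d_comp_d
        (n + 2) (n + 1) n)
    rw [ModuleCat.hom_comp, alternatingFaceMapComplex_d_hom, alternatingFaceMapComplex_d_hom]
      at this
    exact LinearMap.congr_fun this z

/-- A homotopy of chain maps makes the values on a cycle homologous. -/
theorem exists_boundary_of_homotopy {S T : SSet.{u}}
    {f g : (AlgebraicTopology.alternatingFaceMapComplex _).obj (freeSimplicial S) ⟶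
      (AlgebraicTopology.alternatingFaceMapComplex _).obj (freeSimplicial T)}
    (h : Homotopy f g) (n : ℕ) (z : Chain S n) (hz : boundary S n z = 0) :
    ∃ e : Chain T (n + 1), boundary T (n + 1) e = (f.f n).hom z - (g.f n).hom z := by
  refine ⟨(h.hom n (n + 1)).hom z, ?_⟩
  have hc := h.comm n
  rw [prevD_eq (j' := n + 1) (w := by simp)] at hc
  have h3 : (dNext n h.hom).hom z = 0 := by
    cases n with
    | zero => rw [dNext_eq_zero _ _ (by simp)]; rfl
    | succ n =>
      rw [dNext_eq (i' := n) (w := by simp)]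
      refine (congr_arg (h.hom n (n + 1)).hom
        ((alternatingFaceMapComplex_d_apply S n z).trans hz)).trans (map_zero _)
  have h2 : (f.f n).hom z = (dNext n h.hom).hom z + (((AlgebraicTopology.alternatingFaceMapComplex
      _).obj (freeSimplicial T)).d (n + 1) n).hom ((h.hom n (n + 1)).hom z) + (g.f n).hom z :=
    congr_arg (fun f => f.hom z) hc
  rw [h3, zero_add] at h2
  exact (alternatingFaceMapComplex_d_apply T n _).symm.trans (eq_sub_of_add_eq h2.symm)

/-- Homotopic simplicial maps send a cycle to homologous cycles. -/
theorem exists_boundary_of_simplicialHomotopy {S T : SSet.{u}} {f g : S ⟶ T}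
    (h : SSet.Homotopy f g) (n : ℕ) (z : Chain S n) (hz : boundary S n z = 0) :
    ∃ e : Chain T (n + 1), boundary T (n + 1) e = chainMap f n z - chainMap g n z :=
  exists_boundary_of_homotopy
    (SimplicialObject.Homotopy.toChainHomotopy
      (h.toSimplicialObjectHomotopy.whiskerRight freeRat)) n z hz

/-- The pairing of a cochain with chains. -/
def pairing {S : SSet.{u}} {n : ℕ} (φ : Cochain S n) : Chain S n →ₗ[ℚ] ℚ :=
  Finsupp.linearCombination ℚ φ

@[simp]
theorem pairing_single {S : SSet.{u}} {n : ℕ} (φ : Cochain S n) (σ : S _⦋n⦌) (a : ℚ) :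
    pairing φ (Finsupp.single σ a) = a * φ σ := by
  simp [pairing]

theorem pairing_sub {S : SSet.{u}} {n : ℕ} (φ ψ : Cochain S n) (z : Chain S n) :
    pairing (φ - ψ) z = pairing φ z - pairing ψ z := by
  induction z using Finsupp.induction_linear with
  | zero => simp
  | add x y hx hy => rw [map_add, map_add, map_add, hx, hy]; ring
  | single σ a => simp [mul_sub]

theorem pairing_coboundary {S : SSet.{u}} {n : ℕ} (φ : Cochain S n) (z : Chain S (n + 1)) :
    pairing (coboundary S n φ) z = pairing φ (boundary S (n + 1) z) := by
  induction z using Finsupp.induction_linear with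
  | zero => simp
  | add x y hx hy => simp only [map_add, hx, hy]
  | single σ a =>
    rw [boundary_single, map_sum, pairing_single]
    change a * (∑ i : Fin (n + 2), (-1 : ℚ) ^ (i : ℕ) * φ (S.δ i σ)) = _
    rw [Finset.mul_sum]
    refine Finset.sum_congr rfl fun i _ => ?_
    rw [map_smul, smul_eq_mul]
    erw [pairing_single]
    ring

theorem pairing_cochainMap {S T : SSet.{u}} (f : S ⟶ T) {n : ℕ} (φ : Cochain T n)
    (z : Chain S n) : pairing (cochainMap f n φ) z = pairing φ (chainMap f n z) := by
  induction z using Finsupp.induction_linear with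
  | zero => simp
  | add x y hx hy => simp only [map_add, hx, hy]
  | single σ a =>
    rw [chainMap_single, pairing_single, pairing_single]
    rfl

theorem pairing_boundary_eq_zero {S : SSet.{u}} {n : ℕ} {φ : Cochain S n}
    (hφ : φ ∈ cocycles S n) (e : Chain S (n + 1)) : pairing φ (boundary S (n + 1) e) = 0 := by
  rw [← pairing_coboundary, LinearMap.mem_ker.1 hφ]
  simp [pairing]

theorem pairing_eq_zero_of_mem_coboundaries {S : SSet.{u}} {n : ℕ} {φ : Cochain S n}
    (hφ : φ ∈ coboundaries S n) {z : Chain S n} (hz : boundary S n z = 0) : pairing φ z = 0 := by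
  cases n with
  | zero =>
    rw [show φ = 0 from hφ]
    simp [pairing]
  | succ n =>
    obtain ⟨ψ, rfl⟩ := hφ
    rw [pairing_coboundary, hz, map_zero]

/-- Over a field, a cochain that vanishes on all cycles is a coboundary. -/
theorem mem_coboundaries_of_pairing_eq_zero {S : SSet.{u}} {n : ℕ} {φ : Cochain S n}
    (h : ∀ z : Chain S n, boundary S n z = 0 → pairing φ z = 0) : φ ∈ coboundaries S n := by
  cases n with
  | zero =>
    change φ = 0
    funext σ
    simpa using h (Finsupp.single σ 1) rfl
  | succ n =>
    have : (pairing φ : Module.Dual ℚ (Chain S (n + 1))) ∈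
        LinearMap.range (boundary S (n + 1)).dualMap := by
      rw [LinearMap.range_dualMap_eq_dualAnnihilator_ker, Submodule.mem_dualAnnihilator]
      exact fun z hz => h z hz
    obtain ⟨g, hg⟩ := this
    refine ⟨fun τ => g (Finsupp.single τ 1), ?_⟩
    have hg' : pairing (fun τ : S _⦋n⦌ => g (Finsupp.single τ 1)) = g := by
      ext τ
      simp
    funext σ
    have h1 : pairing (coboundary S n fun τ => g (Finsupp.single τ 1)) (Finsupp.single σ 1) =
        pairing φ (Finsupp.single σ 1) := by
      rw [pairing_coboundary, ← hg]
      exact LinearMap.congr_fun hg' _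
    simpa using h1

/-- A cycle all of whose simplices are degenerate is a boundary: the projection onto normalized
chains is homotopic to the identity and kills degenerate simplices. -/
theorem exists_boundary_of_degenerate {S : SSet.{u}} (n : ℕ) (z : Chain S n)
    (hz : boundary S n z = 0)
    (hdeg : ∀ σ ∈ z.support, ∃ (m : ℕ) (_ : m < n) (α : ⦋n⦌ ⟶ ⦋m⦌) (τ : S _⦋m⦌),
      σ = S.map α.op τ) :
    ∃ e : Chain S (n + 1), boundary S (n + 1) e = z := by
  obtain ⟨e, he⟩ := exists_boundary_of_homotopy
    (AlgebraicTopology.DoldKan.homotopyPInftyToId (freeSimplicial S)) n z hz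
  have h0 : ((AlgebraicTopology.DoldKan.PInfty (X := freeSimplicial S)).f n).hom z = 0 := by
    have : ∀ z' : Chain S n, (∀ σ ∈ z'.support, ∃ (m : ℕ) (_ : m < n) (α : ⦋n⦌ ⟶ ⦋m⦌) (τ : S _⦋m⦌),
      σ = S.map α.op τ) →
        ((AlgebraicTopology.DoldKan.PInfty (X := freeSimplicial S)).f n).hom z' = 0 := by
      intro z' hz'
      have hs : z' = ∑ σ ∈ z'.support, Finsupp.single σ (z' σ) := z'.sum_single.symm
      rw [hs]
      refine (map_sum ((AlgebraicTopology.DoldKan.PInfty (X := freeSimplicial S)).f n).hom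
        _ _).trans (Finset.sum_eq_zero fun σ hσ => ?_)
      obtain ⟨m, hm, α, τ, hτ⟩ := hz' σ hσ
      have hα : ¬ Mono α := fun hmono => by
        have := SimplexCategory.len_le_of_mono α
        simp only at this
        omega
      have h1 := AlgebraicTopology.DoldKan.degeneracy_comp_PInfty (freeSimplicial S) n α hα
      have h2 := congr_arg (fun f => f.hom (Finsupp.single τ (z' σ) : Chain S m)) h1
      refine Eq.trans ?_ h2
      refine congr_arg ((AlgebraicTopology.DoldKan.PInfty (X := freeSimplicial S)).f n).hom ?_
      change _ = Finsupp.mapDomain _ _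
      rw [Finsupp.mapDomain_single, hτ]
    exact this z hdeg
  refine ⟨-e, ?_⟩
  have he' : boundary S (n + 1) e = (0 : Chain S n) - z := he.trans (congr_arg (· - z) h0)
  rw [map_neg, he', zero_sub, neg_neg]

/-! ### Comparison with the homology functor -/

/-- The coefficient object `ℚ` of `ratHomology`. -/
abbrev ratCoeff : ModuleCat.{u} ℚ := ModuleCat.of ℚ (ULift.{u} ℚ)

/-- The inclusion of the line spanned by `x`. -/
def freeRatι (X : Type u) (x : X) : ratCoeff.{u} ⟶ ModuleCat.of ℚ (X →₀ ℚ) :=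
  ModuleCat.ofHom ((Finsupp.lsingle x).comp (ULift.moduleEquiv (R := ℚ) (M := ℚ)).toLinearMap)

/-- The coproduct of copies of `ℚ` indexed by `X` is the free vector space on `X`. -/
def sigmaIsoFree (X : Type u) :
    (∐ fun _ : X => ratCoeff.{u}) ≅ ModuleCat.of ℚ (X →₀ ℚ) where
  hom := Limits.Sigma.desc (freeRatι X)
  inv := ModuleCat.ofHom (Finsupp.lsum ℚ fun x =>
    (Limits.Sigma.ι (fun _ : X => ratCoeff.{u}) x).hom.comp
      (ULift.moduleEquiv (R := ℚ) (M := ℚ)).symm.toLinearMap)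
  hom_inv_id := by
    refine Limits.Sigma.hom_ext _ _ fun x => ?_
    rw [Limits.Sigma.ι_desc_assoc, Category.comp_id]
    refine ModuleCat.hom_ext (LinearMap.ext fun a => ?_)
    exact Finsupp.lsum_single ℚ (fun x => (Limits.Sigma.ι (fun _ : X => ratCoeff.{u}) x).hom.comp
      (ULift.moduleEquiv (R := ℚ) (M := ℚ)).symm.toLinearMap) x a.down
  inv_hom_id := by
    refine ModuleCat.hom_ext (Finsupp.lhom_ext fun x a => ?_)
    have := congr_arg (fun f => f.hom (ULift.up a)) (Limits.Sigma.ι_desc (freeRatι X) x)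
    exact (congr_arg (Limits.Sigma.desc (freeRatι X)).hom (Finsupp.lsum_single ..)).trans this

/-- The isomorphisms `sigmaIsoFree` are natural. -/
def sigmaConstIso : (Limits.sigmaConst.obj ratCoeff.{u}) ≅ freeRat.{u} :=
  NatIso.ofComponents sigmaIsoFree (fun {X Y} f => by
    refine Limits.Sigma.hom_ext _ _ fun x => ?_
    change Limits.Sigma.ι (fun _ : X => ratCoeff.{u}) x ≫
        Limits.Sigma.map' (fun x => f x) (fun _ => 𝟙 ratCoeff) ≫
        Limits.Sigma.desc (freeRatι Y) =
      Limits.Sigma.ι (fun _ : X => ratCoeff.{u}) x ≫ Limits.Sigma.desc (freeRatι X) ≫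
        ModuleCat.ofHom (Finsupp.lmapDomain ℚ ℚ (fun x => f x))
    rw [Limits.Sigma.ι_desc_assoc, Limits.Sigma.ι_comp_map'_assoc, Category.id_comp,
      Limits.Sigma.ι_desc]
    refine ModuleCat.hom_ext (LinearMap.ext fun a => ?_)
    exact (Finsupp.mapDomain_single (f := fun x => f x)).symm)

/-- The chain complex of a simplicial set in the sense of Mathlib is the complex of
finitely supported functions on simplices. -/
def chainComplexIso : (SSet.chainComplexFunctor (ModuleCat.{u} ℚ)).obj ratCoeff ≅
    (SimplicialObject.whiskering _ _).obj freeRat.{u} ⋙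
      AlgebraicTopology.alternatingFaceMapComplex _ :=
  Functor.isoWhiskerRight ((SimplicialObject.whiskering _ _).mapIso sigmaConstIso) _

theorem d_next_apply_eq_zero_iff (S : SSet.{u}) (r : ℕ) (z : Chain S r) :
    (((AlgebraicTopology.alternatingFaceMapComplex _).obj (freeSimplicial S)).d r
      ((ComplexShape.down ℕ).next r)).hom z = 0 ↔ boundary S r z = 0 := by
  cases r with
  | zero =>
    rw [HomologicalComplex.shape _ _ _ (by simp)]
    exact ⟨fun _ => rfl, fun _ => rfl⟩
  | succ r =>
    rw [ChainComplex.next_nat_succ]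
    rw [alternatingFaceMapComplex_d_hom]
    rfl

/-- If a continuous map induces an isomorphism on `H_r`, then every `r`-cycle of the target is
homologous to the image of a cycle. -/
theorem exists_cycle_of_isIso {X Y : TopCat.{u}} (f : X ⟶ Y) (r : ℕ)
    [hf : IsIso ((ratHomology.{u} r).map f)] (z : Chain (TopCat.toSSet.obj Y) r)
    (hz : boundary _ r z = 0) :
    ∃ w : Chain (TopCat.toSSet.obj X) r, boundary _ r w = 0 ∧
      ∃ e : Chain (TopCat.toSSet.obj Y) (r + 1),
        boundary _ (r + 1) e = z - chainMap (TopCat.toSSet.map f) r w := by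
  let F : SSet.{u} ⥤ ModuleCat.{u} ℚ :=
    ((SSet.chainComplexFunctor (ModuleCat.{u} ℚ)).obj ratCoeff) ⋙
    HomologicalComplex.homologyFunctor _ _ r
  let F' : SSet.{u} ⥤ ModuleCat.{u} ℚ := ((SimplicialObject.whiskering _ _).obj freeRat.{u} ⋙
      AlgebraicTopology.alternatingFaceMapComplex _) ⋙ HomologicalComplex.homologyFunctor _ _ r
  let e : F ≅ F' := Functor.isoWhiskerRight chainComplexIso _
  have h1 : IsIso (F.map (TopCat.toSSet.map f)) := hf
  have h2 : IsIso (F'.map (TopCat.toSSet.map f)) :=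
    (NatIso.isIso_map_iff e (TopCat.toSSet.map f)).1 h1
  have h3 : Epi (HomologicalComplex.homologyMap
      ((AlgebraicTopology.alternatingFaceMapComplex (ModuleCat.{u} ℚ)).map
        (((SimplicialObject.whiskering _ _).obj freeRat.{u}).map (TopCat.toSSet.map f))) r) :=
    inferInstanceAs (Epi (F'.map (TopCat.toSSet.map f)))
  rw [HomologicalComplex.epi_homologyMap_iff_up_to_refinements _ (r + 1) r _
    (by simp) rfl] at h3
  obtain ⟨A, π, hπ, x, hx, y, hy⟩ := h3 (A := ratCoeff)
    (ModuleCat.ofHom ((LinearMap.toSpanSingleton ℚ (Chain (TopCat.toSSet.obj Y) r) z).comp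
      ULift.moduleEquiv.toLinearMap)) (by
      refine ModuleCat.hom_ext (LinearMap.ext fun a => ?_)
      have := (d_next_apply_eq_zero_iff _ r z).2 hz
      have h4 := congr_arg (fun v => (ULift.moduleEquiv (R := ℚ) (M := ℚ) a) • v) this
      exact ((LinearMap.map_smul _ _ _).trans h4).trans (smul_zero _))
  obtain ⟨a, ha⟩ := (ModuleCat.epi_iff_surjective π).1 hπ (ULift.up 1)
  refine ⟨x.hom a, (d_next_apply_eq_zero_iff _ r _).1 (congr_arg (fun g => g.hom a) hx),
    y.hom a, ?_⟩
  have h5 := congr_arg (fun g => g.hom a) hy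
  have h6 : z = chainMap (TopCat.toSSet.map f) r (x.hom a) +
      boundarySucc _ r (y.hom a) := by
    refine Eq.trans ?_ (h5.trans (congr_arg (chainMap (TopCat.toSSet.map f) r (x.hom a) + ·)
      (alternatingFaceMapComplex_d_apply _ r (y.hom a))))
    change z = (ULift.moduleEquiv (R := ℚ) (M := ℚ) (π.hom a)) • z
    have ha' : π.hom a = ULift.up 1 := ha
    rw [ha']
    exact (one_smul ℚ z).symm
  exact (sub_eq_of_eq_add' h6).symm

section Product

open MonoidalCategory CartesianMonoidalCategory

/-! ### Acyclicity of the fibres of `Δ[n] ⊗ R → R` -/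

/-- The inclusion of `R` as the slice of `Δ[n] ⊗ R` over the vertex `0`. -/
def sliceZero (n : ℕ) (R : SSet.{u}) : R ⟶ Δ[n] ⊗ R :=
  lift (SSet.const (SSet.stdSimplex.obj₀Equiv.symm 0)) (𝟙 R)

/-- The simplices `j ↦ 0` if `t j = 0`, `j ↦ α j` if `t j = 1`, for a simplex `(α, t)` of
`Δ[n] × Δ[1]`: a contraction of `Δ[n]` to its vertex `0`. -/
def contractSimplex (n : ℕ) {m : SimplexCategoryᵒᵖ} (α : (Δ[n] : SSet.{u}).obj m)
    (t : (Δ[1] : SSet.{u}).obj m) : (Δ[n] : SSet.{u}).obj m :=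
  SSet.stdSimplex.objEquiv.symm (SimplexCategory.Hom.mk
    { toFun := fun j => if (SSet.stdSimplex.objEquiv t).toOrderHom j = 0 then 0
        else (SSet.stdSimplex.objEquiv α).toOrderHom j
      monotone' := fun i j hij => by
        have h1 := (SSet.stdSimplex.objEquiv t).toOrderHom.monotone hij
        have h2 := (SSet.stdSimplex.objEquiv α).toOrderHom.monotone hij
        dsimp only
        split_ifs with h3 h4
        · exact le_rfl
        · exact Fin.zero_le _
        · rename_i h4
          rw [h4] at h1
          exact absurd (Fin.le_zero_iff.1 h1) h3
        · exact h2 })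

theorem contractSimplex_apply_of_eq_zero (n : ℕ) {m : SimplexCategoryᵒᵖ}
    (α : (Δ[n] : SSet.{u}).obj m) (t : (Δ[1] : SSet.{u}).obj m) (j : Fin (m.unop.len + 1))
    (h : (SSet.stdSimplex.objEquiv t).toOrderHom j = 0) :
    (SSet.stdSimplex.objEquiv (contractSimplex n α t)).toOrderHom j = 0 :=
  if_pos h

theorem contractSimplex_apply_of_ne_zero (n : ℕ) {m : SimplexCategoryᵒᵖ}
    (α : (Δ[n] : SSet.{u}).obj m) (t : (Δ[1] : SSet.{u}).obj m) (j : Fin (m.unop.len + 1))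
    (h : (SSet.stdSimplex.objEquiv t).toOrderHom j ≠ 0) :
    (SSet.stdSimplex.objEquiv (contractSimplex n α t)).toOrderHom j =
      (SSet.stdSimplex.objEquiv α).toOrderHom j :=
  if_neg h

/-- The product of the contraction of `Δ[n]` with `R`. -/
def contractHomotopy (n : ℕ) (R : SSet.{u}) :
    SSet.Homotopy (snd Δ[n] R ≫ sliceZero n R) (𝟙 (Δ[n] ⊗ R)) where
  h :=
    { app := fun m => ↾fun x => (contractSimplex n x.1.1 x.2, x.1.2)
      naturality := fun m m' f => by
        ext x
        rfl }
  h₀ := by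
    ext m x
    · refine SSet.stdSimplex.objEquiv.injective (SimplexCategory.Hom.ext _ _
        (OrderHom.ext _ _ (funext fun j => ?_)))
      exact contractSimplex_apply_of_eq_zero n x.1 (SSet.ι₀.app m x).2 j rfl
    · rfl
  h₁ := by
    ext m x
    · refine SSet.stdSimplex.objEquiv.injective (SimplexCategory.Hom.ext _ _
        (OrderHom.ext _ _ (funext fun j => ?_)))
      exact contractSimplex_apply_of_ne_zero n x.1 (SSet.ι₁.app m x).2 j
        (by change (1 : Fin 2) ≠ 0; decide)
    · rfl
  rel := by ext _ ⟨⟨_, ⟨⟩⟩, _⟩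

/-- A cycle of `Δ[n] ⊗ R` that projects to zero in `R` is a boundary. -/
theorem exists_boundary_of_snd_eq_zero (n m : ℕ) (R : SSet.{u})
    (z : Chain (Δ[n] ⊗ R) m) (hz : boundary _ m z = 0) (hz' : chainMap (snd Δ[n] R) m z = 0) :
    ∃ e : Chain (Δ[n] ⊗ R) (m + 1), boundary _ (m + 1) e = z := by
  obtain ⟨e, he⟩ := exists_boundary_of_simplicialHomotopy (contractHomotopy n R) m z hz
  rw [chainMap_comp, hz', map_zero, chainMap_id, zero_sub] at he
  exact ⟨-e, by rw [map_neg, he, neg_neg]⟩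

theorem chainMap_snd_sliceZero (n m : ℕ) (R : SSet.{u}) (z : Chain R m) :
    chainMap (snd Δ[n] R) m (chainMap (sliceZero n R) m z) = z := by
  rw [← chainMap_comp, sliceZero, lift_snd, chainMap_id]

/-- A cycle `y` of `Δ[n] ⊗ R` whose projection bounds `t` is bounded by a chain over `t`. -/
theorem exists_boundary_lift (n m : ℕ) (R : SSet.{u}) (y : Chain (Δ[n] ⊗ R) m)
    (hy : boundary _ m y = 0) (t : Chain R (m + 1))
    (ht : boundary R (m + 1) t = chainMap (snd Δ[n] R) m y) :
    ∃ x : Chain (Δ[n] ⊗ R) (m + 1), boundary _ (m + 1) x = y ∧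
      chainMap (snd Δ[n] R) (m + 1) x = t := by
  have h1 : boundary _ (m + 1) (chainMap (sliceZero n R) (m + 1) t) =
      chainMap (sliceZero n R) m (chainMap (snd Δ[n] R) m y) := by
    rw [boundary_chainMap, ht]
    rfl
  obtain ⟨e, he⟩ := exists_boundary_of_snd_eq_zero n m R
    (y - chainMap (sliceZero n R) m (chainMap (snd Δ[n] R) m y))
    (by rw [map_sub, hy, ← h1]; erw [boundary_boundary _ (m + 1)]; exact sub_zero _)
    (by rw [map_sub, chainMap_snd_sliceZero, sub_self])
  have h2 : boundary _ (m + 1) (chainMap (sliceZero n R) (m + 1)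
      (chainMap (snd Δ[n] R) (m + 1) e)) = 0 := by
    rw [boundary_chainMap, boundary_chainMap, he]
    erw [map_sub, chainMap_snd_sliceZero, sub_self]
    exact map_zero _
  refine ⟨chainMap (sliceZero n R) (m + 1) t + (e - chainMap (sliceZero n R) (m + 1)
    (chainMap (snd Δ[n] R) (m + 1) e)), ?_, ?_⟩
  · rw [map_add, map_sub, h2, he, h1, sub_zero]
    exact add_sub_cancel _ _
  · rw [map_add, map_sub, chainMap_snd_sliceZero, chainMap_snd_sliceZero, sub_self, add_zero]

/-! ### Operators natural in the first factor -/

/-- The identity of `[n]` as a simplex of `Δ[n]`. -/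
def idSimplex (n : ℕ) : (Δ[n] : SSet.{u}) _⦋n⦌ := SSet.stdSimplex.objEquiv.symm (𝟙 ⦋n⦌)

/-- The classifying map of a simplex. -/
def simplexMap {S : SSet.{u}} {n : ℕ} (σ : S _⦋n⦌) : Δ[n] ⟶ S := SSet.yonedaEquiv.symm σ

theorem simplexMap_app_idSimplex {S : SSet.{u}} {n : ℕ} (σ : S _⦋n⦌) :
    (simplexMap σ).app (op ⦋n⦌) (idSimplex n) = σ :=
  SSet.yonedaEquiv.apply_symm_apply σ

theorem simplexMap_idSimplex (n : ℕ) : simplexMap (idSimplex.{u} n) = 𝟙 Δ[n] :=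
  SSet.yonedaEquiv_symm_stdSimplex_id ⦋n⦌

theorem simplexMap_comp {S S' : SSet.{u}} {n : ℕ} (σ : S _⦋n⦌) (φ : S ⟶ S') :
    simplexMap σ ≫ φ = simplexMap (φ.app (op ⦋n⦌) σ) :=
  SSet.yonedaEquiv_symm_comp σ φ

/-- The generator `(id_n, τ)` of the chains of `Δ[n] ⊗ T`. -/
def idPair {T : SSet.{u}} {n : ℕ} (τ : T _⦋n⦌) : Chain (Δ[n] ⊗ T) n :=
  Finsupp.single ((idSimplex n, τ) : (Δ[n] ⊗ T) _⦋n⦌) 1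

theorem chainMap_snd_idPair {T : SSet.{u}} {n : ℕ} (τ : T _⦋n⦌) :
    chainMap (snd Δ[n] T) n (idPair τ) = Finsupp.single τ 1 :=
  chainMap_single ..

/-- The operator `C_n(S × T) → C_m(S × R)`, natural in `S`, whose values on the pairs
`(id_n, τ)` of simplices of `Δ[n] × T` are prescribed by `w`. -/
def naturalOp {T R : SSet.{u}} {n m : ℕ} (w : T _⦋n⦌ → Chain (Δ[n] ⊗ R) m) (S : SSet.{u}) :
    Chain (S ⊗ T) n →ₗ[ℚ] Chain (S ⊗ R) m :=
  Finsupp.linearCombination ℚ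
    (fun x : (S ⊗ T) _⦋n⦌ => chainMap (simplexMap x.1 ▷ R) m (w x.2))

section

variable {T R : SSet.{u}} {n m : ℕ} (w : T _⦋n⦌ → Chain (Δ[n] ⊗ R) m)

theorem naturalOp_single (S : SSet.{u}) (x : (S ⊗ T) _⦋n⦌) (a : ℚ) :
    naturalOp w S (Finsupp.single x a) = a • chainMap (simplexMap x.1 ▷ R) m (w x.2) :=
  Finsupp.linearCombination_single ..

theorem chainMap_naturalOp {S S' : SSet.{u}} (φ : S ⟶ S') (z : Chain (S ⊗ T) n) :
    chainMap (φ ▷ R) m (naturalOp w S z) = naturalOp w S' (chainMap (φ ▷ T) n z) := by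
  induction z using Finsupp.induction_linear with
  | zero => simp
  | add x y hx hy => simp only [map_add, hx, hy]
  | single x a =>
    rw [naturalOp_single, map_smul, chainMap_single, naturalOp_single, ← chainMap_comp,
      ← comp_whiskerRight, simplexMap_comp]
    rfl

theorem chainMap_snd_naturalOp (S : SSet.{u}) (z : Chain (S ⊗ T) n)
    (t : Chain T n →ₗ[ℚ] Chain R m)
    (ht : ∀ τ, chainMap (snd Δ[n] R) m (w τ) = t (Finsupp.single τ 1)) :
    chainMap (snd S R) m (naturalOp w S z) = t (chainMap (snd S T) n z) := by
  induction z using Finsupp.induction_linear with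
  | zero => simp
  | add x y hx hy => simp only [map_add, hx, hy]
  | single x a =>
    rw [naturalOp_single, map_smul, chainMap_single, ← chainMap_comp, whiskerRight_snd, ht,
      ← map_smul, Finsupp.smul_single, smul_eq_mul, mul_one]
    rfl

theorem chainMap_simplexMap_idPair (S : SSet.{u}) (x : (S ⊗ T) _⦋n⦌) :
    chainMap (simplexMap x.1 ▷ T) n (idPair x.2) = Finsupp.single x 1 := by
  refine (chainMap_single ..).trans ?_
  exact congr_arg (fun y => Finsupp.single y 1) (Prod.ext (simplexMap_app_idSimplex x.1) rfl)

theorem naturalOp_idPair (τ : T _⦋n⦌) : naturalOp w Δ[n] (idPair τ) = w τ := by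
  refine (naturalOp_single ..).trans ?_
  have h : simplexMap (idSimplex n) ▷ R = 𝟙 (Δ[n] ⊗ R) := by
    rw [simplexMap_idSimplex, id_whiskerRight]
  rw [one_smul, h, chainMap_id]

end

/-- Two operators natural in the first factor agree if they agree on the pairs `(id_n, τ)`. -/
theorem natural_ext {T R : SSet.{u}} {n m : ℕ}
    (A B : ∀ S : SSet.{u}, Chain (S ⊗ T) n →ₗ[ℚ] Chain (S ⊗ R) m)
    (hA : ∀ (S S' : SSet.{u}) (φ : S ⟶ S') (z : Chain (S ⊗ T) n),
      chainMap (φ ▷ R) m (A S z) = A S' (chainMap (φ ▷ T) n z))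
    (hB : ∀ (S S' : SSet.{u}) (φ : S ⟶ S') (z : Chain (S ⊗ T) n),
      chainMap (φ ▷ R) m (B S z) = B S' (chainMap (φ ▷ T) n z))
    (h : ∀ τ : T _⦋n⦌, A Δ[n] (idPair τ) = B Δ[n] (idPair τ))
    (S : SSet.{u}) (z : Chain (S ⊗ T) n) : A S z = B S z := by
  refine LinearMap.congr_fun (Finsupp.lhom_ext fun x a => ?_) z
  have hx : A S (Finsupp.single x 1) = B S (Finsupp.single x 1) := by
    rw [← chainMap_simplexMap_idPair S x, ← hA, ← hB, h]
  rw [← mul_one a, ← smul_eq_mul, ← Finsupp.smul_single, map_smul, map_smul, hx]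

/-- Dependent choice: a sequence can be constructed step by step when each good term has a good
successor related to it. -/
theorem exists_dependent_seq {α : ℕ → Type*} (Good : ∀ n, α n → Prop)
    (Rel : ∀ n, α n → α (n + 1) → Prop) (h0 : ∃ a, Good 0 a)
    (hs : ∀ n a, Good n a → ∃ b, Good (n + 1) b ∧ Rel n a b) :
    ∃ s : ∀ n, α n, (∀ n, Good n (s n)) ∧ ∀ n, Rel n (s n) (s (n + 1)) := by
  choose f hf using hs
  obtain ⟨a, ha⟩ := h0
  let s : ∀ n, {a : α n // Good n a} := fun n =>
    Nat.rec (motive := fun n => {a : α n // Good n a}) ⟨a, ha⟩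
      (fun n x => ⟨f n x.1 x.2, (hf n x.1 x.2).1⟩) n
  exact ⟨fun n => (s n).1, fun n => (s n).2, fun n => (hf n (s n).1 (s n).2).2⟩

/-! ### Lifting chain maps and homotopies to products -/

/-- A chain map `C(T) → C(R)` lifts to chain maps `C(S ⊗ T) → C(S ⊗ R)` natural in `S`. -/
theorem exists_natural_lift {T R : SSet.{u}} (θ : ∀ n, Chain T n →ₗ[ℚ] Chain R n)
    (hθ : ∀ n z, boundary R (n + 1) (θ (n + 1) z) = θ n (boundary T (n + 1) z)) :
    ∃ w : ∀ n, T _⦋n⦌ → Chain (Δ[n] ⊗ R) n,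
      (∀ n τ, chainMap (snd Δ[n] R) n (w n τ) = θ n (Finsupp.single τ 1)) ∧
      ∀ n (S : SSet.{u}) (z : Chain (S ⊗ T) (n + 1)),
        boundary _ (n + 1) (naturalOp (w (n + 1)) S z) =
          naturalOp (w n) S (boundary _ (n + 1) z) := by
  -- By naturality the boundary relation need only be checked on the pairs `(id, τ)`.
  have hext : ∀ (n : ℕ) (a : T _⦋n⦌ → Chain (Δ[n] ⊗ R) n)
      (b : T _⦋n + 1⦌ → Chain (Δ[n + 1] ⊗ R) (n + 1)),
      (∀ τ, boundary _ (n + 1) (b τ) =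
        naturalOp a Δ[n + 1] (boundarySucc (Δ[n + 1] ⊗ T) n (idPair τ))) →
      ∀ (S : SSet.{u}) (z : Chain (S ⊗ T) (n + 1)),
        boundary _ (n + 1) (naturalOp b S z) = naturalOp a S (boundarySucc _ n z) := by
    intro n a b h
    refine natural_ext (fun S => (boundarySucc _ n).comp (naturalOp b S))
      (fun S => (naturalOp a S).comp (boundarySucc _ n)) (fun S S' φ z => ?_)
      (fun S S' φ z => ?_) (fun τ => ?_)
    · rw [LinearMap.comp_apply, LinearMap.comp_apply, ← chainMap_naturalOp]
      exact (boundary_chainMap _ (n + 1) _).symm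
    · rw [LinearMap.comp_apply, LinearMap.comp_apply, chainMap_naturalOp]
      exact congr_arg (naturalOp a S') (boundary_chainMap _ (n + 1) _).symm
    · rw [LinearMap.comp_apply, LinearMap.comp_apply, naturalOp_idPair]
      exact h τ
  obtain ⟨w, hw, hw'⟩ := exists_dependent_seq
    (α := fun n => T _⦋n⦌ → Chain (Δ[n] ⊗ R) n)
    (fun n a => (∀ τ, chainMap (snd Δ[n] R) n (a τ) = θ n (Finsupp.single τ 1)) ∧
      ∀ τ : T _⦋n + 1⦌, boundary _ n
        (naturalOp a Δ[n + 1] (boundarySucc (Δ[n + 1] ⊗ T) n (idPair τ))) = 0)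
    (fun n a b => ∀ τ : T _⦋n + 1⦌, boundary _ (n + 1) (b τ) =
        naturalOp a Δ[n + 1] (boundarySucc (Δ[n + 1] ⊗ T) n (idPair τ)))
    ⟨fun τ => chainMap (sliceZero 0 R) 0 (θ 0 (Finsupp.single τ 1)),
      fun τ => chainMap_snd_sliceZero .., fun τ => rfl⟩
    (fun n a ha => by
      have key : ∀ τ : T _⦋n + 1⦌, ∃ x : Chain (Δ[n + 1] ⊗ R) (n + 1),
          boundary _ (n + 1) x =
            naturalOp a Δ[n + 1] (boundarySucc (Δ[n + 1] ⊗ T) n (idPair τ)) ∧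
          chainMap (snd Δ[n + 1] R) (n + 1) x = θ (n + 1) (Finsupp.single τ 1) := by
        intro τ
        refine exists_boundary_lift (n + 1) n R _ (ha.2 τ) _ ?_
        rw [chainMap_snd_naturalOp a Δ[n + 1] _ (θ n) ha.1, hθ, ← chainMap_snd_idPair τ]
        exact congr_arg (θ n) (boundary_chainMap _ (n + 1) _)
      choose b hb hb' using key
      refine ⟨b, ⟨hb', fun τ => ?_⟩, hb⟩
      rw [hext n a b hb]
      exact (congr_arg (naturalOp a _) (boundary_boundary _ (n + 2) _)).trans (map_zero _))
  exact ⟨w, fun n => (hw n).1, fun n S z => hext n _ _ (hw' n) S z⟩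

/-- Let `Φ` be a chain map `C(S ⊗ T) → C(S ⊗ R)` natural in `S` that covers a null-homotopic
chain map `C(T) → C(R)`. Then `Φ` sends cycles to boundaries: the null-homotopy lifts. -/
theorem exists_boundary_of_natural {T R : SSet.{u}}
    (Φ : ∀ (n : ℕ) (S : SSet.{u}), Chain (S ⊗ T) n →ₗ[ℚ] Chain (S ⊗ R) n)
    (hnat : ∀ n (S S' : SSet.{u}) (φ : S ⟶ S') (z : Chain (S ⊗ T) n),
      chainMap (φ ▷ R) n (Φ n S z) = Φ n S' (chainMap (φ ▷ T) n z))
    (hd : ∀ n S z, boundary _ (n + 1) (Φ (n + 1) S z) = Φ n S (boundary _ (n + 1) z))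
    (ϕ : ∀ n, Chain T n →ₗ[ℚ] Chain R n)
    (hϕ : ∀ n S z, chainMap (snd S R) n (Φ n S z) = ϕ n (chainMap (snd S T) n z))
    (h : ∀ n, Chain T n →ₗ[ℚ] Chain R (n + 1))
    (h0 : ∀ z, boundary R 1 (h 0 z) = ϕ 0 z)
    (hs : ∀ n z, boundary R (n + 2) (h (n + 1) z) =
      ϕ (n + 1) z - h n (boundarySucc T n z))
    (n : ℕ) (S : SSet.{u}) (z : Chain (S ⊗ T) n) (hz : boundary _ n z = 0) :
    ∃ e : Chain (S ⊗ R) (n + 1), boundary _ (n + 1) e = Φ n S z := by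
  -- By naturality the homotopy relation need only be checked on the pairs `(id, τ)`.
  have hext0 : ∀ (b : T _⦋0⦌ → Chain (Δ[0] ⊗ R) 1),
      (∀ τ, boundary _ 1 (b τ) = Φ 0 Δ[0] (idPair τ)) →
      ∀ (S : SSet.{u}) (z : Chain (S ⊗ T) 0),
        boundary _ 1 (naturalOp b S z) = Φ 0 S z := by
    intro b h
    refine natural_ext (fun S => (boundarySucc _ 0).comp (naturalOp b S))
      (fun S => Φ 0 S) (fun S S' φ z => ?_) (hnat 0) (fun τ => ?_)
    · rw [LinearMap.comp_apply, LinearMap.comp_apply, ← chainMap_naturalOp]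
      exact (boundary_chainMap _ 1 _).symm
    · rw [LinearMap.comp_apply, naturalOp_idPair]
      exact h τ
  have hext : ∀ (n : ℕ) (a : T _⦋n⦌ → Chain (Δ[n] ⊗ R) (n + 1))
      (b : T _⦋n + 1⦌ → Chain (Δ[n + 1] ⊗ R) (n + 2)),
      (∀ τ, boundary _ (n + 2) (b τ) = Φ (n + 1) Δ[n + 1] (idPair τ) -
        naturalOp a Δ[n + 1] (boundarySucc (Δ[n + 1] ⊗ T) n (idPair τ))) →
      ∀ (S : SSet.{u}) (z : Chain (S ⊗ T) (n + 1)),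
        boundary _ (n + 2) (naturalOp b S z) =
          Φ (n + 1) S z - naturalOp a S (boundarySucc _ n z) := by
    intro n a b h
    refine natural_ext (fun S => (boundarySucc _ (n + 1)).comp (naturalOp b S))
      (fun S => Φ (n + 1) S - (naturalOp a S).comp (boundarySucc _ n)) (fun S S' φ z => ?_)
      (fun S S' φ z => ?_) (fun τ => ?_)
    · rw [LinearMap.comp_apply, LinearMap.comp_apply, ← chainMap_naturalOp]
      exact (boundary_chainMap _ (n + 2) _).symm
    · rw [LinearMap.sub_apply, LinearMap.sub_apply, LinearMap.comp_apply, LinearMap.comp_apply,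
        map_sub, hnat, chainMap_naturalOp]
      exact congr_arg (fun x => Φ (n + 1) S' _ - naturalOp a S' x)
        (boundary_chainMap _ (n + 1) _).symm
    · rw [LinearMap.comp_apply, naturalOp_idPair]
      exact h τ
  have hw : ∀ n, ∃ a : T _⦋n⦌ → Chain (Δ[n] ⊗ R) (n + 1),
      ((∀ τ, chainMap (snd Δ[n] R) (n + 1) (a τ) = h n (Finsupp.single τ 1)) ∧
        ∀ τ : T _⦋n + 1⦌, boundary _ (n + 1)
          (naturalOp a Δ[n + 1] (boundarySucc (Δ[n + 1] ⊗ T) n (idPair τ))) =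
            Φ n Δ[n + 1] (boundarySucc (Δ[n + 1] ⊗ T) n (idPair τ))) ∧
        ∀ (S : SSet.{u}) (z : Chain (S ⊗ T) n), boundary _ n z = 0 →
          boundary _ (n + 1) (naturalOp a S z) = Φ n S z := by
    intro n
    induction n with
    | zero =>
      have key : ∀ τ : T _⦋0⦌, ∃ x : Chain (Δ[0] ⊗ R) 1,
          boundary _ 1 x = Φ 0 Δ[0] (idPair τ) ∧
          chainMap (snd Δ[0] R) 1 x = h 0 (Finsupp.single τ 1) := by
        intro τ
        refine exists_boundary_lift 0 0 R _ rfl _ ?_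
        rw [h0, hϕ, chainMap_snd_idPair]
      choose b hb hb' using key
      exact ⟨b, ⟨hb', fun τ => hext0 b hb _ _⟩, fun S z _ => hext0 b hb S z⟩
    | succ n ih =>
      obtain ⟨a, ha⟩ := ih
      have key : ∀ τ : T _⦋n + 1⦌, ∃ x : Chain (Δ[n + 1] ⊗ R) (n + 2),
          boundary _ (n + 2) x = Φ (n + 1) Δ[n + 1] (idPair τ) -
            naturalOp a Δ[n + 1] (boundarySucc (Δ[n + 1] ⊗ T) n (idPair τ)) ∧
          chainMap (snd Δ[n + 1] R) (n + 2) x = h (n + 1) (Finsupp.single τ 1) := by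
        intro τ
        refine exists_boundary_lift (n + 1) (n + 1) R _ ?_ _ ?_
        · rw [map_sub, ha.1.2, hd]
          exact sub_self _
        · rw [map_sub, chainMap_snd_naturalOp a Δ[n + 1] _ (h n) ha.1.1, hs, hϕ,
            chainMap_snd_idPair, ← chainMap_snd_idPair τ]
          exact congr_arg (fun x => ϕ (n + 1) _ - h n x) (boundary_chainMap _ (n + 1) _)
      choose b hb hb' using key
      refine ⟨b, ⟨hb', fun τ => ?_⟩, fun S z hz => ?_⟩
      · refine (hext n a b hb _ _).trans ?_
        have : boundarySucc (Δ[n + 2] ⊗ T) n (boundarySucc (Δ[n + 2] ⊗ T) (n + 1) (idPair τ)) = 0 :=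
          boundary_boundary _ (n + 2) _
        rw [this, map_zero, sub_zero]
      · refine (hext n a b hb _ _).trans ?_
        have : boundarySucc (S ⊗ T) n z = 0 := hz
        rw [this, map_zero, sub_zero]
  obtain ⟨w, hw⟩ := hw n
  exact ⟨naturalOp w S z, hw.2 S z hz⟩

/-- Every linear map of vector spaces has a partial inverse. -/
theorem exists_partialInverse {V W : Type*} [AddCommGroup V] [Module ℚ V] [AddCommGroup W]
    [Module ℚ W] (f : V →ₗ[ℚ] W) : ∃ g : W →ₗ[ℚ] V, ∀ v, f (g (f v)) = f v := by
  obtain ⟨s, hs⟩ := f.rangeRestrict.exists_rightInverse_of_surjective f.range_rangeRestrict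
  obtain ⟨g, hg⟩ := s.exists_extend
  refine ⟨g, fun v => ?_⟩
  have h1 : g (f v) = s (f.rangeRestrict v) := LinearMap.congr_fun hg (f.rangeRestrict v)
  rw [h1]
  exact congr_arg Subtype.val (LinearMap.congr_fun hs (f.rangeRestrict v))

/-- Künneth comparison: if every cycle of `T'` becomes homologous in `T` to a cycle coming from
`T''`, then the same holds after taking the product with any simplicial set `S`. -/
theorem exists_cycle_prod {T T' T'' : SSet.{u}} (f : T' ⟶ T) (g : T'' ⟶ T)
    (hfg : ∀ n (z : Chain T' n), boundary T' n z = 0 → ∃ w : Chain T'' n, boundary T'' n w = 0 ∧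
      ∃ e : Chain T (n + 1), boundary T (n + 1) e = chainMap f n z - chainMap g n w)
    (S : SSet.{u}) (n : ℕ) (z : Chain (S ⊗ T') n) (hz : boundary _ n z = 0) :
    ∃ w : Chain (S ⊗ T'') n, boundary _ n w = 0 ∧ ∃ e : Chain (S ⊗ T) (n + 1),
      boundary _ (n + 1) e = chainMap (S ◁ f) n z - chainMap (S ◁ g) n w := by
  -- `G (w, e) = g w + ∂ e`; its range contains the image of the cycles under `f`.
  let G : ∀ n, (LinearMap.ker (boundary T'' n) × Chain T (n + 1)) →ₗ[ℚ] Chain T n := fun n =>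
    ((chainMap g n).comp (LinearMap.ker (boundary T'' n)).subtype).coprod (boundarySucc T n)
  choose γ hγ using fun n => exists_partialInverse (G n)
  have hγ' : ∀ n (z : Chain T' n), boundary T' n z = 0 →
      chainMap g n (γ n (chainMap f n z)).1.1 + boundarySucc T n (γ n (chainMap f n z)).2 =
        chainMap f n z := by
    intro n z hz
    obtain ⟨w, hw, e, he⟩ := hfg n z hz
    have h1 : chainMap f n z = G n (⟨w, hw⟩, e) := by
      change _ = chainMap g n w + boundarySucc T n e
      rw [← sub_eq_iff_eq_add']
      exact he.symm
    have h2 := hγ n (⟨w, hw⟩, e)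
    rw [← h1] at h2
    exact h2
  choose σ hσ using fun n => exists_partialInverse (boundary T' n)
  -- `π` projects onto a complement of the boundaries in the cycles.
  let π : ∀ n, Chain T' n →ₗ[ℚ] Chain T' n := fun n =>
    (LinearMap.id - (boundarySucc T' n).comp (σ (n + 1))).comp
      (LinearMap.id - (σ n).comp (boundary T' n))
  have hπ : ∀ n z, π n z = (z - σ n (boundary T' n z)) -
      boundarySucc T' n (σ (n + 1) (z - σ n (boundary T' n z))) := fun n z => rfl
  have hdπ : ∀ n z, boundary T' n (π n z) = 0 := by
    intro n z
    have h1 : boundary T' n (boundarySucc T' n (σ (n + 1) (z - σ n (boundary T' n z)))) = 0 :=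
      boundary_boundary T' (n + 1) _
    rw [hπ, map_sub, map_sub, hσ, h1, sub_self, sub_zero]
  have hπd : ∀ n z, π n (boundarySucc T' n z) = 0 := by
    intro n z
    have h1 : boundary T' n (boundarySucc T' n z) = 0 := boundary_boundary T' (n + 1) _
    rw [hπ, h1, map_zero, sub_zero]
    exact sub_eq_zero.2 (hσ (n + 1) z).symm
  let η : ∀ n, Chain T' n →ₗ[ℚ] Chain T' (n + 1) := fun n =>
    (σ (n + 1)).comp (LinearMap.id - (σ n).comp (boundary T' n))
  have hη : ∀ n z, boundarySucc T' n (η n z) = z - σ n (boundary T' n z) - π n z := by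
    intro n z
    rw [hπ, sub_sub_cancel]
    rfl
  have hηd : ∀ n z, η n (boundarySucc T' n z) = σ (n + 1) (boundarySucc T' n z) := by
    intro n z
    have h1 : boundary T' n (boundarySucc T' n z) = 0 := boundary_boundary T' (n + 1) _
    change σ (n + 1) (boundarySucc T' n z - σ n (boundary T' n (boundarySucc T' n z))) = _
    rw [h1, map_zero, sub_zero]
  -- The chain map `θ : C(T') → C(T'')` and the homotopy `h` between `g θ` and `f`.
  let θ : ∀ n, Chain T' n →ₗ[ℚ] Chain T'' n := fun n =>
    ((LinearMap.ker (boundary T'' n)).subtype.comp (LinearMap.fst ℚ _ _)).comp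
      ((γ n).comp ((chainMap f n).comp (π n)))
  let h : ∀ n, Chain T' n →ₗ[ℚ] Chain T (n + 1) := fun n =>
    -((LinearMap.snd ℚ _ _).comp ((γ n).comp ((chainMap f n).comp (π n))) +
      (chainMap f (n + 1)).comp (η n))
  have hgθ : ∀ n z, boundarySucc T n (h n z) =
      chainMap g n (θ n z) - chainMap f n (z - σ n (boundary T' n z)) := by
    intro n z
    have h1 := hγ' n (π n z) (hdπ n z)
    have h2 : boundarySucc T n (chainMap f (n + 1) (η n z)) =
        chainMap f n (z - σ n (boundary T' n z) - π n z) := by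
      rw [← hη]
      exact boundary_chainMap f (n + 1) _
    change boundarySucc T n (-((γ n (chainMap f n (π n z))).2 + chainMap f (n + 1) (η n z))) =
      chainMap g n (γ n (chainMap f n (π n z))).1.1 - _
    rw [map_neg, map_add, h2, eq_sub_of_add_eq' h1, map_sub _ _ (π n z)]
    abel
  have hθd : ∀ n z, boundary T'' n (θ n z) = 0 := fun n z => (γ n (chainMap f n (π n z))).1.2
  have hθd' : ∀ n z, θ n (boundarySucc T' n z) = 0 := by
    intro n z
    change ((γ n (chainMap f n (π n (boundarySucc T' n z)))).1 : Chain T'' n) = 0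
    rw [hπd, map_zero, map_zero]
    rfl
  obtain ⟨w, hw, hw'⟩ := exists_natural_lift θ
    (fun n z => (hθd (n + 1) z).trans (hθd' n z).symm)
  refine ⟨naturalOp (w n) S z, ?_, ?_⟩
  · cases n with
    | zero => rfl
    | succ n => rw [hw', hz, map_zero]
  obtain ⟨e, he⟩ := exists_boundary_of_natural
    (fun n S => (chainMap (S ◁ g) n).comp (naturalOp (w n) S) - chainMap (S ◁ f) n)
    (fun n S S' φ z => by
      rw [LinearMap.sub_apply, LinearMap.sub_apply, LinearMap.comp_apply, LinearMap.comp_apply,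
        map_sub, ← chainMap_naturalOp, ← chainMap_comp, ← chainMap_comp, ← chainMap_comp,
        ← chainMap_comp, whisker_exchange, whisker_exchange])
    (fun n S z => by
      rw [LinearMap.sub_apply, LinearMap.comp_apply, map_sub, boundary_chainMap,
        boundary_chainMap, hw']
      rfl)
    (fun n => (chainMap g n).comp (θ n) - chainMap f n)
    (fun n S z => by
      rw [LinearMap.sub_apply, LinearMap.sub_apply, LinearMap.comp_apply, LinearMap.comp_apply,
        map_sub, ← chainMap_comp, ← chainMap_comp, whiskerLeft_snd, whiskerLeft_snd,
        chainMap_comp, chainMap_comp, chainMap_snd_naturalOp _ _ _ _ (hw n)])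
    h
    (fun z => by
      refine (hgθ 0 z).trans ?_
      have : boundary T' 0 z = 0 := rfl
      rw [this, map_zero, sub_zero]
      rfl)
    (fun n z => by
      refine (hgθ (n + 1) z).trans ?_
      have h1 : h n (boundarySucc T' n z) =
          -chainMap f (n + 1) (σ (n + 1) (boundarySucc T' n z)) := by
        change -((γ n (chainMap f n (π n (boundarySucc T' n z)))).2 +
          chainMap f (n + 1) (η n (boundarySucc T' n z))) = _
        rw [hπd, hηd, map_zero, map_zero, Prod.snd_zero, zero_add]
      rw [h1, map_sub]
      change _ = (chainMap g (n + 1) (θ (n + 1) z) - chainMap f (n + 1) z) - _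
      abel)
    n S z hz
  refine ⟨-e, ?_⟩
  rw [map_neg, he, LinearMap.sub_apply, LinearMap.comp_apply, neg_sub]

/-! ### Skeleta and cup products -/

theorem exists_chainMap_eq {A U : SSet.{u}} (f : A ⟶ U) (n : ℕ) (z : Chain U n)
    (h : ∀ σ ∈ z.support, ∃ τ, f.app (op ⦋n⦌) τ = σ) : ∃ w, chainMap f n w = z := by
  choose g hg using h
  refine ⟨∑ σ : z.support, Finsupp.single (g σ σ.2) (z σ), ?_⟩
  rw [map_sum]
  refine Eq.trans (Finset.sum_congr rfl fun σ _ => ?_)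
    ((Finset.sum_coe_sort z.support fun σ => Finsupp.single σ (z σ)).trans z.sum_single)
  rw [chainMap_single, hg]

theorem chainMap_injective {A U : SSet.{u}} (f : A ⟶ U) (n : ℕ)
    (hf : Function.Injective (f.app (op ⦋n⦌))) : Function.Injective (chainMap f n) :=
  Finsupp.mapDomain_injective hf

theorem boundary_eq_zero_of_injective {A U : SSet.{u}} (f : A ⟶ U)
    (hf : ∀ n, Function.Injective (f.app (op ⦋n⦌))) {n : ℕ} {w : Chain A n}
    (hw : boundary U n (chainMap f n w) = 0) : boundary A n w = 0 :=
  chainMap_injective f _ (hf _) (by rw [← boundary_chainMap, hw, map_zero])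

theorem pairing_zero {S : SSet.{u}} {n : ℕ} (z : Chain S n) :
    pairing (0 : Cochain S n) z = 0 := by
  have := pairing_sub (0 : Cochain S n) 0 z
  rwa [sub_self, sub_self] at this

/-- The subcomplex of `T` generated by the simplices of dimension less than the integer `k`. -/
def skel (T : SSet.{u}) (k : ℤ) : T.Subcomplex where
  obj m := {τ | ∃ (j : ℕ) (_ : (j : ℤ) < k) (α : m.unop ⟶ ⦋j⦌) (τ' : T _⦋j⦌), τ = T.map α.op τ'}
  map := by
    rintro m m' g τ ⟨j, hj, α, τ', rfl⟩
    refine ⟨j, hj, g.unop ≫ α, τ', ?_⟩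
    rw [op_comp, Functor.map_comp]
    rfl

theorem mem_skel_of_lt {T : SSet.{u}} {k : ℤ} {r : ℕ} (hr : (r : ℤ) < k) (τ : T _⦋r⦌) :
    τ ∈ (skel T k).obj (op ⦋r⦌) :=
  ⟨r, hr, 𝟙 ⦋r⦌, τ, by
    change τ = T.map (𝟙 (op ⦋r⦌)) τ
    rw [T.map_id]
    rfl⟩

theorem exists_degenerate_of_mem_skel {T : SSet.{u}} {k : ℤ} {r : ℕ} (hr : k ≤ (r : ℤ))
    (τ : ((skel T k : T.Subcomplex) : SSet.{u}) _⦋r⦌) :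
    ∃ (m : ℕ) (_ : m < r) (α : ⦋r⦌ ⟶ ⦋m⦌) (τ' : ((skel T k : T.Subcomplex) : SSet.{u}) _⦋m⦌),
      τ = ((skel T k : T.Subcomplex) : SSet.{u}).map α.op τ' := by
  obtain ⟨τ, j, hj, α, τ', rfl⟩ := τ
  exact ⟨j, by omega, α, ⟨τ', mem_skel_of_lt hj τ'⟩, rfl⟩

/-- A map `g : T' → T` that is surjective on homology in degrees below `k` captures the homology
of the skeleton: in degrees `≥ k` every cycle of the skeleton is degenerate. -/
theorem exists_cycle_skel {T T' : SSet.{u}} (g : T' ⟶ T) (k : ℤ)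
    (hg : ∀ r : ℕ, (r : ℤ) < k → ∀ z : Chain T r, boundary T r z = 0 → ∃ w : Chain T' r,
      boundary T' r w = 0 ∧ ∃ e : Chain T (r + 1), boundary T (r + 1) e = z - chainMap g r w)
    (r : ℕ) (z : Chain ((skel T k : T.Subcomplex) : SSet.{u}) r) (hz : boundary _ r z = 0) :
    ∃ w : Chain T' r, boundary T' r w = 0 ∧ ∃ e : Chain T (r + 1),
      boundary T (r + 1) e = chainMap (skel T k).ι r z - chainMap g r w := by
  by_cases hr : (r : ℤ) < k
  · exact hg r hr _ (by rw [boundary_chainMap, hz, map_zero])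
  · obtain ⟨e, he⟩ := exists_boundary_of_degenerate r z hz
      fun σ _ => exists_degenerate_of_mem_skel (not_lt.1 hr) σ
    refine ⟨0, map_zero _, chainMap (skel T k).ι (r + 1) e, ?_⟩
    rw [map_zero, sub_zero, ← he]
    exact boundary_chainMap _ _ _

/-- A cocycle that vanishes on the cycles of a subcomplex is cohomologous to one that vanishes on
the subcomplex. -/
theorem exists_cocycle_vanishing {A U : SSet.{u}} (j : A ⟶ U)
    (hj : ∀ n, Function.Injective (j.app (op ⦋n⦌))) {n : ℕ} {φ : Cochain U n}
    (hφ : φ ∈ cocycles U n)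
    (h : ∀ z : Chain A n, boundary A n z = 0 → pairing φ (chainMap j n z) = 0) :
    ∃ φ' ∈ cocycles U n, φ - φ' ∈ coboundaries U n ∧ ∀ σ, φ' (j.app (op ⦋n⦌) σ) = 0 := by
  have h1 : cochainMap j n φ ∈ coboundaries A n :=
    mem_coboundaries_of_pairing_eq_zero fun z hz => by rw [pairing_cochainMap, h z hz]
  cases n with
  | zero => exact ⟨φ, hφ, by rw [sub_self]; exact Submodule.zero_mem _, congr_fun h1⟩
  | succ n =>
    obtain ⟨χ, hχ⟩ := h1
    -- Extend `χ` by zero from `A` to `U`.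
    let χ' : Cochain U n := Function.extend (j.app (op ⦋n⦌)) χ 0
    have hχ' : cochainMap j n χ' = χ := by
      funext σ
      exact (hj n).extend_apply _ _ _
    refine ⟨φ - coboundary U n χ', ?_, ?_, fun σ => ?_⟩
    · refine Submodule.sub_mem _ hφ (LinearMap.mem_ker.2 ?_)
      funext σ
      have h2 : pairing (coboundary U (n + 1) (coboundary U n χ')) (Finsupp.single σ 1) = 0 := by
        rw [pairing_coboundary, pairing_coboundary]
        refine (congr_arg _ (boundary_boundary U (n + 2) _)).trans (map_zero _)
      simpa using h2
    · rw [sub_sub_cancel]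
      exact ⟨χ', rfl⟩
    · have h2 : cochainMap j (n + 1) (coboundary U n χ') = cochainMap j (n + 1) φ := by
        rw [← coboundary_cochainMap, hχ', hχ]
      have h3 := congr_fun h2 σ
      exact sub_eq_zero.2 h3.symm

/-- If `φ` vanishes on `S ⊗ skel k` and `ψ` vanishes on `S ⊗ skel l`, then `φ ∪ ψ` vanishes on
`S ⊗ skel (k + l)`: a simplex of `T` pulled back from dimension `m` has a front face pulled back
from dimension `a` and a back face pulled back from dimension `m - a`, for some `a`. -/
theorem cochainCup_eq_zero_of_mem_skel {S T : SSet.{u}} {k l : ℤ} {p q n : ℕ} (h : p + q = n)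
    {φ : Cochain (S ⊗ T) p} {ψ : Cochain (S ⊗ T) q}
    (hφ : ∀ (s : S _⦋p⦌) (τ : T _⦋p⦌), τ ∈ (skel T k).obj (op ⦋p⦌) → φ (s, τ) = 0)
    (hψ : ∀ (s : S _⦋q⦌) (τ : T _⦋q⦌), τ ∈ (skel T l).obj (op ⦋q⦌) → ψ (s, τ) = 0)
    (s : S _⦋n⦌) (τ : T _⦋n⦌) (hτ : τ ∈ (skel T (k + l)).obj (op ⦋n⦌)) :
    cochainCup (S ⊗ T) h φ ψ (s, τ) = 0 := by
  obtain ⟨m, hm, α, τ', rfl⟩ := hτ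
  change φ (S.map (front h).op s, T.map (front h).op (T.map α.op τ')) *
    ψ (S.map (back h).op s, T.map (back h).op (T.map α.op τ')) = 0
  rw [map_comp_apply, map_comp_apply]
  have hpn : p < n + 1 := by omega
  obtain ⟨a, ha⟩ : ∃ a : ℕ, a = (α.toOrderHom ⟨p, hpn⟩ : Fin (m + 1)).1 := ⟨_, rfl⟩
  have hlt : (α.toOrderHom ⟨p, hpn⟩ : Fin (m + 1)).1 < m + 1 := (α.toOrderHom ⟨p, hpn⟩).2
  have ham : a + (m - a) = m := by omega
  -- The front face factors through `[0, …, a]` and the back face through `[a, …, m]`.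
  by_cases hak : (a : ℤ) < k
  · let α₁ : ⦋p⦌ ⟶ ⦋a⦌ := SimplexCategory.Hom.mk
      { toFun := fun i => ⟨(((front h) ≫ α).toOrderHom i : Fin (m + 1)).1, by
          have h1 : (((front h) ≫ α).toOrderHom i : Fin (m + 1)).1 ≤
              (α.toOrderHom ⟨p, hpn⟩ : Fin (m + 1)).1 :=
            α.toOrderHom.monotone (Nat.lt_succ_iff.1 i.2)
          rw [← ha] at h1
          exact Nat.lt_succ_iff.2 h1⟩
        monotone' := fun i j hij => ((front h) ≫ α).toOrderHom.monotone hij }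
    have h1 : front h ≫ α = α₁ ≫ front ham := by
      ext i : 3
      rfl
    rw [hφ _ _ ⟨a, hak, α₁, T.map (front ham).op τ', by rw [map_comp_apply, h1]⟩, zero_mul]
  · let α₂ : ⦋q⦌ ⟶ ⦋m - a⦌ := SimplexCategory.Hom.mk
      { toFun := fun i => ⟨(((back h) ≫ α).toOrderHom i : Fin (m + 1)).1 - a, by
          have h1 : (((back h) ≫ α).toOrderHom i : Fin (m + 1)).1 < m + 1 :=
            (((back h) ≫ α).toOrderHom i).2
          simp only [SimplexCategory.len_mk]
          omega⟩
        monotone' := fun i j hij => Nat.sub_le_sub_right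
          (((back h) ≫ α).toOrderHom.monotone hij) a }
    have h1 : back h ≫ α = α₂ ≫ back ham := by
      ext i : 3
      apply Fin.ext
      have h2 : (α.toOrderHom ⟨p, hpn⟩ : Fin (m + 1)).1 ≤
          (((back h) ≫ α).toOrderHom i : Fin (m + 1)).1 :=
        α.toOrderHom.monotone (Nat.le_add_right p i.1)
      rw [← ha] at h2
      exact (Nat.add_sub_cancel' h2).symm
    rw [hψ _ _ ⟨m - a, by omega, α₂, T.map (back ham).op τ', by rw [map_comp_apply, h1]⟩,
      mul_zero]

theorem whiskerLeft_skel_injective (S T : SSet.{u}) (k : ℤ) (n : ℕ) :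
    Function.Injective ((S ◁ (skel T k).ι).app (op ⦋n⦌)) := by
  rintro ⟨s, τ⟩ ⟨s', τ'⟩ hst
  have h1 : (s, τ.1) = (s', τ'.1) := hst
  rw [Prod.mk.injEq] at h1
  exact Prod.ext h1.1 (Subtype.ext h1.2)

/-- A cocycle on `S ⊗ T` that vanishes on the cycles coming from `S ⊗ T'`, where `T' → T` is
surjective on homology below degree `k`, is cohomologous to one that vanishes on `S ⊗ skel k`. -/
theorem exists_cocycle_vanishing_skel {S T T' : SSet.{u}} (g : T' ⟶ T) (k : ℤ)
    (hg : ∀ r : ℕ, (r : ℤ) < k → ∀ z : Chain T r, boundary T r z = 0 → ∃ w : Chain T' r,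
      boundary T' r w = 0 ∧ ∃ e : Chain T (r + 1), boundary T (r + 1) e = z - chainMap g r w)
    {n : ℕ} {φ : Cochain (S ⊗ T) n} (hφ : φ ∈ cocycles (S ⊗ T) n)
    (h : ∀ z : Chain (S ⊗ T') n, boundary _ n z = 0 → pairing φ (chainMap (S ◁ g) n z) = 0) :
    ∃ φ' ∈ cocycles (S ⊗ T) n, φ - φ' ∈ coboundaries (S ⊗ T) n ∧
      ∀ (s : S _⦋n⦌) (τ : T _⦋n⦌), τ ∈ (skel T k).obj (op ⦋n⦌) → φ' (s, τ) = 0 := by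
  obtain ⟨φ', h1, h2, h3⟩ := exists_cocycle_vanishing (S ◁ (skel T k).ι)
    (whiskerLeft_skel_injective S T k) hφ (fun z hz => by
      obtain ⟨w, hw, e, he⟩ := exists_cycle_prod (skel T k).ι g (exists_cycle_skel g k hg) S n z hz
      have h4 := pairing_boundary_eq_zero hφ e
      rw [he, map_sub, h w hw, sub_zero] at h4
      exact h4)
  exact ⟨φ', h1, h2, fun s τ hτ => h3 (s, ⟨τ, hτ⟩)⟩

/-- Suppose that `T` has no homology above degree `c`, that `T₁ → T` and `T₂ → T` are surjective
on homology below degrees `k` and `l`, where `k + l = c + 1`, and that cocycles `φ`, `ψ` on `S ⊗ T`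
vanish on the cycles coming from `S ⊗ T₁` and `S ⊗ T₂`. Then `φ ∪ ψ` is a coboundary. -/
theorem cochainCup_mem_coboundaries_of_vanishing {S T T₁ T₂ : SSet.{u}} (c : ℕ)
    (hT : ∀ r, c < r → ∀ z : Chain T r, boundary T r z = 0 →
      ∃ e : Chain T (r + 1), boundary T (r + 1) e = z)
    {k l : ℤ} (hkl : k + l = c + 1) (g₁ : T₁ ⟶ T) (g₂ : T₂ ⟶ T)
    (hg₁ : ∀ r : ℕ, (r : ℤ) < k → ∀ z : Chain T r, boundary T r z = 0 → ∃ w : Chain T₁ r,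
      boundary T₁ r w = 0 ∧ ∃ e : Chain T (r + 1), boundary T (r + 1) e = z - chainMap g₁ r w)
    (hg₂ : ∀ r : ℕ, (r : ℤ) < l → ∀ z : Chain T r, boundary T r z = 0 → ∃ w : Chain T₂ r,
      boundary T₂ r w = 0 ∧ ∃ e : Chain T (r + 1), boundary T (r + 1) e = z - chainMap g₂ r w)
    {p q n : ℕ} (h : p + q = n) {φ : Cochain (S ⊗ T) p} {ψ : Cochain (S ⊗ T) q}
    (hφ : φ ∈ cocycles (S ⊗ T) p) (hψ : ψ ∈ cocycles (S ⊗ T) q)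
    (hφ0 : ∀ z : Chain (S ⊗ T₁) p, boundary _ p z = 0 → pairing φ (chainMap (S ◁ g₁) p z) = 0)
    (hψ0 : ∀ z : Chain (S ⊗ T₂) q, boundary _ q z = 0 → pairing ψ (chainMap (S ◁ g₂) q z) = 0) :
    cochainCup (S ⊗ T) h φ ψ ∈ coboundaries (S ⊗ T) n := by
  obtain ⟨φ', hφ', hφφ', hφ's⟩ := exists_cocycle_vanishing_skel g₁ k hg₁ hφ hφ0
  obtain ⟨ψ', hψ', hψψ', hψ's⟩ := exists_cocycle_vanishing_skel g₂ l hg₂ hψ hψ0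
  have h1 := cochainCup_mem_coboundaries_left (S ⊗ T) h (φ - φ') ψ hφφ' hψ
  have h2 := cochainCup_mem_coboundaries_right (S ⊗ T) h φ' (ψ - ψ') hφ' hψψ'
  have h3 : cochainCup (S ⊗ T) h φ' ψ' ∈ coboundaries (S ⊗ T) n := by
    refine mem_coboundaries_of_pairing_eq_zero fun z hz => ?_
    have hcyc := cochainCup_mem_cocycles (S ⊗ T) h φ' ψ' hφ' hψ'
    obtain ⟨w, hw, e, he⟩ := exists_cycle_prod (𝟙 T) (skel T (k + l)).ι (fun r z hz => by
      by_cases hr : c < r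
      · obtain ⟨e, he⟩ := hT r hr z hz
        exact ⟨0, map_zero _, e, by rw [map_zero, sub_zero, chainMap_id, he]⟩
      · have hr' : (r : ℤ) < k + l := by omega
        obtain ⟨w, hw⟩ := exists_chainMap_eq (skel T (k + l)).ι r z
          fun τ _ => ⟨⟨τ, mem_skel_of_lt hr' τ⟩, rfl⟩
        refine ⟨w, boundary_eq_zero_of_injective (skel T (k + l)).ι
          (fun _ _ _ => Subtype.ext) (by rw [hw, hz]), 0, ?_⟩
        rw [hw, chainMap_id, map_zero, sub_self]) S n z hz
    have h4 := pairing_boundary_eq_zero hcyc e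
    rw [he, map_sub, whiskerLeft_id, chainMap_id, sub_eq_zero] at h4
    rw [h4, ← pairing_cochainMap]
    have h5 : cochainMap (S ◁ (skel T (k + l)).ι) n (cochainCup (S ⊗ T) h φ' ψ') = 0 := by
      funext ⟨s, τ⟩
      exact cochainCup_eq_zero_of_mem_skel h hφ's hψ's s τ.1 τ.2
    rw [h5, pairing_zero]
  have h4 : cochainCup (S ⊗ T) h φ ψ = cochainCup (S ⊗ T) h (φ - φ') ψ +
      (cochainCup (S ⊗ T) h φ' (ψ - ψ') + cochainCup (S ⊗ T) h φ' ψ') := by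
    funext σ
    simp only [cochainCup, Pi.add_apply, Pi.sub_apply]
    ring
  rw [h4]
  exact Submodule.add_mem _ h1 (Submodule.add_mem _ h2 h3)

end Product

section Subdivision

/-! ### Barycentric subdivision of linear chains -/

/-- The simplicial set whose `n`-simplices are the `(n + 1)`-tuples of elements of `A`. -/
def tuples (A : Type u) : SSet.{u} where
  obj m := Fin (m.unop.len + 1) → A
  map f := ↾fun w => w ∘ f.unop.toOrderHom

/-- The simplicial map induced by a map of vertices. -/
def tuplesMap {A A' : Type u} (f : A → A') : tuples A ⟶ tuples A' where
  app _ := ↾fun w => f ∘ w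

variable {A A' : Type u}

/-- The cone of a tuple with apex `a`. -/
def consTuple (a : A) (n : ℕ) (w : (tuples A) _⦋n⦌) : (tuples A) _⦋n + 1⦌ :=
  (Fin.cons a (w : Fin (n + 1) → A) : Fin (n + 2) → A)

/-- The cone operator on linear chains with apex `a`. -/
def cone (a : A) (n : ℕ) : Chain (tuples A) n →ₗ[ℚ] Chain (tuples A) (n + 1) :=
  Finsupp.lmapDomain ℚ ℚ (consTuple a n)

@[simp]
theorem cone_single (a : A) (n : ℕ) (w : (tuples A) _⦋n⦌) (x : ℚ) :
    cone a n (Finsupp.single w x) = Finsupp.single (consTuple a n w) x := by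
  simp [cone]

theorem δ_zero_consTuple (a : A) (n : ℕ) (w : (tuples A) _⦋n⦌) :
    (tuples A).δ 0 (consTuple a n w) = w := by
  funext i
  rfl

theorem δ_succ_consTuple (a : A) (n : ℕ) (w : (tuples A) _⦋n + 1⦌) (i : Fin (n + 2)) :
    (tuples A).δ i.succ (consTuple a (n + 1) w) = consTuple a n ((tuples A).δ i w) := by
  funext j
  refine Fin.cases ?_ (fun j => ?_) j
  · change (Fin.cons a (w : Fin (n + 2) → A) : Fin (n + 3) → A) (i.succ.succAbove 0) = a
    rw [Fin.succ_succAbove_zero]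
    rfl
  · change (Fin.cons a (w : Fin (n + 2) → A) : Fin (n + 3) → A) (i.succ.succAbove j.succ) =
      (w : Fin (n + 2) → A) (i.succAbove j)
    rw [Fin.succ_succAbove_succ]
    rfl

/-- The cone operator is a contracting homotopy in positive degrees. -/
theorem boundary_cone (a : A) (n : ℕ) (z : Chain (tuples A) (n + 1)) :
    boundarySucc (tuples A) (n + 1) (cone a (n + 1) z) =
      z - cone a n (boundarySucc (tuples A) n z) := by
  induction z using Finsupp.induction_linear with
  | zero => simp
  | add x y hx hy => rw [map_add, map_add, map_add, map_add, hx, hy]; abel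
  | single w x =>
    rw [cone_single]
    refine (boundary_single _ _ _).trans ?_
    rw [Fin.sum_univ_succ]
    have h1 : boundarySucc (tuples A) n (Finsupp.single w x) =
        ∑ i : Fin (n + 2), (-1 : ℚ) ^ (i : ℕ) • Finsupp.single ((tuples A).δ i w) x :=
      boundary_single _ _ _
    rw [h1, δ_zero_consTuple, map_sum, sub_eq_add_neg, ← Finset.sum_neg_distrib, Fin.val_zero,
      pow_zero, one_smul]
    congr 1
    refine Finset.sum_congr rfl fun i _ => ?_
    rw [δ_succ_consTuple, map_smul, cone_single, Fin.val_succ, pow_succ, mul_neg_one, neg_smul]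

/-- In degree zero, the cone on a boundary is still a filling of it. -/
theorem boundary_cone_boundary (a : A) (z : Chain (tuples A) 1) :
    boundarySucc (tuples A) 0 (cone a 0 (boundarySucc (tuples A) 0 z)) =
      boundarySucc (tuples A) 0 z := by
  have h := boundary_cone a 0 z
  have h1 : boundarySucc (tuples A) 0 (boundarySucc (tuples A) 1 (cone a 1 z)) = 0 :=
    boundary_boundary _ 2 _
  rw [h, map_sub, sub_eq_zero] at h1
  exact h1.symm

theorem chainMap_cone (f : A → A') (a : A) (n : ℕ) (z : Chain (tuples A) n) :
    chainMap (tuplesMap f) (n + 1) (cone a n z) = cone (f a) n (chainMap (tuplesMap f) n z) := by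
  induction z using Finsupp.induction_linear with
  | zero => simp
  | add x y hx hy => simp only [map_add, hx, hy]
  | single w x =>
    rw [cone_single, chainMap_single, chainMap_single, cone_single]
    congr 1
    funext j
    refine Fin.cases rfl (fun j => rfl) j

section Subdivision

variable (c : ∀ n, (tuples A) _⦋n⦌ → A) (c' : ∀ n, (tuples A') _⦋n⦌ → A')

/-- The barycentric subdivision operator on linear chains, relative to a choice `c w` of a
"barycenter" for each tuple `w`: the subdivision of `w` is the cone with apex `c w` on the
subdivision of the boundary of `w`. -/
def subdiv (n : ℕ) : Chain (tuples A) n →ₗ[ℚ] Chain (tuples A) n :=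
  match n with
  | 0 => LinearMap.id
  | n + 1 => Finsupp.linearCombination ℚ fun w =>
      cone (c (n + 1) w) n (subdiv n (boundarySucc (tuples A) n (Finsupp.single w 1)))

/-- The homotopy between the identity and barycentric subdivision. -/
def subdivHomotopy (n : ℕ) : Chain (tuples A) n →ₗ[ℚ] Chain (tuples A) (n + 1) :=
  match n with
  | 0 => 0
  | n + 1 => Finsupp.linearCombination ℚ fun w => cone (c (n + 1) w) (n + 1)
      (Finsupp.single w 1 - subdivHomotopy n (boundarySucc (tuples A) n (Finsupp.single w 1)))

theorem subdiv_succ_single (n : ℕ) (w : (tuples A) _⦋n + 1⦌) :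
    subdiv c (n + 1) (Finsupp.single w 1) =
      cone (c (n + 1) w) n (subdiv c n (boundarySucc (tuples A) n (Finsupp.single w 1))) := by
  rw [subdiv, Finsupp.linearCombination_single, one_smul]

theorem subdivHomotopy_succ_single (n : ℕ) (w : (tuples A) _⦋n + 1⦌) :
    subdivHomotopy c (n + 1) (Finsupp.single w 1) = cone (c (n + 1) w) (n + 1)
      (Finsupp.single w 1 -
        subdivHomotopy c n (boundarySucc (tuples A) n (Finsupp.single w 1))) := by
  rw [subdivHomotopy, Finsupp.linearCombination_single, one_smul]

theorem chain_hom_ext {S : SSet.{u}} {n : ℕ} {M : Type*} [AddCommGroup M] [Module ℚ M]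
    {f g : Chain S n →ₗ[ℚ] M} (h : ∀ σ, f (Finsupp.single σ 1) = g (Finsupp.single σ 1)) :
    f = g :=
  Finsupp.lhom_ext' fun σ => LinearMap.ext_ring (h σ)

theorem boundary_subdiv (n : ℕ) (z : Chain (tuples A) (n + 1)) :
    boundarySucc (tuples A) n (subdiv c (n + 1) z) =
      subdiv c n (boundarySucc (tuples A) n z) := by
  induction n with
  | zero =>
    refine LinearMap.congr_fun (f := (boundarySucc (tuples A) 0).comp (subdiv c 1))
      (g := (subdiv c 0).comp (boundarySucc (tuples A) 0)) (chain_hom_ext fun w => ?_) z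
    rw [LinearMap.comp_apply, LinearMap.comp_apply, subdiv_succ_single]
    exact boundary_cone_boundary _ _
  | succ n ih =>
    refine LinearMap.congr_fun (f := (boundarySucc (tuples A) (n + 1)).comp (subdiv c (n + 2)))
      (g := (subdiv c (n + 1)).comp (boundarySucc (tuples A) (n + 1)))
      (chain_hom_ext fun w => ?_) z
    have h : boundarySucc (tuples A) n (boundarySucc (tuples A) (n + 1) (Finsupp.single w 1)) = 0 :=
      boundary_boundary _ (n + 2) _
    rw [LinearMap.comp_apply, LinearMap.comp_apply, subdiv_succ_single, boundary_cone, ih, h,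
      map_zero, map_zero, sub_zero]

theorem boundary_subdivHomotopy (n : ℕ) (z : Chain (tuples A) (n + 1)) :
    boundarySucc (tuples A) (n + 1) (subdivHomotopy c (n + 1) z) =
      z - subdiv c (n + 1) z - subdivHomotopy c n (boundarySucc (tuples A) n z) := by
  refine LinearMap.congr_fun
    (f := (boundarySucc (tuples A) (n + 1)).comp (subdivHomotopy c (n + 1)))
    (g := LinearMap.id - subdiv c (n + 1) -
      (subdivHomotopy c n).comp (boundarySucc (tuples A) n)) (chain_hom_ext fun w => ?_) z
  rw [LinearMap.comp_apply, LinearMap.sub_apply, LinearMap.sub_apply, LinearMap.comp_apply,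
    LinearMap.id_apply, subdivHomotopy_succ_single, boundary_cone, subdiv_succ_single]
  have h : boundarySucc (tuples A) n (subdivHomotopy c n
      (boundarySucc (tuples A) n (Finsupp.single w 1))) =
      boundarySucc (tuples A) n (Finsupp.single w 1) -
        subdiv c n (boundarySucc (tuples A) n (Finsupp.single w 1)) := by
    cases n with
    | zero =>
      rw [subdivHomotopy, subdiv, LinearMap.id_apply, sub_self, LinearMap.zero_apply, map_zero]
    | succ n =>
      have h1 : boundarySucc (tuples A) n
          (boundarySucc (tuples A) (n + 1) (Finsupp.single w 1)) = 0 :=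
        boundary_boundary _ (n + 2) _
      rw [boundary_subdivHomotopy n, h1, map_zero, sub_zero]
  rw [map_sub _ (Finsupp.single w 1), h, sub_sub_cancel, sub_right_comm]

variable {c c'} {f : A → A'}
  (hf : ∀ n (w : (tuples A) _⦋n⦌), f (c n w) = c' n ((tuplesMap f).app (op ⦋n⦌) w))
include hf

theorem chainMap_subdiv (n : ℕ) (z : Chain (tuples A) n) :
    chainMap (tuplesMap f) n (subdiv c n z) = subdiv c' n (chainMap (tuplesMap f) n z) := by
  induction n with
  | zero => rfl
  | succ n ih =>
    refine LinearMap.congr_fun (f := (chainMap (tuplesMap f) (n + 1)).comp (subdiv c (n + 1)))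
      (g := (subdiv c' (n + 1)).comp (chainMap (tuplesMap f) (n + 1)))
      (chain_hom_ext fun w => ?_) z
    rw [LinearMap.comp_apply, LinearMap.comp_apply, subdiv_succ_single, chainMap_cone, ih, hf,
      chainMap_single, subdiv_succ_single, ← chainMap_single]
    exact congr_arg (fun x => cone _ n (subdiv c' n x)) (boundary_chainMap _ _ _).symm

theorem chainMap_subdivHomotopy (n : ℕ) (z : Chain (tuples A) n) :
    chainMap (tuplesMap f) (n + 1) (subdivHomotopy c n z) =
      subdivHomotopy c' n (chainMap (tuplesMap f) n z) := by
  induction n with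
  | zero => rw [subdivHomotopy, subdivHomotopy, LinearMap.zero_apply, LinearMap.zero_apply,
      map_zero]
  | succ n ih =>
    refine LinearMap.congr_fun
      (f := (chainMap (tuplesMap f) (n + 2)).comp (subdivHomotopy c (n + 1)))
      (g := (subdivHomotopy c' (n + 1)).comp (chainMap (tuplesMap f) (n + 1)))
      (chain_hom_ext fun w => ?_) z
    rw [LinearMap.comp_apply, LinearMap.comp_apply, subdivHomotopy_succ_single, chainMap_cone,
      map_sub, ih, hf, chainMap_single, subdivHomotopy_succ_single, ← chainMap_single]
    exact congr_arg (fun x => cone _ (n + 1) (_ - subdivHomotopy c' n x))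
      (boundary_chainMap _ _ _).symm

end Subdivision

end Subdivision

/-! ### Supports of chains -/

theorem map_mem_of_mem_supported {α M : Type*} [AddCommGroup M] [Module ℚ M] {s : Set α}
    {P : Submodule ℚ M} (f : (α →₀ ℚ) →ₗ[ℚ] M) (h : ∀ x ∈ s, f (Finsupp.single x 1) ∈ P)
    {z : α →₀ ℚ} (hz : z ∈ Finsupp.supported ℚ ℚ s) : f z ∈ P := by
  rw [Finsupp.supported_eq_span_single] at hz
  have h1 : Submodule.span ℚ ((fun x => Finsupp.single x (1 : ℚ)) '' s) ≤ P.comap f := by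
    rw [Submodule.span_le]
    rintro _ ⟨x, hx, rfl⟩
    exact h x hx
  exact h1 hz

theorem chainMap_mem_supported {S T : SSet.{u}} (f : S ⟶ T) {n : ℕ} {s : Set (S _⦋n⦌)}
    {t : Set (T _⦋n⦌)} (h : ∀ σ ∈ s, f.app (op ⦋n⦌) σ ∈ t) {z : Chain S n}
    (hz : z ∈ Finsupp.supported ℚ ℚ s) : chainMap f n z ∈ Finsupp.supported ℚ ℚ t := by
  refine map_mem_of_mem_supported (chainMap f n) (fun σ hσ => ?_) hz
  rw [chainMap_single]
  exact Finsupp.single_mem_supported _ _ (h σ hσ)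

theorem boundary_mem_supported {S : SSet.{u}} {n : ℕ} {s : Set (S _⦋n + 1⦌)} {t : Set (S _⦋n⦌)}
    (h : ∀ σ ∈ s, ∀ i, S.δ i σ ∈ t) {z : Chain S (n + 1)} (hz : z ∈ Finsupp.supported ℚ ℚ s) :
    boundarySucc S n z ∈ Finsupp.supported ℚ ℚ t := by
  refine map_mem_of_mem_supported (boundarySucc S n) (fun σ hσ => ?_) hz
  have h1 : boundarySucc S n (Finsupp.single σ 1) =
      ∑ i : Fin (n + 2), (-1 : ℚ) ^ (i : ℕ) • Finsupp.single (S.δ i σ) 1 := boundary_single _ _ _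
  rw [h1]
  exact Submodule.sum_mem _ fun i _ =>
    Submodule.smul_mem _ _ (Finsupp.single_mem_supported _ _ (h σ hσ i))

/-! ### Affine simplices in the standard simplex -/

/-- The affine map of simplices with prescribed vertices. -/
def affineMap {m N : ℕ} (w : Fin (m + 1) → stdSimplex ℝ (Fin (N + 1))) :
    C(stdSimplex ℝ (Fin (m + 1)), stdSimplex ℝ (Fin (N + 1))) where
  toFun t := ⟨∑ i, t.1 i • (w i).1, (convex_stdSimplex ℝ _).sum_mem (fun i _ => t.2.1 i) t.2.2
    fun i _ => (w i).2⟩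
  continuous_toFun := by
    refine Continuous.subtype_mk (continuous_finsetSum _ fun i _ => ?_) _
    exact ((continuous_apply i).comp continuous_subtype_val).smul continuous_const

theorem affineMap_coe {m N : ℕ} (w : Fin (m + 1) → stdSimplex ℝ (Fin (N + 1)))
    (t : stdSimplex ℝ (Fin (m + 1))) : (affineMap w t).1 = ∑ i, t.1 i • (w i).1 := rfl

theorem affineMap_comp {m m' N : ℕ} (w : Fin (m + 1) → stdSimplex ℝ (Fin (N + 1)))
    (α : Fin (m' + 1) → Fin (m + 1)) (t : stdSimplex ℝ (Fin (m' + 1))) :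
    affineMap (w ∘ α) t = affineMap w (stdSimplex.map α t) := by
  refine Subtype.ext ?_
  rw [affineMap_coe, affineMap_coe]
  have h : ∀ i, (stdSimplex.map α t).1 i = ∑ j with α j = i, t.1 j := fun i =>
    FunOnFinite.linearMap_apply_apply ℝ ℝ α _ i
  simp only [h, Finset.sum_smul, Function.comp_apply]
  rw [← Finset.sum_fiberwise Finset.univ α]
  refine Finset.sum_congr rfl fun i _ => Finset.sum_congr rfl fun j hj => ?_
  rw [(Finset.mem_filter.1 hj).2]

theorem map_affineMap {m N N' : ℕ} (w : Fin (m + 1) → stdSimplex ℝ (Fin (N + 1)))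
    (α : Fin (N + 1) → Fin (N' + 1)) (t : stdSimplex ℝ (Fin (m + 1))) :
    stdSimplex.map α (affineMap w t) = affineMap (fun i => stdSimplex.map α (w i)) t := by
  refine Subtype.ext ?_
  rw [affineMap_coe]
  change FunOnFinite.linearMap ℝ ℝ α (∑ i, t.1 i • (w i).1) = _
  rw [map_sum]
  refine Finset.sum_congr rfl fun i _ => ?_
  rw [map_smul]
  rfl

theorem affineMap_vertex (m : ℕ) (t : stdSimplex ℝ (Fin (m + 1))) :
    affineMap (fun i => stdSimplex.vertex i) t = t := by
  refine Subtype.ext ?_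
  rw [affineMap_coe]
  funext j
  simp [Finset.sum_apply, Pi.single_apply]

/-- The standard simplex, lifted to the ambient universe. -/
abbrev USimplex (N : ℕ) : Type u := ULift.{u} (stdSimplex ℝ (Fin (N + 1)))

/-- The tuple of vertices of the standard simplex. -/
def vertices (N : ℕ) : (tuples (USimplex.{u} N)) _⦋N⦌ :=
  fun i : Fin (N + 1) => (⟨stdSimplex.vertex i⟩ : USimplex.{u} N)

/-- The underlying points of a tuple in the standard simplex. -/
def points {N m : ℕ} (w : (tuples (USimplex.{u} N)) _⦋m⦌) :
    Fin (m + 1) → stdSimplex ℝ (Fin (N + 1)) :=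
  fun i => ((w : Fin (m + 1) → USimplex.{u} N) i).down

/-- The barycenter of a tuple in the standard simplex. -/
def center (N n : ℕ) (w : (tuples (USimplex.{u} N)) _⦋n⦌) : USimplex.{u} N :=
  ⟨affineMap (points w) stdSimplex.barycenter⟩

/-- The map of vertices induced by a map of finite sets. -/
def vertexMap {N N' : ℕ} (α : Fin (N + 1) → Fin (N' + 1)) (x : USimplex.{u} N) : USimplex.{u} N' :=
  ⟨stdSimplex.map α x.down⟩

theorem vertexMap_center {N N' : ℕ} (α : Fin (N + 1) → Fin (N' + 1)) (n : ℕ)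
    (w : (tuples (USimplex.{u} N)) _⦋n⦌) :
    vertexMap α (center N n w) = center N' n ((tuplesMap (vertexMap α)).app (op ⦋n⦌) w) :=
  congr_arg ULift.up (map_affineMap _ _ _)

/-! ### Iterated subdivision of singular chains -/

/-- The iterated barycentric subdivision in the standard simplex. -/
def subdivIter (N n k : ℕ) :
    Chain (tuples (USimplex.{u} N)) n →ₗ[ℚ] Chain (tuples (USimplex N)) n :=
  match k with
  | 0 => LinearMap.id
  | k + 1 => (subdiv (center N) n).comp (subdivIter N n k)

/-- The homotopy between the identity and the iterated barycentric subdivision. -/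
def subdivIterHomotopy (N n k : ℕ) :
    Chain (tuples (USimplex.{u} N)) n →ₗ[ℚ] Chain (tuples (USimplex N)) (n + 1) :=
  match k with
  | 0 => 0
  | k + 1 => subdivIterHomotopy N n k + (subdivHomotopy (center N) n).comp (subdivIter N n k)

theorem boundary_subdivIter (N n k : ℕ) (z : Chain (tuples (USimplex.{u} N)) (n + 1)) :
    boundarySucc _ n (subdivIter N (n + 1) k z) = subdivIter N n k (boundarySucc _ n z) := by
  induction k with
  | zero => rfl
  | succ k ih =>
    rw [subdivIter, subdivIter, LinearMap.comp_apply, LinearMap.comp_apply, boundary_subdiv, ih]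

theorem boundary_subdivIterHomotopy (N n k : ℕ) (z : Chain (tuples (USimplex.{u} N)) (n + 1)) :
    boundarySucc _ (n + 1) (subdivIterHomotopy N (n + 1) k z) =
      z - subdivIter N (n + 1) k z - subdivIterHomotopy N n k (boundarySucc _ n z) := by
  induction k with
  | zero =>
    simp only [subdivIter, subdivIterHomotopy, LinearMap.zero_apply, map_zero, LinearMap.id_apply,
      sub_self]
  | succ k ih =>
    simp only [subdivIter, subdivIterHomotopy, LinearMap.add_apply, map_add, LinearMap.comp_apply,
      ih, boundary_subdivHomotopy, boundary_subdivIter]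
    abel

theorem chainMap_subdivIter {N N' : ℕ} (α : Fin (N + 1) → Fin (N' + 1)) (n k : ℕ)
    (z : Chain (tuples (USimplex.{u} N)) n) :
    chainMap (tuplesMap (vertexMap α)) n (subdivIter N n k z) =
      subdivIter N' n k (chainMap (tuplesMap (vertexMap α)) n z) := by
  induction k with
  | zero => rfl
  | succ k ih =>
    rw [subdivIter, subdivIter, LinearMap.comp_apply, LinearMap.comp_apply,
      chainMap_subdiv (vertexMap_center α), ih]

theorem chainMap_subdivIterHomotopy {N N' : ℕ} (α : Fin (N + 1) → Fin (N' + 1)) (n k : ℕ)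
    (z : Chain (tuples (USimplex.{u} N)) n) :
    chainMap (tuplesMap (vertexMap α)) (n + 1) (subdivIterHomotopy N n k z) =
      subdivIterHomotopy N' n k (chainMap (tuplesMap (vertexMap α)) n z) := by
  induction k with
  | zero => rw [subdivIterHomotopy, subdivIterHomotopy, LinearMap.zero_apply, LinearMap.zero_apply,
      map_zero]
  | succ k ih =>
    rw [subdivIterHomotopy, subdivIterHomotopy, LinearMap.add_apply, LinearMap.add_apply, map_add,
      LinearMap.comp_apply, LinearMap.comp_apply, chainMap_subdivHomotopy (vertexMap_center α),
      chainMap_subdivIter, ih]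

/-- The singular simplicial set of a space. -/
abbrev Sing (X : Type u) [TopologicalSpace X] : SSet.{u} := TopCat.toSSet.obj (TopCat.of X)

section

variable {X : Type u} [TopologicalSpace X]

/-- The continuous map underlying a singular simplex. -/
def toMap {n : ℕ} (σ : (Sing X) _⦋n⦌) : C(stdSimplex ℝ (Fin (n + 1)), X) :=
  TopCat.toSSetObjEquiv (TopCat.of X) (op ⦋n⦌) σ

/-- The singular simplex given by a continuous map. -/
def ofMap {n : ℕ} (f : C(stdSimplex ℝ (Fin (n + 1)), X)) : (Sing X) _⦋n⦌ :=
  (TopCat.toSSetObjEquiv (TopCat.of X) (op ⦋n⦌)).symm f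

theorem toMap_injective {n : ℕ} : Function.Injective (toMap : (Sing X) _⦋n⦌ → _) :=
  (TopCat.toSSetObjEquiv (TopCat.of X) (op ⦋n⦌)).injective

/-- A singular simplex sends linear simplices of the standard simplex to singular simplices. -/
def push {N : ℕ} (σ : (Sing X) _⦋N⦌) : tuples (USimplex.{u} N) ⟶ Sing X where
  app m := ↾fun w => (TopCat.toSSetObjEquiv (TopCat.of X) m).symm
    ((toMap σ).comp (affineMap (m := m.unop.len) (points (m := m.unop.len) w)))
  naturality m m' g := by
    ext w
    apply (TopCat.toSSetObjEquiv (TopCat.of X) m').injective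
    ext t
    exact congr_arg (toMap σ) (affineMap_comp (points (m := m.unop.len) w) g.unop.toOrderHom t)

theorem toMap_push {N m : ℕ} (σ : (Sing X) _⦋N⦌) (w : (tuples (USimplex.{u} N)) _⦋m⦌) :
    toMap ((push σ).app (op ⦋m⦌) w) = (toMap σ).comp (affineMap (points w)) := rfl

theorem push_vertices {N : ℕ} (σ : (Sing X) _⦋N⦌) :
    (push σ).app (op ⦋N⦌) (vertices N) = σ := by
  apply toMap_injective
  ext t
  rw [toMap_push]
  exact congr_arg (toMap σ) (affineMap_vertex N t)

theorem push_δ {N : ℕ} (σ : (Sing X) _⦋N + 1⦌) (i : Fin (N + 2)) :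
    push ((Sing X).δ i σ) = tuplesMap (vertexMap i.succAbove) ≫ push σ := by
  ext m w
  apply (TopCat.toSSetObjEquiv (TopCat.of X) m).injective
  ext t
  exact congr_arg (toMap σ) (map_affineMap (points (m := m.unop.len) w) i.succAbove t)

theorem tuplesMap_vertices (N : ℕ) (i : Fin (N + 2)) :
    (tuplesMap (vertexMap i.succAbove)).app (op ⦋N⦌) (vertices.{u} N) =
      (tuples _).δ i (vertices (N + 1)) := by
  funext j
  exact congr_arg ULift.up (stdSimplex.map_vertex _ _)

/-- The operator on singular chains induced by an operator on linear chains. -/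
def singularOp {n m : ℕ}
    (P : Chain (tuples (USimplex.{u} n)) n →ₗ[ℚ] Chain (tuples (USimplex n)) m) :
    Chain (Sing X) n →ₗ[ℚ] Chain (Sing X) m :=
  Finsupp.linearCombination ℚ fun σ => chainMap (push σ) m (P (Finsupp.single (vertices n) 1))

theorem singularOp_single {n m : ℕ}
    (P : Chain (tuples (USimplex.{u} n)) n →ₗ[ℚ] Chain (tuples (USimplex n)) m)
    (σ : (Sing X) _⦋n⦌) : singularOp P (Finsupp.single σ 1) =
      chainMap (push σ) m (P (Finsupp.single (vertices n) 1)) := by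
  rw [singularOp, Finsupp.linearCombination_single, one_smul]

/-- Iterated barycentric subdivision of singular chains is chain homotopic to the identity. -/
theorem boundary_singularOp {n : ℕ} (k : ℕ) (z : Chain (Sing X) (n + 1)) :
    boundarySucc _ (n + 1) (singularOp (subdivIterHomotopy (n + 1) (n + 1) k) z) =
      z - singularOp (subdivIter (n + 1) (n + 1) k) z -
        singularOp (subdivIterHomotopy n n k) (boundarySucc _ n z) := by
  refine LinearMap.congr_fun
    (f := (boundarySucc (Sing X) (n + 1)).comp (singularOp (subdivIterHomotopy (n + 1) (n + 1) k)))
    (g := LinearMap.id - singularOp (subdivIter (n + 1) (n + 1) k) -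
      (singularOp (subdivIterHomotopy n n k)).comp (boundarySucc (Sing X) n))
    (chain_hom_ext fun σ => ?_) z
  rw [LinearMap.comp_apply, LinearMap.sub_apply, LinearMap.sub_apply, LinearMap.comp_apply,
    LinearMap.id_apply, singularOp_single, singularOp_single]
  have h1 : boundarySucc (Sing X) n (Finsupp.single σ 1) =
    ∑ i : Fin (n + 2), (-1 : ℚ) ^ (i : ℕ) • Finsupp.single ((Sing X).δ i σ) 1 :=
      boundary_single _ _ _
  have h2 : boundarySucc _ n (Finsupp.single (vertices.{u} (n + 1)) 1) =
    ∑ i : Fin (n + 2), (-1 : ℚ) ^ (i : ℕ) •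
      chainMap (tuplesMap (vertexMap i.succAbove)) n (Finsupp.single (vertices n) 1) := by
    refine (boundary_single _ _ _).trans (Finset.sum_congr rfl fun i _ => ?_)
    rw [chainMap_single, tuplesMap_vertices]
  have h3 : singularOp (subdivIterHomotopy n n k) (boundarySucc (Sing X) n (Finsupp.single σ 1)) =
      chainMap (push σ) (n + 1) (subdivIterHomotopy (n + 1) n k
        (boundarySucc _ n (Finsupp.single (vertices (n + 1)) 1))) := by
    rw [h1, h2, map_sum, map_sum, map_sum]
    refine Finset.sum_congr rfl fun i _ => ?_
    rw [map_smul, map_smul, map_smul, singularOp_single, ← chainMap_subdivIterHomotopy,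
      ← chainMap_comp, push_δ]
  rw [h3]
  refine (boundary_chainMap (push σ) (n + 2) _).trans ?_
  refine (congr_arg (chainMap (push σ) (n + 1))
    (boundary_subdivIterHomotopy (n + 1) n k (Finsupp.single (vertices (n + 1)) 1))).trans ?_
  rw [map_sub, map_sub, chainMap_single, push_vertices]

end

/-! ### The mesh of iterated subdivisions -/

/-- The tuples in the standard simplex all of whose points lie in `C` and have mutual distances at
most `D`. -/
def meshSet (N m : ℕ) (D : ℝ) (C : Set (Fin (N + 1) → ℝ)) :
    Set ((tuples (USimplex.{u} N)) _⦋m⦌) :=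
  {w | (∀ i, (points w i).1 ∈ C) ∧ ∀ i j, dist (points w i).1 (points w j).1 ≤ D}

theorem center_coe (N n : ℕ) (w : (tuples (USimplex.{u} N)) _⦋n⦌) :
    (center N n w).down.1 = ∑ i, ((n : ℝ) + 1)⁻¹ • (points w i).1 := by
  refine (affineMap_coe _ _).trans (Finset.sum_congr rfl fun i _ => ?_)
  congr 1
  refine (stdSimplex.barycenter_apply i).trans ?_
  simp

theorem dist_center_le (N n : ℕ) {D : ℝ} {C : Set (Fin (N + 1) → ℝ)}
    {w : (tuples (USimplex.{u} N)) _⦋n⦌} (hw : w ∈ meshSet N n D C) (i : Fin (n + 1)) :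
    dist (points w i).1 (center N n w).down.1 ≤ n / (n + 1) * D := by
  have hn : (0 : ℝ) < n + 1 := by positivity
  have h1 : (center N n w).down.1 - (points w i).1 =
      ((n : ℝ) + 1)⁻¹ • ∑ j, ((points w j).1 - (points w i).1) := by
    rw [center_coe, Finset.sum_sub_distrib, smul_sub, Finset.smul_sum, Finset.sum_const,
      Finset.card_univ, Fintype.card_fin, ← Nat.cast_smul_eq_nsmul ℝ, smul_smul]
    push_cast
    rw [inv_mul_cancel₀ hn.ne', one_smul]
  rw [dist_comm, dist_eq_norm, h1, norm_smul, norm_inv, Real.norm_of_nonneg hn.le]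
  have h2 : ‖∑ j, ((points w j).1 - (points w i).1)‖ ≤ n * D := by
    rw [← Finset.sum_erase Finset.univ (f := fun j => (points w j).1 - (points w i).1) (a := i)
      (sub_self _)]
    refine (norm_sum_le_of_le (n := fun _ => D) _ fun j _ => ?_).trans (le_of_eq ?_)
    · rw [← dist_eq_norm]
      exact hw.2 j i
    · rw [Finset.sum_const, Finset.card_erase_of_mem (Finset.mem_univ i), Finset.card_univ,
        Fintype.card_fin, nsmul_eq_mul, Nat.add_sub_cancel]
  calc ((n : ℝ) + 1)⁻¹ * ‖∑ j, ((points w j).1 - (points w i).1)‖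
      ≤ ((n : ℝ) + 1)⁻¹ * (n * D) := by gcongr
    _ = n / (n + 1) * D := by ring

/-- Barycentric subdivision of an `m`-simplex shrinks diameters by the factor `m / (m + 1)`. -/
theorem subdiv_single_mem_supported (N m : ℕ) {D : ℝ} {C : Set (Fin (N + 1) → ℝ)}
    (hC : Convex ℝ C) {w : (tuples (USimplex.{u} N)) _⦋m⦌} (hw : w ∈ meshSet N m D C) :
    subdiv (center N) m (Finsupp.single w 1) ∈
      Finsupp.supported ℚ ℚ (meshSet N m (m / (m + 1) * D) C) := by
  induction m generalizing C with
  | zero =>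
    refine Finsupp.single_mem_supported _ _ ⟨hw.1, fun i j => ?_⟩
    rw [show i = j from Fin.ext (by omega), dist_self]
    simp
  | succ m ih =>
    have hD : 0 ≤ D := (dist_nonneg).trans (hw.2 0 0)
    let b := center N (m + 1) w
    let R : ℝ := ((m + 1 : ℕ) : ℝ) / ((m + 1 : ℕ) + 1) * D
    have hb : b.down.1 ∈ C := by
      rw [center_coe]
      refine hC.sum_mem (fun _ _ => by positivity) ?_ fun i _ => hw.1 i
      rw [Finset.sum_const, Finset.card_univ, Fintype.card_fin, nsmul_eq_mul]
      push_cast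
      exact mul_inv_cancel₀ (by positivity)
    -- The faces are subdivided inside `C'`, whose points are all close to the barycenter.
    let C' := C ∩ Metric.closedBall b.down.1 R
    have hC' : Convex ℝ C' := hC.inter (convex_closedBall _ _)
    rw [subdiv_succ_single]
    have h1 : boundarySucc _ m (Finsupp.single w 1) ∈
        Finsupp.supported ℚ ℚ (meshSet N m D C') := by
      refine boundary_mem_supported (s := {w}) ?_ (Finsupp.single_mem_supported _ _ rfl)
      rintro _ rfl i
      exact ⟨fun j => ⟨hw.1 (i.succAbove j), dist_center_le N (m + 1) hw (i.succAbove j)⟩,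
        fun j j' => hw.2 (i.succAbove j) (i.succAbove j')⟩
    have h2 := map_mem_of_mem_supported _ (fun v hv => ih hC' hv) h1
    refine map_mem_of_mem_supported (cone _ m) (fun v hv => ?_) h2
    rw [cone_single]
    refine Finsupp.single_mem_supported _ _ ⟨?_, ?_⟩
    · refine Fin.cases hb fun j => (hv.1 j).1
    · have h3 : (m : ℝ) / (m + 1) * D ≤ R := by
        refine mul_le_mul_of_nonneg_right ?_ hD
        push_cast
        rw [div_le_div_iff₀ (by positivity) (by positivity)]
        nlinarith
      have hR : 0 ≤ R := by positivity
      refine Fin.cases (Fin.cases ?_ fun j => ?_) fun i => Fin.cases ?_ fun j => ?_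
      · exact (dist_self _).trans_le hR
      · exact (dist_comm _ _).trans_le (hv.1 j).2
      · exact (hv.1 i).2
      · exact (hv.2 i j).trans h3

theorem subdivIter_mem_supported (N k : ℕ) :
    subdivIter.{u} N N k (Finsupp.single (vertices N) 1) ∈
      Finsupp.supported ℚ ℚ (meshSet N N (((N : ℝ) / (N + 1)) ^ k) Set.univ) := by
  induction k with
  | zero =>
    refine Finsupp.single_mem_supported _ _ ⟨fun _ => Set.mem_univ _, fun i j => ?_⟩
    rw [pow_zero]
    exact (Metric.dist_le_diam_of_mem (bounded_stdSimplex _) (points _ i).2 (points _ j).2).trans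
      diam_stdSimplex_le
  | succ k ih =>
    rw [subdivIter, LinearMap.comp_apply, pow_succ']
    exact map_mem_of_mem_supported _
      (fun v hv => subdiv_single_mem_supported N N convex_univ hv) ih

/-! ### Small chains and the Mayer–Vietoris argument -/

section

variable {X : Type u} [TopologicalSpace X]

/-- The singular simplices with image in `A`. -/
def simplicesIn (A : Set X) (n : ℕ) : Set ((Sing X) _⦋n⦌) :=
  {σ | ∀ t, toMap σ t ∈ A}

/-- The singular chains with support in `A`. -/
def chainsIn (A : Set X) (n : ℕ) : Submodule ℚ (Chain (Sing X) n) :=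
  Finsupp.supported ℚ ℚ (simplicesIn A n)

/-- The subspace `A` has vanishing homology in degree `r`: each cycle with support in `A` is the
boundary of a chain with support in `A`. -/
def AcyclicAt (A : Set X) (r : ℕ) : Prop :=
  ∀ z ∈ chainsIn A r, boundary _ r z = 0 → ∃ e ∈ chainsIn A (r + 1), boundarySucc _ r e = z

theorem simplicesIn_mono {A B : Set X} (h : A ⊆ B) (n : ℕ) : simplicesIn A n ⊆ simplicesIn B n :=
  fun _ hσ t => h (hσ t)

theorem chainsIn_mono {A B : Set X} (h : A ⊆ B) (n : ℕ) : chainsIn A n ≤ chainsIn B n :=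
  Finsupp.supported_mono (simplicesIn_mono h n)

theorem δ_mem_simplicesIn {A : Set X} {n : ℕ} {σ : (Sing X) _⦋n + 1⦌}
    (hσ : σ ∈ simplicesIn A (n + 1)) (i : Fin (n + 2)) : (Sing X).δ i σ ∈ simplicesIn A n :=
  fun t => hσ (stdSimplex.map i.succAbove t)

theorem boundarySucc_mem_chainsIn {A : Set X} {n : ℕ} {z : Chain (Sing X) (n + 1)}
    (hz : z ∈ chainsIn A (n + 1)) : boundarySucc _ n z ∈ chainsIn A n :=
  boundary_mem_supported (fun _ hσ i => δ_mem_simplicesIn hσ i) hz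

theorem mem_chainsIn_inter {A B : Set X} {n : ℕ} {z : Chain (Sing X) n} (hA : z ∈ chainsIn A n)
    (hB : z ∈ chainsIn B n) : z ∈ chainsIn (A ∩ B) n :=
  fun _ hσ t => ⟨hA hσ t, hB hσ t⟩

theorem push_mem_simplicesIn {A : Set X} {n m : ℕ} {σ : (Sing X) _⦋n⦌}
    (hσ : σ ∈ simplicesIn A n) (w : (tuples (USimplex.{u} n)) _⦋m⦌) :
    (push σ).app (op ⦋m⦌) w ∈ simplicesIn A m :=
  fun t => hσ (affineMap (points w) t)

/-- Lebesgue's lemma for a singular simplex: its restrictions to sufficiently small linear simplices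
lie in one of the two open sets. -/
theorem exists_mesh_push_mem {U V : Set X} (hU : IsOpen U) (hV : IsOpen V) {n : ℕ}
    (σ : (Sing X) _⦋n⦌) (hσ : σ ∈ simplicesIn (U ∪ V) n) :
    ∃ ε > 0, ∀ D < ε, ∀ m, ∀ w ∈ meshSet.{u} n m D Set.univ,
      (push σ).app (op ⦋m⦌) w ∈ simplicesIn U m ∪ simplicesIn V m := by
  obtain ⟨ε, hε, h⟩ := lebesgue_number_lemma_of_metric
    (s := (Set.univ : Set (stdSimplex ℝ (Fin (n + 1)))))
    (c := fun b : Bool => toMap σ ⁻¹' (if b then U else V)) isCompact_univ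
    (fun b => by
      cases b
      · exact hV.preimage (toMap σ).continuous
      · exact hU.preimage (toMap σ).continuous)
    (fun t _ => by
      rcases hσ t with h | h
      · exact Set.mem_iUnion.2 ⟨true, h⟩
      · exact Set.mem_iUnion.2 ⟨false, h⟩)
  refine ⟨ε, hε, fun D hD m w hw => ?_⟩
  have h1 : ∀ t, affineMap (points w) t ∈ Metric.ball (points w 0) ε := by
    intro t
    have : (affineMap (points w) t).1 ∈ Metric.closedBall (points w 0).1 D := by
      rw [affineMap_coe]
      exact (convex_closedBall _ _).sum_mem (fun i _ => t.2.1 i) t.2.2 fun i _ => hw.2 i 0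
    exact lt_of_le_of_lt this hD
  obtain ⟨b, hb⟩ := h (points w 0) (Set.mem_univ _)
  cases b
  · exact Or.inr fun t => hb (h1 t)
  · exact Or.inl fun t => hb (h1 t)

/-- A cycle in the union of two open sets is homologous to a sum of chains in each of them. -/
theorem exists_small_chain {U V : Set X} (hU : IsOpen U) (hV : IsOpen V) {n : ℕ}
    {z : Chain (Sing X) (n + 1)} (hz : z ∈ chainsIn (U ∪ V) (n + 1))
    (hz' : boundarySucc _ n z = 0) :
    ∃ u ∈ chainsIn U (n + 1), ∃ v ∈ chainsIn V (n + 1), ∃ e ∈ chainsIn (U ∪ V) (n + 2),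
      boundarySucc _ (n + 1) e = z - (u + v) := by
  have h0 : ∀ σ ∈ z.support, ∀ᶠ k : ℕ in Filter.atTop,
      ∀ w ∈ meshSet.{u} (n + 1) (n + 1) ((((n + 1 : ℕ) : ℝ) / ((n + 1 : ℕ) + 1)) ^ k) Set.univ,
      (push σ).app (op ⦋n + 1⦌) w ∈ simplicesIn U (n + 1) ∪ simplicesIn V (n + 1) := by
    intro σ hσ
    obtain ⟨ε, hε, h⟩ := exists_mesh_push_mem hU hV σ (hz hσ)
    have h1 : Filter.Tendsto (fun k : ℕ => (((n + 1 : ℕ) : ℝ) / ((n + 1 : ℕ) + 1)) ^ k)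
        Filter.atTop (nhds 0) := by
      refine tendsto_pow_atTop_nhds_zero_of_lt_one (by positivity) ?_
      rw [div_lt_one (by positivity)]
      linarith
    filter_upwards [h1.eventually (gt_mem_nhds hε)] with k hk w hw using h _ hk _ w hw
  obtain ⟨k, hk⟩ := ((Filter.eventually_all_finset _).2 h0).exists
  have h1 : singularOp (subdivIter (n + 1) (n + 1) k) z ∈
      chainsIn U (n + 1) ⊔ chainsIn V (n + 1) := by
    rw [chainsIn, chainsIn, ← Finsupp.supported_union]
    refine map_mem_of_mem_supported (s := z.support) _ (fun σ hσ => ?_)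
      ((Finsupp.mem_supported _ _).2 subset_rfl)
    rw [singularOp_single]
    exact chainMap_mem_supported (push σ) (hk σ hσ) (subdivIter_mem_supported _ _)
  obtain ⟨u, hu, v, hv, huv⟩ := Submodule.mem_sup.1 h1
  refine ⟨u, hu, v, hv, singularOp (subdivIterHomotopy (n + 1) (n + 1) k) z, ?_, ?_⟩
  · refine map_mem_of_mem_supported _ (fun σ hσ => ?_) hz
    rw [singularOp_single]
    refine chainMap_mem_supported (s := Set.univ) (push σ) (fun w _ => push_mem_simplicesIn hσ w) ?_
    rw [Finsupp.supported_univ]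
    exact Submodule.mem_top
  · rw [boundary_singularOp, hz', map_zero, sub_zero, huv]

/-- The Mayer–Vietoris argument. -/
theorem AcyclicAt.union {U V : Set X} (hU : IsOpen U) (hV : IsOpen V) {r : ℕ}
    (h1 : AcyclicAt U (r + 1)) (h2 : AcyclicAt V (r + 1)) (h3 : AcyclicAt (U ∩ V) r) :
    AcyclicAt (U ∪ V) (r + 1) := by
  intro z hz hz'
  obtain ⟨u, hu, v, hv, e, he, hez⟩ := exists_small_chain hU hV hz hz'
  have huv : boundarySucc _ r u = -boundarySucc _ r v := by
    have h4 : boundarySucc _ r (boundarySucc _ (r + 1) e) = 0 := boundary_boundary _ (r + 2) e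
    rw [hez, map_sub, map_add, show boundarySucc _ r z = 0 from hz', zero_sub, neg_eq_zero] at h4
    exact eq_neg_of_add_eq_zero_left h4
  obtain ⟨w, hw, hwu⟩ := h3 (boundarySucc _ r u)
    (mem_chainsIn_inter (boundarySucc_mem_chainsIn hu)
      (by rw [huv]; exact Submodule.neg_mem _ (boundarySucc_mem_chainsIn hv)))
    (boundary_boundary _ (r + 1) u)
  obtain ⟨e₁, he₁, hd₁⟩ := h1 (u - w)
    (Submodule.sub_mem _ hu (chainsIn_mono Set.inter_subset_left _ hw))
    (by rw [map_sub]; exact sub_eq_zero.2 hwu.symm)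
  obtain ⟨e₂, he₂, hd₂⟩ := h2 (v + w)
    (Submodule.add_mem _ hv (chainsIn_mono Set.inter_subset_right _ hw))
    (by
      rw [map_add]
      change boundarySucc _ r v + boundarySucc _ r w = 0
      rw [hwu, huv, add_neg_cancel])
  refine ⟨e + (e₁ + e₂), Submodule.add_mem _ he (Submodule.add_mem _
    (chainsIn_mono Set.subset_union_left _ he₁) (chainsIn_mono Set.subset_union_right _ he₂)), ?_⟩
  rw [map_add, map_add, hez, hd₁, hd₂]
  abel

/-- The part of a chain that is supported in `A`. -/
def partIn (A : Set X) (n : ℕ) : Chain (Sing X) n →ₗ[ℚ] Chain (Sing X) n := by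
  classical
  exact Finsupp.linearCombination ℚ fun σ => if σ ∈ simplicesIn A n then Finsupp.single σ 1 else 0

theorem partIn_single_of_mem {A : Set X} {n : ℕ} {σ : (Sing X) _⦋n⦌} (h : σ ∈ simplicesIn A n) :
    partIn A n (Finsupp.single σ 1) = Finsupp.single σ 1 := by
  rw [partIn, Finsupp.linearCombination_single, one_smul, if_pos h]

theorem partIn_single_of_notMem {A : Set X} {n : ℕ} {σ : (Sing X) _⦋n⦌}
    (h : σ ∉ simplicesIn A n) : partIn A n (Finsupp.single σ 1) = 0 := by
  rw [partIn, Finsupp.linearCombination_single, one_smul, if_neg h]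

theorem partIn_mem_chainsIn (A : Set X) (n : ℕ) (z : Chain (Sing X) n) :
    partIn A n z ∈ chainsIn A n := by
  refine map_mem_of_mem_supported (s := Set.univ) (partIn A n) (fun σ _ => ?_)
    (by rw [Finsupp.supported_univ]; exact Submodule.mem_top)
  by_cases h : σ ∈ simplicesIn A n
  · rw [partIn_single_of_mem h]
    exact Finsupp.single_mem_supported _ _ h
  · rw [partIn_single_of_notMem h]
    exact Submodule.zero_mem _

section Disjoint

variable {ι : Type*} {O : ι → Set X} (hO : ∀ i, IsOpen (O i))
  (hd : Pairwise fun i j => Disjoint (O i) (O j))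

include hd in
theorem notMem_simplicesIn_of_ne {n : ℕ} {σ : (Sing X) _⦋n⦌} {i j : ι}
    (hi : σ ∈ simplicesIn (O i) n) (hij : i ≠ j) : σ ∉ simplicesIn (O j) n := fun hj =>
  Set.disjoint_left.1 (hd hij) (hi stdSimplex.barycenter) (hj stdSimplex.barycenter)

include hO hd in
/-- The standard simplex is connected, so a singular simplex lies in one of the sets `O i`. -/
theorem exists_mem_simplicesIn {n : ℕ} {σ : (Sing X) _⦋n⦌} (hσ : σ ∈ simplicesIn (⋃ i, O i) n) :
    ∃ i, σ ∈ simplicesIn (O i) n := by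
  obtain ⟨i, hi⟩ := Set.mem_iUnion.1 (hσ stdSimplex.barycenter)
  have hc : IsPreconnected (Set.range (toMap σ)) := isPreconnected_range (toMap σ).continuous
  have h1 : Set.range (toMap σ) ⊆ O i := by
    refine hc.subset_left_of_subset_union (hO i) (v := ⋃ j : {j // j ≠ i}, O j)
      (isOpen_iUnion fun j => hO j) ?_ ?_ ⟨_, Set.mem_range_self _, hi⟩
    · exact Set.disjoint_iUnion_right.2 fun j => hd j.2.symm
    · rintro _ ⟨t, rfl⟩
      obtain ⟨j, hj⟩ := Set.mem_iUnion.1 (hσ t)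
      by_cases hij : j = i
      · exact Or.inl (hij ▸ hj)
      · exact Or.inr (Set.mem_iUnion.2 ⟨⟨j, hij⟩, hj⟩)
  exact ⟨i, fun t => h1 (Set.mem_range_self t)⟩

include hO hd in
/-- Homology of a disjoint union of open sets. -/
theorem AcyclicAt.iUnion {r : ℕ} (h : ∀ i, AcyclicAt (O i) (r + 1)) :
    AcyclicAt (⋃ i, O i) (r + 1) := by
  classical
  intro z hz hz'
  have hcomm : ∀ i, boundarySucc _ r (partIn (O i) (r + 1) z) =
      partIn (O i) r (boundarySucc _ r z) := by
    intro i
    have h0 : ((boundarySucc (Sing X) r).comp (partIn (O i) (r + 1)) -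
        (partIn (O i) r).comp (boundarySucc (Sing X) r)) z ∈ (⊥ : Submodule ℚ _) := by
      refine map_mem_of_mem_supported _ (fun σ hσ => ?_) hz
      rw [Submodule.mem_bot, LinearMap.sub_apply, LinearMap.comp_apply, LinearMap.comp_apply,
        sub_eq_zero]
      have h1 : boundarySucc (Sing X) r (Finsupp.single σ 1) =
          ∑ k : Fin (r + 2), (-1 : ℚ) ^ (k : ℕ) • Finsupp.single ((Sing X).δ k σ) 1 :=
        boundary_single _ _ _
      obtain ⟨j, hj⟩ := exists_mem_simplicesIn hO hd hσ
      by_cases hij : j = i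
      · subst hij
        rw [partIn_single_of_mem hj, h1, map_sum]
        refine Finset.sum_congr rfl fun k _ => ?_
        rw [map_smul, partIn_single_of_mem (δ_mem_simplicesIn hj k)]
      · rw [partIn_single_of_notMem (notMem_simplicesIn_of_ne hd hj hij), h1, map_sum, map_zero]
        refine (Finset.sum_eq_zero fun k _ => ?_).symm
        rw [map_smul, partIn_single_of_notMem
          (notMem_simplicesIn_of_ne hd (δ_mem_simplicesIn hj k) hij), smul_zero]
    exact sub_eq_zero.1 h0
  choose e he hez using fun i => h i (partIn (O i) (r + 1) z) (partIn_mem_chainsIn _ _ _)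
    ((hcomm i).trans (by rw [show boundarySucc _ r z = 0 from hz', map_zero]))
  choose idx hidx using fun σ : z.support => exists_mem_simplicesIn hO hd (hz σ.2)
  let I : Finset ι := Finset.univ.image idx
  refine ⟨∑ i ∈ I, e i, Submodule.sum_mem _ fun i _ =>
    chainsIn_mono (Set.subset_iUnion O i) _ (he i), ?_⟩
  rw [map_sum, Finset.sum_congr rfl fun i _ => hez i]
  let F : Chain (Sing X) (r + 1) →ₗ[ℚ] Chain (Sing X) (r + 1) :=
    (∑ i ∈ I, partIn (O i) (r + 1)) - LinearMap.id
  have hF : ∀ z, F z = ∑ i ∈ I, partIn (O i) (r + 1) z - z := fun z => by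
    simp only [F, LinearMap.sub_apply, LinearMap.sum_apply, LinearMap.id_apply]
  have h0 : F z ∈ (⊥ : Submodule ℚ _) := by
    refine map_mem_of_mem_supported (s := z.support) _ (fun σ hσ => ?_)
      ((Finsupp.mem_supported _ _).2 subset_rfl)
    rw [Submodule.mem_bot, hF, sub_eq_zero, Finset.sum_eq_single (idx ⟨σ, hσ⟩)]
    · exact partIn_single_of_mem (hidx ⟨σ, hσ⟩)
    · exact fun i _ hi => partIn_single_of_notMem
        (notMem_simplicesIn_of_ne hd (hidx ⟨σ, hσ⟩) hi.symm)
    · exact fun hi => absurd (Finset.mem_image_of_mem idx (Finset.mem_univ _)) hi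
  rw [Submodule.mem_bot, hF, sub_eq_zero] at h0
  exact h0

end Disjoint

/-! ### Embeddings and homotopies -/

variable {Y : Type u} [TopologicalSpace Y]

/-- The simplicial map induced by a continuous map. -/
abbrev singMap (f : C(X, Y)) : Sing X ⟶ Sing Y := TopCat.toSSet.map (TopCat.ofHom f)

theorem singMap_injective {f : C(X, Y)} (hf : Function.Injective f) (n : ℕ) :
    Function.Injective ((singMap f).app (op ⦋n⦌)) := by
  intro σ τ h
  apply toMap_injective
  ext t
  have h1 : f.comp (toMap σ) = f.comp (toMap τ) := congr_arg toMap h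
  exact hf (DFunLike.congr_fun h1 t)

theorem chainMap_mem_chainsIn (f : C(X, Y)) {A : Set X} {n : ℕ} {z : Chain (Sing X) n}
    (hz : z ∈ chainsIn A n) : chainMap (singMap f) n z ∈ chainsIn (f '' A) n :=
  chainMap_mem_supported (s := simplicesIn A n) (t := simplicesIn (f '' A) n)
    (singMap f)
    (fun _ hσ t => Set.mem_image_of_mem f (hσ t)) hz

theorem exists_chain_of_isEmbedding {f : C(X, Y)} (hf : Topology.IsEmbedding f) {A : Set X}
    {n : ℕ} {z : Chain (Sing Y) n} (hz : z ∈ chainsIn (f '' A) n) :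
    ∃ w ∈ chainsIn A n, chainMap (singMap f) n w = z := by
  obtain ⟨w, hw⟩ := exists_chainMap_eq (singMap f) n z fun σ hσ => by
    choose g hgA hg using hz hσ
    refine ⟨ofMap ⟨g, hf.isInducing.continuous_iff.2 ?_⟩, ?_⟩
    · rw [show f ∘ g = toMap σ from funext hg]
      exact (toMap σ).continuous
    · apply toMap_injective
      ext t
      exact hg t
  refine ⟨w, fun σ hσ t => ?_, hw⟩
  have h1 : (singMap f).app (op ⦋n⦌) σ ∈ z.support := by
    classical
    rw [← hw]
    change _ ∈ (Finsupp.mapDomain _ w).support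
    rw [Finsupp.mapDomain_support_of_injective (singMap_injective hf.injective n)]
    exact Finset.mem_image_of_mem _ hσ
  obtain ⟨x, hx, hxt⟩ := hz h1 t
  have hxt' : x = toMap σ t := hf.injective hxt
  rw [← hxt']
  exact hx

theorem AcyclicAt.image {f : C(X, Y)} (hf : Topology.IsEmbedding f) {A : Set X} {r : ℕ}
    (h : AcyclicAt A r) : AcyclicAt (f '' A) r := by
  intro z hz hz'
  obtain ⟨w, hw, rfl⟩ := exists_chain_of_isEmbedding hf hz
  obtain ⟨e, he, hew⟩ := h w hw
    (boundary_eq_zero_of_injective _ (singMap_injective hf.injective) hz')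
  exact ⟨chainMap (singMap f) (r + 1) e, chainMap_mem_chainsIn f he,
    (boundary_chainMap _ _ _).trans (congr_arg _ hew)⟩

theorem AcyclicAt.of_image {f : C(X, Y)} (hf : Topology.IsEmbedding f) {A : Set X} {r : ℕ}
    (h : AcyclicAt (f '' A) r) : AcyclicAt A r := by
  intro z hz hz'
  obtain ⟨e, he, hez⟩ := h _ (chainMap_mem_chainsIn f hz)
    (by rw [boundary_chainMap, hz', map_zero])
  obtain ⟨w, hw, rfl⟩ := exists_chain_of_isEmbedding hf he
  refine ⟨w, hw, chainMap_injective _ _ (singMap_injective hf.injective r) ?_⟩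
  exact (boundary_chainMap (singMap f) (r + 1) w).symm.trans hez

/-- Homotopic continuous maps send a cycle to homologous cycles. -/
theorem exists_boundary_of_homotopic {f g : C(X, Y)} (h : f.Homotopic g) (n : ℕ)
    (z : Chain (Sing X) n) (hz : boundary _ n z = 0) :
    ∃ e : Chain (Sing Y) (n + 1), boundary _ (n + 1) e =
      chainMap (singMap f) n z - chainMap (singMap g) n z := by
  obtain ⟨H⟩ := h
  have H' : TopCat.Homotopy (TopCat.ofHom f) (TopCat.ofHom g) := H
  exact exists_boundary_of_simplicialHomotopy H'.toSSet n z hz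

end

/-! ### Homology of open subsets of Euclidean space -/

section

variable {X Y : Type u} [TopologicalSpace X] [TopologicalSpace Y]

theorem mem_chainsIn_univ {n : ℕ} (z : Chain (Sing X) n) : z ∈ chainsIn (Set.univ : Set X) n :=
  fun _ _ _ => Set.mem_univ _

/-- All singular simplices of a totally disconnected space are constant, hence degenerate in positive
degrees. -/
theorem acyclicAt_of_totallyDisconnected [TotallyDisconnectedSpace X] (r : ℕ) :
    AcyclicAt (Set.univ : Set X) (r + 1) := by
  intro z _ hz
  obtain ⟨e, he⟩ := exists_boundary_of_degenerate (r + 1) z hz fun σ _ => by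
    refine ⟨0, Nat.succ_pos r, SimplexCategory.const ⦋r + 1⦌ ⦋0⦌ 0,
      ofMap (ContinuousMap.const _ (toMap σ stdSimplex.barycenter)), ?_⟩
    apply toMap_injective
    ext t
    exact (isPreconnected_range (toMap σ).continuous).subsingleton (Set.mem_range_self _)
      (Set.mem_range_self _)
  exact ⟨e, mem_chainsIn_univ e, he⟩

theorem acyclicAt_empty (r : ℕ) : AcyclicAt (∅ : Set X) r := by
  intro z hz _
  refine ⟨0, Submodule.zero_mem _, ?_⟩
  rw [map_zero]
  refine (Finsupp.support_eq_empty.1 (Finset.eq_empty_of_forall_notMem fun σ hσ => ?_)).symm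
  exact hz hσ stdSimplex.barycenter

theorem AcyclicAt.prod_contractible {C : Type} [TopologicalSpace C] [ContractibleSpace C] {r : ℕ}
    (h : AcyclicAt (Set.univ : Set X) r) : AcyclicAt (Set.univ : Set (C × X)) r := by
  obtain ⟨c₀, hc⟩ := id_nullhomotopic C
  let p : C(C × X, X) := ⟨Prod.snd, continuous_snd⟩
  let s : C(X, C × X) := ⟨fun x => (c₀, x), by fun_prop⟩
  have hps : (ContinuousMap.id (C × X)).Homotopic (s.comp p) :=
    hc.prodMap (ContinuousMap.Homotopic.refl (ContinuousMap.id X))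
  intro z _ hz
  obtain ⟨e, he⟩ := exists_boundary_of_homotopic hps r z hz
  obtain ⟨e', -, he'⟩ := h (chainMap (singMap p) r z) (mem_chainsIn_univ _)
    (by rw [boundary_chainMap, hz, map_zero])
  refine ⟨e + chainMap (singMap s) (r + 1) e', mem_chainsIn_univ _, ?_⟩
  have h1 : boundarySucc _ r (chainMap (singMap s) (r + 1) e') =
      chainMap (singMap s) r (chainMap (singMap p) r z) :=
    (boundary_chainMap _ _ _).trans (congr_arg _ he')
  have h2 : boundarySucc _ r e = z - chainMap (singMap s) r (chainMap (singMap p) r z) := by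
    refine he.trans (congr_arg₂ (· - ·) (chainMap_id _ r z) ?_)
    exact chainMap_comp (singMap p) (singMap s) r z
  rw [map_add, h1, h2, sub_add_cancel]

theorem AcyclicAt.univ_coe {A : Set X} {r : ℕ} (h : AcyclicAt A r) :
    AcyclicAt (Set.univ : Set A) r := by
  refine AcyclicAt.of_image (f := ⟨Subtype.val, continuous_subtype_val⟩)
    Topology.IsEmbedding.subtypeVal ?_
  rw [ContinuousMap.coe_mk, Set.image_univ, Subtype.range_coe]
  exact h

theorem AcyclicAt.prod_convex {J : Set ℝ} (hJ : Convex ℝ J) (hJ' : J.Nonempty) {V : Set X} {r : ℕ}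
    (h : AcyclicAt V r) : AcyclicAt (J ×ˢ V) r := by
  have : ContractibleSpace J := hJ.contractibleSpace hJ'
  have h1 := (h.univ_coe.prod_contractible (C := J)).image
    (f := ⟨Prod.map Subtype.val Subtype.val, by fun_prop⟩)
    (Topology.IsEmbedding.subtypeVal.prodMap Topology.IsEmbedding.subtypeVal)
  rwa [ContinuousMap.coe_mk, Set.image_univ, Set.range_prodMap, Subtype.range_coe,
    Subtype.range_coe] at h1

/-- Open subsets of the line have no homology in positive degrees. -/
theorem acyclicAt_real (W : Set (ℝ × PUnit.{u + 1})) (hW : IsOpen W) (r : ℕ) :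
    AcyclicAt W (r + 1) := by
  let W' : Set ℝ := (fun t => (t, PUnit.unit)) ⁻¹' W
  have hW' : IsOpen W' := hW.preimage (by fun_prop)
  let ι := {C : Set ℝ // ∃ x ∈ W', C = connectedComponentIn W' x}
  have h1 : W = ⋃ C : ι, (C : Set ℝ) ×ˢ (Set.univ : Set PUnit.{u + 1}) := by
    ext ⟨t, y⟩
    simp only [Set.mem_iUnion, Set.mem_prod, Set.mem_univ, and_true]
    constructor
    · intro h
      exact ⟨⟨_, t, h, rfl⟩, mem_connectedComponentIn h⟩
    · rintro ⟨⟨_, x, hx, rfl⟩, ht⟩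
      exact connectedComponentIn_subset W' x ht
  rw [h1]
  refine AcyclicAt.iUnion ?_ ?_ ?_
  · rintro ⟨_, x, hx, rfl⟩
    exact hW'.connectedComponentIn.prod isOpen_univ
  · rintro ⟨_, x, hx, rfl⟩ ⟨_, y, hy, rfl⟩ hne
    refine Set.disjoint_left.2 ?_
    intro p h2 h3
    exact hne (Subtype.ext
      ((connectedComponentIn_eq h2.1).trans (connectedComponentIn_eq h3.1).symm))
  · rintro ⟨_, x, hx, rfl⟩
    exact AcyclicAt.prod_convex isPreconnected_connectedComponentIn.ordConnected.convex
      ⟨x, mem_connectedComponentIn hx⟩ (acyclicAt_of_totallyDisconnected r)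

theorem lt_of_mem_Ioo_mul {η t : ℝ} (hη : 0 < η) {i j : ℤ} (h1 : i * η < t) (h2 : t < j * η) :
    i < j := by
  exact_mod_cast lt_of_mul_lt_mul_right (h1.trans h2) hη.le

end

/-- If all open subsets of `Y` are acyclic in degrees `≥ s`, then all open subsets of `ℝ × Y` are
acyclic in degrees `≥ s + 1`. A cycle has compact support, which is covered by boxes `J i ×ˢ V i`
over the overlapping intervals `J i = (i η, (i + 2) η)`. The boxes with even `i` are disjoint, as
are those with odd `i` and the intersections of consecutive boxes. -/
theorem acyclicAt_real_prod {Y : Type u} [MetricSpace Y] {s : ℕ} (hs : 1 ≤ s)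
    (hY : ∀ V : Set Y, IsOpen V → ∀ r, s ≤ r → AcyclicAt V r) (W : Set (ℝ × Y)) (hW : IsOpen W)
    (r : ℕ) (hr : s + 1 ≤ r) : AcyclicAt W r := by
  obtain ⟨r, rfl⟩ : ∃ r', r = r' + 1 + 1 := ⟨r - 2, by omega⟩
  intro z hz hz'
  -- `K` is the support of the cycle.
  let K : Set (ℝ × Y) := ⋃ σ ∈ z.support, Set.range (toMap σ)
  have hK : IsCompact K :=
    z.support.isCompact_biUnion fun σ _ => isCompact_range (toMap σ).continuous
  have hKW : K ⊆ W := Set.iUnion₂_subset fun σ hσ => by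
    rintro _ ⟨t, rfl⟩
    exact hz hσ t
  obtain ⟨δ, hδ, hδW⟩ := hK.exists_thickening_subset_open hW hKW
  -- The intervals `J i` have length `2 η = δ`, so that a box over `J i` around a point of `K` with
  -- first coordinate in `J i` stays in the `δ`-neighbourhood of `K`.
  let η : ℝ := δ / 2
  have hη : 0 < η := half_pos hδ
  have hη2 : η * 2 = δ := div_mul_cancel₀ _ two_ne_zero
  let J : ℤ → Set ℝ := fun i => Set.Ioo (i * η) ((i + 2 : ℤ) * η)
  let V : ℤ → Set Y := fun i => interior {y | ∀ t ∈ J i, (t, y) ∈ W}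
  let O : ℤ → Set (ℝ × Y) := fun i => J i ×ˢ V i
  have hO : ∀ i, IsOpen (O i) := fun i => isOpen_Ioo.prod isOpen_interior
  have hOW : ∀ i, O i ⊆ W := fun i p hp => interior_subset hp.2 p.1 hp.1
  have hKO : ∀ p ∈ K, ∃ i, p ∈ O i := by
    rintro ⟨t, y⟩ hp
    have h1 : ((⌈t / η⌉ - 1 : ℤ) : ℝ) * η < t := by
      rw [← lt_div_iff₀ hη]
      push_cast
      linarith [Int.ceil_lt_add_one (t / η)]
    have h2 : t ≤ ((⌈t / η⌉ - 1 : ℤ) : ℝ) * η + η := by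
      have := (div_le_iff₀ hη).1 (Int.le_ceil (t / η))
      push_cast
      linarith
    refine ⟨⌈t / η⌉ - 1, ⟨h1, ?_⟩, ?_⟩
    · push_cast at h2 ⊢
      linarith
    · refine mem_interior.2 ⟨Metric.ball y δ, fun y' hy' t' ht' => hδW ?_, Metric.isOpen_ball,
        Metric.mem_ball_self hδ⟩
      refine Metric.mem_thickening_iff.2 ⟨(t, y), hp, ?_⟩
      rw [Prod.dist_eq]
      refine max_lt ?_ hy'
      rw [Real.dist_eq, abs_lt]
      obtain ⟨h3, h4⟩ := ht'
      change ((⌈t / η⌉ - 1 : ℤ) : ℝ) * η < t' at h3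
      change t' < ((⌈t / η⌉ - 1 + 2 : ℤ) : ℝ) * η at h4
      push_cast at h1 h2 h3 h4
      constructor <;> linarith
  have hconv : ∀ i, AcyclicAt (O i) (r + 1 + 1) := fun i =>
    AcyclicAt.prod_convex (convex_Ioo _ _) (Set.nonempty_Ioo.2 (by push_cast; linarith))
      (hY _ isOpen_interior _ (by omega))
  let A := ⋃ j : ℤ, O (2 * j)
  let B := ⋃ j : ℤ, O (2 * j + 1)
  have hA : AcyclicAt A (r + 1 + 1) := by
    refine AcyclicAt.iUnion (fun j => hO _) (fun j k hjk => Set.disjoint_left.2 ?_)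
      fun j => hconv _
    rintro p ⟨h1, -⟩ ⟨h2, -⟩
    have h3 := lt_of_mem_Ioo_mul hη h1.1 h2.2
    have h4 := lt_of_mem_Ioo_mul hη h2.1 h1.2
    omega
  have hB : AcyclicAt B (r + 1 + 1) := by
    refine AcyclicAt.iUnion (fun j => hO _) (fun j k hjk => Set.disjoint_left.2 ?_)
      fun j => hconv _
    rintro p ⟨h1, -⟩ ⟨h2, -⟩
    have h3 := lt_of_mem_Ioo_mul hη h1.1 h2.2
    have h4 := lt_of_mem_Ioo_mul hη h2.1 h1.2
    omega
  let Jc : ℤ → Set ℝ := fun i => Set.Ioo ((i + 1 : ℤ) * η) ((i + 2 : ℤ) * η)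
  have hAB : A ∩ B = ⋃ i : ℤ, Jc i ×ˢ (V i ∩ V (i + 1)) := by
    ext p
    constructor
    · rintro ⟨h1, h2⟩
      obtain ⟨j, h3, h4⟩ := Set.mem_iUnion.1 h1
      obtain ⟨k, h5, h6⟩ := Set.mem_iUnion.1 h2
      have h7 := lt_of_mem_Ioo_mul hη h3.1 h5.2
      have h8 := lt_of_mem_Ioo_mul hη h5.1 h3.2
      obtain rfl | rfl : j = k ∨ j = k + 1 := by omega
      · exact Set.mem_iUnion.2 ⟨2 * j, ⟨h5.1, h3.2⟩, h4, h6⟩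
      · have h9 : 2 * (k + 1) = 2 * k + 1 + 1 := by ring
        rw [h9] at h3 h4
        exact Set.mem_iUnion.2 ⟨2 * k + 1, ⟨h3.1, h5.2⟩, h6, h4⟩
    · intro h
      obtain ⟨i, h1, h2, h3⟩ := Set.mem_iUnion.1 h
      have h4 : p ∈ O i := by
        refine ⟨⟨lt_trans ?_ h1.1, h1.2⟩, h2⟩
        push_cast
        linarith
      have h5 : p ∈ O (i + 1) := by
        refine ⟨⟨h1.1, h1.2.trans ?_⟩, h3⟩
        push_cast
        linarith
      obtain ⟨j, rfl | rfl⟩ := Int.even_or_odd' i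
      · exact ⟨Set.mem_iUnion.2 ⟨j, h4⟩, Set.mem_iUnion.2 ⟨j, h5⟩⟩
      · refine ⟨Set.mem_iUnion.2 ⟨j + 1, ?_⟩, Set.mem_iUnion.2 ⟨j, h4⟩⟩
        rw [show 2 * (j + 1) = 2 * j + 1 + 1 by ring]
        exact h5
  have hAB' : AcyclicAt (A ∩ B) (r + 1) := by
    rw [hAB]
    refine AcyclicAt.iUnion (fun i => isOpen_Ioo.prod (isOpen_interior.inter isOpen_interior))
      (fun j k hjk => Set.disjoint_left.2 ?_) fun i => AcyclicAt.prod_convex (convex_Ioo _ _)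
        (Set.nonempty_Ioo.2 (by push_cast; linarith))
        (hY _ (isOpen_interior.inter isOpen_interior) _ (by omega))
    rintro p ⟨h1, -⟩ ⟨h2, -⟩
    have h3 := lt_of_mem_Ioo_mul hη h1.1 h2.2
    have h4 := lt_of_mem_Ioo_mul hη h2.1 h1.2
    omega
  obtain ⟨e, he, hez⟩ := AcyclicAt.union (isOpen_iUnion fun j => hO _)
    (isOpen_iUnion fun j => hO _) hA hB hAB' z (fun σ hσ t => by
      obtain ⟨i, hi⟩ := hKO (toMap σ t) (Set.mem_biUnion hσ (Set.mem_range_self t))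
      obtain ⟨j, rfl | rfl⟩ := Int.even_or_odd' i
      · exact Or.inl (Set.mem_iUnion.2 ⟨j, hi⟩)
      · exact Or.inr (Set.mem_iUnion.2 ⟨j, hi⟩)) hz'
  refine ⟨e, chainsIn_mono ?_ _ he, hez⟩
  exact Set.union_subset (Set.iUnion_subset fun j => hOW _) (Set.iUnion_subset fun j => hOW _)

/-- In every positive dimension `c + 1` there is a Euclidean space, in any universe, whose open
subsets have no homology in degrees `≥ c + 1`. -/
theorem exists_euclidean_acyclic (c : ℕ) :
    ∃ (Y : Type u) (_ : NormedAddCommGroup Y) (_ : NormedSpace ℝ Y) (_ : FiniteDimensional ℝ Y),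
      Module.finrank ℝ Y = c + 1 ∧
        ∀ V : Set Y, IsOpen V → ∀ r, c + 1 ≤ r → AcyclicAt V r := by
  induction c with
  | zero =>
    refine ⟨ℝ × PUnit.{u + 1}, inferInstance, inferInstance, inferInstance, ?_, ?_⟩
    · rw [Module.finrank_prod, Module.finrank_self, Module.finrank_zero_of_subsingleton]
    · intro V hV r hr
      obtain ⟨r, rfl⟩ : ∃ r', r = r' + 1 := ⟨r - 1, by omega⟩
      exact acyclicAt_real V hV r
  | succ c ih =>
    obtain ⟨Y, _, _, _, h1, h2⟩ := ih
    refine ⟨ℝ × Y, inferInstance, inferInstance, inferInstance, ?_, ?_⟩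
    · rw [Module.finrank_prod, Module.finrank_self, h1, add_comm]
    · exact acyclicAt_real_prod (by omega) h2

/-! ### Homology of manifolds above the dimension -/

section Manifold

variable {L : Type u} [TopologicalSpace L] {c : ℕ}

theorem acyclicAt_of_subset_source (e : OpenPartialHomeomorph L (EuclideanSpace ℝ (Fin (c + 1))))
    {W : Set L} (hW : IsOpen W) (hWe : W ⊆ e.source) (r : ℕ) (hr : c + 1 ≤ r) :
    AcyclicAt W r := by
  obtain ⟨Y, _, _, _, h1, h2⟩ := exists_euclidean_acyclic.{u} c
  let φ : EuclideanSpace ℝ (Fin (c + 1)) ≃L[ℝ] Y :=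
    ContinuousLinearEquiv.ofFinrankEq (by rw [finrank_euclideanSpace_fin, h1])
  have hf := φ.toHomeomorph.isOpenEmbedding.comp e.isOpenEmbedding_restrict
  let f : C(e.source, Y) := ⟨_, hf.continuous⟩
  have h3 : AcyclicAt (f '' (Subtype.val ⁻¹' W)) r :=
    h2 _ (hf.isOpenMap _ (hW.preimage continuous_subtype_val)) r hr
  have h4 := (h3.of_image hf.isEmbedding).image
    (f := (⟨Subtype.val, continuous_subtype_val⟩ : C(e.source, L)))
    Topology.IsEmbedding.subtypeVal
  rwa [ContinuousMap.coe_mk, Set.image_preimage_eq_of_subset (by rwa [Subtype.range_coe])] at h4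

/-- Open subsets of a finite union of chart domains have no homology above the dimension, by
induction on the number of charts: the intersection of a new chart domain with the previous ones
is an open subset of Euclidean space. -/
theorem acyclicAt_of_subset_biUnion_source [ChartedSpace (EuclideanSpace ℝ (Fin (c + 1))) L]
    (t : Finset L) (W : Set L) (hW : IsOpen W)
    (hWt : W ⊆ ⋃ x ∈ t, (chartAt (EuclideanSpace ℝ (Fin (c + 1))) x).source) (r : ℕ)
    (hr : c + 1 ≤ r) : AcyclicAt W (r + 1) := by
  classical
  induction t using Finset.induction_on generalizing W with
  | empty =>
    rw [show W = ∅ by simpa using hWt]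
    exact acyclicAt_empty _
  | insert x t _ ih =>
    rw [Finset.set_biUnion_insert] at hWt
    have ho : ∀ y : L, IsOpen (chartAt (EuclideanSpace ℝ (Fin (c + 1))) y).source :=
      fun y => (chartAt _ y).open_source
    have h1 : W = (W ∩ (chartAt (EuclideanSpace ℝ (Fin (c + 1))) x).source) ∪
        (W ∩ ⋃ y ∈ t, (chartAt (EuclideanSpace ℝ (Fin (c + 1))) y).source) := by
      rw [← Set.inter_union_distrib_left, Set.inter_eq_left.2 hWt]
    have h2 : IsOpen (W ∩ (chartAt (EuclideanSpace ℝ (Fin (c + 1))) x).source) := hW.inter (ho x)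
    have h3 : IsOpen (W ∩ ⋃ y ∈ t, (chartAt (EuclideanSpace ℝ (Fin (c + 1))) y).source) :=
      hW.inter (isOpen_biUnion fun y _ => ho y)
    rw [h1]
    exact AcyclicAt.union h2 h3
      (acyclicAt_of_subset_source _ h2 Set.inter_subset_right _ (by omega))
      (ih _ h3 Set.inter_subset_right)
      (acyclicAt_of_subset_source _ (h2.inter h3)
        (Set.inter_subset_left.trans Set.inter_subset_right) _ hr)

/-- A compact manifold has no homology above its dimension. -/
theorem exists_boundary_of_compact_manifold (c : ℕ) [CompactSpace L]
    [ChartedSpace (EuclideanSpace ℝ (Fin c)) L] (r : ℕ) (hr : c < r) (z : Chain (Sing L) r)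
    (hz : boundary _ r z = 0) : ∃ e : Chain (Sing L) (r + 1), boundary _ (r + 1) e = z := by
  obtain ⟨r, rfl⟩ : ∃ r', r = r' + 1 := ⟨r - 1, by omega⟩
  have h : AcyclicAt (Set.univ : Set L) (r + 1) := by
    cases c with
    | zero =>
      have : DiscreteTopology L :=
        ChartedSpace.discreteTopology (EuclideanSpace ℝ (Fin 0)) L
      exact acyclicAt_of_totallyDisconnected r
    | succ c =>
      obtain ⟨t, ht⟩ := CompactSpace.elim_nhds_subcover
        (fun x : L => (chartAt (EuclideanSpace ℝ (Fin (c + 1))) x).source)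
        fun x => (chartAt _ x).open_source.mem_nhds (mem_chart_source _ x)
      exact acyclicAt_of_subset_biUnion_source t _ isOpen_univ (by rw [ht]; rfl) r (by omega)
  obtain ⟨e, -, he⟩ := h z (mem_chainsIn_univ z) hz
  exact ⟨e, he⟩

end Manifold

section Bundle

open MonoidalCategory CartesianMonoidalCategory

/-! ### Globally trivial bundles -/

theorem HomotopyPushout.inl_comp_homotopic {X Y₁ Y₂ : Type u} [TopologicalSpace X]
    [TopologicalSpace Y₁] [TopologicalSpace Y₂] (f₁ : C(X, Y₁)) (f₂ : C(X, Y₂)) :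
    ((HomotopyPushout.inl f₁ f₂).comp f₁).Homotopic ((HomotopyPushout.inr f₁ f₂).comp f₂) :=
  ⟨{ toFun := fun p => Quot.mk _ (Sum.inl (p.2, p.1))
     continuous_toFun := continuous_quot_mk.comp (continuous_inl.comp continuous_swap)
     map_zero_left := fun x => Quot.sound (GlueRel.left x)
     map_one_left := fun x => Quot.sound (GlueRel.right x) }⟩

section Trivialization

variable {G B : Type u} [Group G] [TopologicalSpace G] [TopologicalSpace B]
  (ξ : PrincipalBundle G B) (e : Bundle.Trivialization G ξ.proj) (he : e.baseSet = Set.univ)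

include he in
theorem continuous_trivialization_symm : Continuous e.toOpenPartialHomeomorph.symm := by
  have h := e.toOpenPartialHomeomorph.continuousOn_symm
  rwa [e.target_eq, he, Set.univ_prod_univ, continuousOn_univ] at h

include he in
theorem continuous_trivialization : Continuous e := by
  have h : ContinuousOn e e.source := e.toOpenPartialHomeomorph.continuousOn
  rwa [e.source_eq, he, Set.preimage_univ, continuousOn_univ] at h

/-- The identification `B × X → P ×_G X` given by a global trivialization of `P`. -/
def assocOfProd (X : Type u) [TopologicalSpace X] [MulAction G X] : C(B × X, ξ.Assoc X) where
  toFun a := Quot.mk _ (e.toOpenPartialHomeomorph.symm (a.1, 1), a.2)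
  continuous_toFun := continuous_quot_mk.comp
    (((continuous_trivialization_symm ξ e he).comp (by fun_prop)).prodMk continuous_snd)

/-- The inverse `P ×_G X → B × X`, `[p, x] ↦ (proj p, g x)`, where `g` is the coordinate of `p`. -/
def prodOfAssoc (he' : IsPrincipalTrivialization e) (X : Type u) [TopologicalSpace X]
    [MulAction G X] [ContinuousSMul G X] : C(ξ.Assoc X, B × X) where
  toFun := Quot.lift (fun a => (ξ.proj a.1, (e a.1).2 • a.2)) (by
    rintro ⟨p, x⟩ ⟨p', x'⟩ ⟨g, h, h'⟩
    have hp' : p' ∈ e.source := by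
      rw [e.mem_source, he]
      exact Set.mem_univ _
    simp only at h h'
    simp only [h, h', ξ.proj_smul, he' p' hp', mul_smul])
  continuous_toFun := continuous_quot_lift _ ((ξ.proj.continuous.comp continuous_fst).prodMk
    ((continuous_snd.comp ((continuous_trivialization ξ e he).comp continuous_fst)).smul
      continuous_snd))

theorem assocOfProd_prodOfAssoc (he' : IsPrincipalTrivialization e) (X : Type u)
    [TopologicalSpace X] [MulAction G X] [ContinuousSMul G X] (a : ξ.Assoc X) :
    assocOfProd ξ e he X (prodOfAssoc ξ e he he' X a) = a := by
  obtain ⟨p, x⟩ := a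
  have hs : ∀ p, p ∈ e.source := fun p => by
    rw [e.mem_source, he]
    exact Set.mem_univ _
  have ht : ((ξ.proj p, 1) : B × G) ∈ e.target := by
    rw [e.mem_target, he]
    exact Set.mem_univ _
  refine (Quot.sound ⟨(e p).2, ?_, rfl⟩).symm
  refine e.toOpenPartialHomeomorph.injOn (hs _) (hs _) ?_
  change e p = e (MulOpposite.op (e p).2 • e.toOpenPartialHomeomorph.symm (ξ.proj p, 1))
  have h1 : e (e.toOpenPartialHomeomorph.symm (ξ.proj p, 1)) = (ξ.proj p, 1) :=
    e.apply_symm_apply ht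
  refine Prod.ext ?_ ?_
  · rw [e.coe_fst (hs _), e.coe_fst (hs _), ξ.proj_smul]
    exact (congr_arg Prod.fst h1).symm.trans (e.coe_fst (hs _))
  · rw [he' _ (hs _), h1, one_mul]

end Trivialization

/-! ### Singular simplices of a product -/

section

variable (B X : Type u) [TopologicalSpace B] [TopologicalSpace X]

/-- Pairs of singular simplices as singular simplices of the product. -/
def prodSing : Sing B ⊗ Sing X ⟶ Sing (B × X) where
  app m := ↾fun a => (TopCat.toSSetObjEquiv (TopCat.of (B × X)) m).symm
    ((TopCat.toSSetObjEquiv (TopCat.of B) m a.1).prodMk (TopCat.toSSetObjEquiv (TopCat.of X) m a.2))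
  naturality _ _ _ := rfl

/-- The components of a singular simplex of the product. -/
def singProd : Sing (B × X) ⟶ Sing B ⊗ Sing X :=
  lift (singMap ⟨Prod.fst, continuous_fst⟩) (singMap ⟨Prod.snd, continuous_snd⟩)

end

/-- A cocycle representing a reduced class vanishes on the cycles in the image of a map that is
homotopic to the constant map at the base point. -/
theorem pairing_eq_zero_of_homotopic_const {X Q : Type u} [TopologicalSpace X] [TopologicalSpace Q]
    {x₀ : Q} {n : ℕ} {φ : cocycles (Sing Q) n} (hφ : classOf (Sing Q) n φ ∈ reducedH x₀ n)
    {f : C(X, Q)} (hf : f.Homotopic (ContinuousMap.const X x₀)) (z : Chain (Sing X) n)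
    (hz : boundary _ n z = 0) : pairing φ.1 (chainMap (singMap f) n z) = 0 := by
  have h0 : classOf (Sing PUnit.{u + 1}) n
      ⟨cochainMap (singMap (ContinuousMap.const PUnit.{u + 1} x₀)) n φ.1,
        cochainMap_mem_cocycles _ n _ φ.2⟩ = 0 := LinearMap.mem_ker.1 hφ
  have h1 : cochainMap (singMap (ContinuousMap.const PUnit.{u + 1} x₀)) n φ.1 ∈
      coboundaries (Sing PUnit.{u + 1}) n :=
    (Submodule.Quotient.mk_eq_zero
      ((coboundaries (Sing PUnit.{u + 1}) n).submoduleOf (cocycles _ n))).1 h0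
  obtain ⟨e, he⟩ := exists_boundary_of_homotopic hf n z hz
  have h2 := pairing_boundary_eq_zero φ.2 e
  have h3 : chainMap (singMap (ContinuousMap.const X x₀)) n z =
      chainMap (singMap (ContinuousMap.const PUnit.{u + 1} x₀)) n
        (chainMap (singMap (ContinuousMap.const X PUnit.unit)) n z) :=
    chainMap_comp (singMap (ContinuousMap.const X PUnit.unit))
      (singMap (ContinuousMap.const PUnit.{u + 1} x₀)) n z
  rw [he, map_sub, sub_eq_zero, h3] at h2
  rw [h2, ← pairing_cochainMap]
  exact pairing_eq_zero_of_mem_coboundaries h1 (by rw [boundary_chainMap, hz, map_zero])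

section

variable {G L B E : Type u} [Group G] [TopologicalSpace G] [TopologicalSpace B]
  [TopologicalSpace L] [MulAction G L] [TopologicalSpace E] {π : C(E, B)}
  (β : BundleStructure G L π) {k : ℤ} (M : MooreApproximation G L k)

/-- The composition `ft_{<k} E → E → Q_{≥k} E` is nullhomotopic. -/
theorem toQ_comp_truncMap_homotopic :
    ((β.toQ M).comp (β.truncMap M)).Homotopic (ContinuousMap.const _ (β.conePoint M)) := by
  have h1 : ((β.toQ M).comp (β.truncMap M)).Homotopic
      ((HomotopyPushout.inr (ContinuousMap.const B (PUnit.unit : PUnit.{u + 1}))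
        (β.section_ M)).comp ((β.section_ M).comp (β.truncProj M))) :=
    (ContinuousMap.Homotopic.refl (HomotopyPushout.inr
      (ContinuousMap.const B (PUnit.unit : PUnit.{u + 1})) (β.section_ M))).comp
      (HomotopyPushout.inl_comp_homotopic (β.truncProj M) (β.truncMap M)).symm
  exact h1.trans ((HomotopyPushout.inl_comp_homotopic
    (ContinuousMap.const B (PUnit.unit : PUnit.{u + 1})) (β.section_ M)).symm.comp
      (ContinuousMap.Homotopic.refl (β.truncProj M)))

variable (e : Bundle.Trivialization G β.principal.proj) (he : e.baseSet = Set.univ)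

/-- The trivialization `B × L → E`, on the level of singular simplices. -/
def trivSing : Sing B ⊗ Sing L ⟶ Sing E :=
  prodSing B L ≫
    singMap ((ContinuousMap.mk β.homeo β.homeo.continuous).comp (assocOfProd β.principal e he L))

/-- The pullback of a reduced class of `Q_{≥k} E` vanishes on the cycles coming from
`B × L_{<k}`. -/
theorem pairing_trivSing_eq_zero {n : ℕ} {φ : cocycles (Sing (β.Q M)) n}
    (hφ : classOf _ n φ ∈ reducedH (β.conePoint M) n) (z : Chain (Sing B ⊗ Sing M.Space) n)
    (hz : boundary _ n z = 0) :
    pairing (cochainMap (trivSing β e he) n (cochainMap (singMap (β.toQ M)) n φ.1))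
      (chainMap (Sing B ◁ singMap M.map) n z) = 0 := by
  let z' := chainMap (singMap (assocOfProd β.principal e he M.Space)) n
    (chainMap (prodSing B M.Space) n z)
  have h1 := pairing_eq_zero_of_homotopic_const hφ (toQ_comp_truncMap_homotopic β M) z'
    (by rw [boundary_chainMap, boundary_chainMap, hz, map_zero, map_zero])
  rw [pairing_cochainMap, pairing_cochainMap, ← chainMap_comp, ← chainMap_comp]
  rw [← chainMap_comp, ← chainMap_comp] at h1
  exact h1

variable [ContinuousSMul G L]

/-- A cochain on `E` is a coboundary if its pullback to `B × L` is. -/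
theorem mem_coboundaries_of_trivSing (he' : IsPrincipalTrivialization e) {n : ℕ}
    {φ : Cochain (Sing E) n}
    (h : cochainMap (trivSing β e he) n φ ∈ coboundaries (Sing B ⊗ Sing L) n) :
    φ ∈ coboundaries (Sing E) n := by
  let R : C(E, B × L) := (prodOfAssoc β.principal e he he' L).comp
    (ContinuousMap.mk β.homeo.symm β.homeo.symm.continuous)
  have h1 := cochainMap_mem_coboundaries (singMap R ≫ singProd B L) n _ h
  have h2 : ((ContinuousMap.mk β.homeo β.homeo.continuous).comp
      (assocOfProd β.principal e he L)).comp R = ContinuousMap.id E := by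
    ext x
    exact (congr_arg β.homeo (assocOfProd_prodOfAssoc β.principal e he he' L _)).trans
      (β.homeo.apply_symm_apply x)
  have h3 : (singMap R ≫ singProd B L) ≫ trivSing β e he = 𝟙 (Sing E) := by
    have h4 : (singMap R ≫ singProd B L) ≫ trivSing β e he =
        singMap (((ContinuousMap.mk β.homeo β.homeo.continuous).comp
          (assocOfProd β.principal e he L)).comp R) := rfl
    rw [h4, h2]
    rfl
  have h5 : cochainMap ((singMap R ≫ singProd B L) ≫ trivSing β e he) n φ ∈
      coboundaries (Sing E) n := h1
  rw [h3] at h5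
  exact h5

/-- The cup product of classes pulled back from `Q_{≥k} E` and `Q_{≥l} E`, with `k + l = c + 1`,
vanishes. -/
theorem cup_pullback_toQ_eq_zero (c : ℕ) [CompactSpace L]
    [ChartedSpace (EuclideanSpace ℝ (Fin c)) L] (hβ : β.IsGlobalProduct) {l : ℤ}
    (hkl : k + l = c + 1) (N : MooreApproximation G L l) {p q n : ℕ} (h : p + q = n)
    {x : H (β.Q M) p} (hx : x ∈ reducedH (β.conePoint M) p) {y : H (β.Q N) q}
    (hy : y ∈ reducedH (β.conePoint N) q) :
    cup E h (pullback (β.toQ M) p x) (pullback (β.toQ N) q y) = 0 := by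
  obtain ⟨e, he, he'⟩ := hβ
  obtain ⟨φ, rfl⟩ := Submodule.mkQ_surjective _ x
  obtain ⟨ψ, rfl⟩ := Submodule.mkQ_surjective _ y
  refine classOf_eq_zero (Sing E) n _ (mem_coboundaries_of_trivSing β e he he' ?_)
  refine cochainCup_mem_coboundaries_of_vanishing c
    (fun r hr z hz => exists_boundary_of_compact_manifold c r hr z hz) hkl
    (singMap M.map) (singMap N.map) (fun r hr z hz => ?_) (fun r hr z hz => ?_) h
    (cochainMap_mem_cocycles (trivSing β e he) p _
      (cochainMap_mem_cocycles (singMap (β.toQ M)) p _ φ.2))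
    (cochainMap_mem_cocycles (trivSing β e he) q _
      (cochainMap_mem_cocycles (singMap (β.toQ N)) q _ ψ.2))
    (pairing_trivSing_eq_zero β M e he hx) (pairing_trivSing_eq_zero β N e he hy)
  · have := M.iso_of_lt r hr
    exact exists_cycle_of_isIso (TopCat.ofHom M.map) r z hz
  · have := N.iso_of_lt r hr
    exact exists_cycle_of_isIso (TopCat.ofHom N.map) r z hz

end

theorem cutoff_add_cutoff {p q : Perversity} (hpq : Complementary p q) (c : ℕ) :
    cutoff p c + cutoff q c = c + 1 := by
  have h := hpq (c + 1) (Nat.succ_pos c)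
  simp only [topPerversity, Nat.cast_add, Nat.cast_one] at h
  simp only [cutoff]
  omega

end Bundle

end LocalDuality

end

theorem mainTheorem6
    {G L B E : Type u} [Group G] [TopologicalSpace G] [IsTopologicalGroup G]
    (b c : ℕ)
    [TopologicalSpace B] [T2Space B] [CompactSpace B]
    [ChartedSpace (EuclideanSpace ℝ (Fin b)) B]
    [TopologicalSpace L] [T2Space L] [CompactSpace L]
    [ChartedSpace (EuclideanSpace ℝ (Fin c)) L]
    [MulAction G L] [ContinuousSMul G L]
    [TopologicalSpace E] (π : C(E, B))
    (β : LocalDuality.BundleStructure G L π) (hβ : β.IsGlobalProduct)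
    (p q : LocalDuality.Perversity) (hpq : LocalDuality.Complementary p q)
    (M : LocalDuality.MooreApproximation G L (LocalDuality.cutoff p c))
    (N : LocalDuality.MooreApproximation G L (LocalDuality.cutoff q c))
    (i : ℕ) :
    β.obstruction M N (b + c) i = {0} := by
  ext z
  unfold LocalDuality.BundleStructure.obstruction
  split_ifs with h
  · constructor
    · rintro ⟨x, hx, y, hy, rfl⟩
      exact LocalDuality.cup_pullback_toQ_eq_zero β M c hβ (LocalDuality.cutoff_add_cutoff hpq c) N
        _ hx hy
    · rintro rfl
      exact ⟨0, Submodule.zero_mem _, 0, Submodule.zero_mem _, by simp only [map_zero]⟩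
  · rfl
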